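/- Let $\Omega\subset\mathbb R^2$ be a bounded open set with Lipschitz boundary, star-shaped with respect to the origin, and let $h\ge 1$ be real. Let $C^{0,1}_c(\Omega)$ be the space of Lipschitz functions with compact support in $\Omega$, normed by $\|\varphi\|=\sup|\varphi|+\mathrm{Lip}(\varphi)$, and let $X=(C^{0,1}_c(\Omega))^*$ be its topological dual with the dual norm. **Ginzburg–Landau.** For $w\in H^1(\Omega;\mathbb R^2)$ and $\varepsilon>0$ let $GL_\varepsilon(w)=\int_\Omega \frac12|\nabla w|^2+\frac1{\varepsilon^2}(1-|w|)^2\,dx$, and let $Jw\in X$ be given by $\langle Jw,\varphi\rangle=\int_\Omega \det\nabla w\,\varphi\,dx$. **Lattice.** Let $\Omega_\varepsilon^0=\varepsilon\mathbb Z^2\cap\Omega$; let $\Omega^1_\varepsilon$ be the set of pairs $(i,j)\in\Omega_\varepsilon^0\times\Omega_\varepsilon^0$ with $|i-j|=\varepsilon$ and $i\le j$ componentwise; let $\Omega_\varepsilon^2=\{i\in\Omega_\varepsilon^0: i+[0,\varepsilon]^2\subset\Omega\}$. **Screw dislocations.** For $t\in\mathbb R$ let $P(t)$ be the integer nearest to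 $t$ (the one of smaller modulus if there are two). For $u:\Omega_\varepsilon^0\to\mathbb R$ let $\beta_{i,j}=(u(j)-u(i))-P(u(j)-u(i))$ and $SD_\varepsilon(u)=\frac12\sum_{(i,j)\in\Omega_\varepsilon^1}\beta_{i,j}^2=\frac12\sum_{(i,j)\in\Omega_\varepsilon^1}\mathrm{dist}^2(u(i)-u(j),\mathbb Z)$. For $i\in\Omega_\varepsilon^2$ let $$\alpha_u(i)=\beta_{i,i+(0,\varepsilon)}+\beta_{i+(0,\varepsilon),i+(\varepsilon,\varepsilon)}-\beta_{i+(\varepsilon,0),i+(\varepsilon,\varepsilon)}-\beta_{i,i+(\varepsilon,0)},$$ and let $\mu_u=\sum_{i\in\Omega_\varepsilon^2}\alpha_u(i)\,\delta_{i+\frac12(\varepsilon,\varepsilon)}$, regarded as an element of $X$. **XY spins.** For $v:\Omega_\varepsilon^0\to S^1$ let $XY_\varepsilon(v)=\frac12\sum_{(i,j)\in\Omega_\varepsilon^1}|v(i)-v(j)|^2$ and $\mu_v=\mu_{u}$ with $u=\frac1{2\pi}\theta(v)$, where $\theta(v)\in[0,2\pi)$ and $v=e^{i\theta(v)}$. **Energies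 of the singularities.** For $\mu\in X$ put (with $\inf\emptyset=+\infty$) $$\mathcal{GL}_\varepsilon(\mu)=\frac1{|\log\varepsilon|^h}\inf\Big\{GL_\varepsilon(w): w\in H^1(\Omega;\mathbb R^2),\ \frac{Jw}{\pi|\log\varepsilon|^{h-1}}=\mu\Big\},$$ $$\mathcal{XY}_\varepsilon(\mu)=\frac1{|\log\varepsilon|^h}\inf\Big\{XY_\varepsilon(v): v:\Omega_\varepsilon^0\to S^1,\ \frac{\mu_v}{|\log\varepsilon|^{h-1}}=\mu\Big\},$$ $$\mathcal{SD}_\varepsilon(\mu)=\frac{4\pi^2}{|\log\varepsilon|^h}\inf\Big\{SD_\varepsilon(u): u:\Omega_\varepsilon^0\to\mathbb R,\ \frac{\mu_u}{|\log\varepsilon|^{h-1}}=\mu\Big\}.$$ **Variational equivalence.** For families $(F_\varepsilon)_{\varepsilon>0}$, $(G_\varepsilon)_{\varepsilon>0}$ of functionals $X\to[0,+\infty]$ write $(G_\varepsilon)\preceq(F_\varepsilon)$ if there is a continuous strictly increasing function $\varepsilon\mapsto\delta_\varepsilon$ on $[0,\infty)$ with $\delta_0=0$ such that for every sequence $\varepsilon_n\to0$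 of positive numbers and every $(p_n)\subset X$ with $\sup_n F_{\varepsilon_n}(p_n)<\infty$ there is $(q_n)\subset X$ such that i) $\limsup_n\big(G_{\delta_{\varepsilon_n}}(q_n)-F_{\varepsilon_n}(p_n)\big)\le0$; ii) either both $(p_n)$ and $(q_n)$ are unbounded, or $\|p_n-q_n\|\to0$. The families are variationally equivalent if $(F_\varepsilon)\preceq(G_\varepsilon)$ and $(G_\varepsilon)\preceq(F_\varepsilon)$. **Theorem.** The families $(\mathcal{GL}_\varepsilon)$, $(\mathcal{XY}_\varepsilon)$ and $(\mathcal{SD}_\varepsilon)$ are pairwise variationally equivalent on $X$. -/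

import Mathlib

open Filter Topology MeasureTheory
open scoped ENNReal NNReal ContDiff

noncomputable section

namespace TopSing

/-- The Euclidean plane. -/
abbrev Plane : Type := EuclideanSpace ℝ (Fin 2)

/-! ### The domain -/

/-- `Ω` has Lipschitz boundary: near each boundary point, after a rotation (or reflection) of
the axes, `Ω` is the strict subgraph of a Lipschitz function of one variable. -/
def HasLipschitzBoundary (Ω : Set Plane) : Prop :=
  ∀ x ∈ frontier Ω, ∃ (r : ℝ) (R : Plane ≃ₗᵢ[ℝ] Plane) (K : ℝ≥0) (g : ℝ → ℝ),
    0 < r ∧ LipschitzWith K g ∧ ∀ y ∈ Metric.ball x r, y ∈ Ω ↔ R y 1 < g (R y 0)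

/-! ### Lipschitz functions with compact support in `Ω`, and their dual -/

/-- Lipschitz functions with compact support in `Ω`, extended by zero to the plane. -/
def lipSubmodule (Ω : Set Plane) : Submodule ℝ (Plane → ℝ) where
  carrier := {φ | (∃ K : ℝ≥0, LipschitzWith K φ) ∧ HasCompactSupport φ ∧ tsupport φ ⊆ Ω}
  zero_mem' := by
    refine ⟨⟨0, LipschitzWith.const 0⟩, HasCompactSupport.zero, ?_⟩
    have h0 : tsupport (0 : Plane → ℝ) = ∅ := by simp [tsupport]
    rw [h0]
    exact Set.empty_subset _
  add_mem' := by
    rintro φ ψ ⟨⟨K, hK⟩, hc, hs⟩ ⟨⟨L, hL⟩, hc', hs'⟩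
    exact ⟨⟨K + L, hK.add hL⟩, hc.add hc', (tsupport_add φ ψ).trans (Set.union_subset hs hs')⟩
  smul_mem' := by
    rintro c φ ⟨⟨K, hK⟩, hc, hs⟩
    refine ⟨⟨‖c‖₊ * K, ?_⟩, hc.smul_left, ?_⟩
    · exact (lipschitzWith_smul c).comp hK
    · exact (tsupport_smul_subset_right (fun _ => c) φ).trans hs

/-- The space `C^{0,1}_c(Ω)`. -/
def LipC (Ω : Set Plane) : Type := lipSubmodule Ω

namespace LipC

variable {Ω : Set Plane}

instance : AddCommGroup (LipC Ω) := inferInstanceAs (AddCommGroup (lipSubmodule Ω))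

instance : Module ℝ (LipC Ω) := inferInstanceAs (Module ℝ (lipSubmodule Ω))

instance : CoeFun (LipC Ω) (fun _ => Plane → ℝ) := ⟨fun φ => φ.1⟩

theorem add_apply (φ ψ : LipC Ω) (x : Plane) : (φ + ψ) x = φ x + ψ x := rfl

theorem smul_apply (c : ℝ) (φ : LipC Ω) (x : Plane) : (c • φ) x = c * φ x := rfl

theorem zero_apply (x : Plane) : (0 : LipC Ω) x = 0 := rfl

theorem continuous (φ : LipC Ω) : Continuous φ.1 := by
  obtain ⟨⟨K, hK⟩, -⟩ := φ.2
  exact hK.continuous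

/-- The supremum norm. -/
def supNorm (φ : LipC Ω) : ℝ := ⨆ x, |φ x|

/-- The best Lipschitz constant. -/
def lipConst (φ : LipC Ω) : ℝ := ⨆ p : Plane × Plane, |φ p.1 - φ p.2| / dist p.1 p.2

theorem bddAbove_abs (φ : LipC Ω) : BddAbove (Set.range fun x => |φ x|) := by
  obtain ⟨C, hC⟩ := φ.2.2.1.exists_bound_of_continuous φ.continuous
  refine ⟨C, ?_⟩
  rintro _ ⟨x, rfl⟩
  exact hC x

theorem bddAbove_quot (φ : LipC Ω) :
    BddAbove (Set.range fun p : Plane × Plane => |φ p.1 - φ p.2| / dist p.1 p.2) := by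
  obtain ⟨⟨K, hK⟩, -⟩ := φ.2
  refine ⟨K, ?_⟩
  rintro _ ⟨p, rfl⟩
  refine div_le_of_le_mul₀ dist_nonneg K.2 ?_
  have := hK.dist_le_mul p.1 p.2
  rwa [Real.dist_eq] at this

theorem abs_le_supNorm (φ : LipC Ω) (x : Plane) : |φ x| ≤ φ.supNorm :=
  le_ciSup φ.bddAbove_abs x

theorem quot_le_lipConst (φ : LipC Ω) (p : Plane × Plane) :
    |φ p.1 - φ p.2| / dist p.1 p.2 ≤ φ.lipConst :=
  le_ciSup φ.bddAbove_quot p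

theorem supNorm_nonneg (φ : LipC Ω) : 0 ≤ φ.supNorm :=
  (abs_nonneg _).trans (φ.abs_le_supNorm 0)

theorem lipConst_nonneg (φ : LipC Ω) : 0 ≤ φ.lipConst :=
  (by positivity : (0 : ℝ) ≤ |φ 0 - φ 0| / dist (0 : Plane) 0).trans (φ.quot_le_lipConst (0, 0))

instance : Norm (LipC Ω) := ⟨fun φ => φ.supNorm + φ.lipConst⟩

theorem norm_def (φ : LipC Ω) : ‖φ‖ = φ.supNorm + φ.lipConst := rfl

theorem abs_le_norm (φ : LipC Ω) (x : Plane) : |φ x| ≤ ‖φ‖ :=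
  (φ.abs_le_supNorm x).trans (le_add_of_nonneg_right φ.lipConst_nonneg)

theorem normCore : NormedSpace.Core ℝ (LipC Ω) where
  norm_nonneg φ := add_nonneg φ.supNorm_nonneg φ.lipConst_nonneg
  norm_smul c φ := by
    have h1 : (c • φ).supNorm = |c| * φ.supNorm := by
      unfold supNorm
      rw [Real.mul_iSup_of_nonneg (abs_nonneg c)]
      simp only [smul_apply, abs_mul]
    have h2 : (c • φ).lipConst = |c| * φ.lipConst := by
      unfold lipConst
      rw [Real.mul_iSup_of_nonneg (abs_nonneg c)]
      simp only [smul_apply, ← mul_sub, abs_mul, mul_div_assoc]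
    rw [norm_def, norm_def, h1, h2, Real.norm_eq_abs, mul_add]
  norm_triangle φ ψ := by
    have h1 : (φ + ψ).supNorm ≤ φ.supNorm + ψ.supNorm := by
      refine ciSup_le fun x => ?_
      rw [add_apply]
      exact (abs_add_le _ _).trans (add_le_add (φ.abs_le_supNorm x) (ψ.abs_le_supNorm x))
    have h2 : (φ + ψ).lipConst ≤ φ.lipConst + ψ.lipConst := by
      refine ciSup_le fun p => ?_
      refine le_trans ?_ (add_le_add (φ.quot_le_lipConst p) (ψ.quot_le_lipConst p))
      rw [← add_div, add_apply, add_apply, add_sub_add_comm]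
      exact div_le_div_of_nonneg_right (abs_add_le _ _) dist_nonneg
    rw [norm_def, norm_def, norm_def]
    linarith
  norm_eq_zero_iff φ := by
    constructor
    · intro h
      refine Subtype.ext (funext fun x => ?_)
      have hx := φ.abs_le_norm x
      rw [h] at hx
      exact abs_eq_zero.mp (le_antisymm hx (abs_nonneg _))
    · rintro rfl
      simp [norm_def, supNorm, lipConst, zero_apply]

/-- `C^{0,1}_c(Ω)` with the norm `sup |φ| + Lip(φ)`. -/
instance : NormedAddCommGroup (LipC Ω) := NormedAddCommGroup.ofCore normCore

instance : NormedSpace ℝ (LipC Ω) := NormedSpace.ofCore normCore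

end LipC

/-- The space `X`: the topological dual of `C^{0,1}_c(Ω)`, with the dual norm. -/
abbrev SingSpace (Ω : Set Plane) : Type := LipC Ω →L[ℝ] ℝ

/-- The Dirac mass at `y`, as an element of `X`. -/
def dirac (Ω : Set Plane) (y : Plane) : SingSpace Ω :=
  LinearMap.mkContinuous
    { toFun := fun φ : LipC Ω => φ y
      map_add' := fun _ _ => rfl
      map_smul' := fun _ _ => rfl } 1
    (fun φ => by rw [one_mul]; exact φ.abs_le_norm y)

/-! ### Ginzburg-Landau -/

/-- An element `w` of `H¹(Ω; ℝ²)` together with its weak gradient: `D a j` is the weak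
derivative of the component `w_a` in the direction `j`. -/
structure SobolevMap (Ω : Set Plane) where
  w : Plane → Plane
  D : Fin 2 → Fin 2 → Plane → ℝ
  memLp_w : MemLp w 2 (volume.restrict Ω)
  memLp_D : ∀ a j, MemLp (D a j) 2 (volume.restrict Ω)
  weak_deriv : ∀ ψ : Plane → ℝ, ContDiff ℝ ∞ ψ → HasCompactSupport ψ → tsupport ψ ⊆ Ω →
    ∀ a j, ∫ x in Ω, w x a * fderiv ℝ ψ x (EuclideanSpace.single j 1) =
      -∫ x in Ω, D a j x * ψ x

namespace SobolevMap

variable {Ω : Set Plane}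

/-- The pointwise Jacobian `det ∇w`. -/
def det (w : SobolevMap Ω) (x : Plane) : ℝ :=
  w.D 0 0 x * w.D 1 1 x - w.D 0 1 x * w.D 1 0 x

theorem integrable_det (w : SobolevMap Ω) : Integrable w.det (volume.restrict Ω) :=
  ((w.memLp_D 0 0).integrable_mul (w.memLp_D 1 1)).sub
    ((w.memLp_D 0 1).integrable_mul (w.memLp_D 1 0))

theorem integrable_det_mul (w : SobolevMap Ω) (φ : LipC Ω) :
    Integrable (fun x => w.det x * φ x) (volume.restrict Ω) :=
  w.integrable_det.mul_bdd (c := ‖φ‖) φ.continuous.aestronglyMeasurable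
    (Eventually.of_forall φ.abs_le_norm)

/-- The Jacobian `Jw` as an element of `X`: `⟨Jw, φ⟩ = ∫_Ω det ∇w · φ`. -/
def jac (w : SobolevMap Ω) : SingSpace Ω :=
  LinearMap.mkContinuous
    { toFun := fun φ : LipC Ω => ∫ x in Ω, w.det x * φ x
      map_add' := fun φ ψ => by
        rw [← integral_add (w.integrable_det_mul φ) (w.integrable_det_mul ψ)]
        simp only [LipC.add_apply, mul_add]
      map_smul' := fun c φ => by
        rw [RingHom.id_apply, smul_eq_mul, ← integral_const_mul]
        simp only [LipC.smul_apply, mul_left_comm] }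
    (∫ x in Ω, |w.det x|)
    (fun φ => by
      rw [← integral_mul_const]
      refine norm_integral_le_of_norm_le (w.integrable_det.abs.mul_const _)
        (Eventually.of_forall fun x => ?_)
      rw [norm_mul, Real.norm_eq_abs, Real.norm_eq_abs]
      exact mul_le_mul_of_nonneg_left (φ.abs_le_norm x) (abs_nonneg _))

/-- The Ginzburg-Landau energy `∫_Ω ½|∇w|² + ε⁻² (1 - |w|)²`. -/
def energy (ε : ℝ) (w : SobolevMap Ω) : ℝ≥0∞ :=
  ∫⁻ x in Ω, ENNReal.ofReal
    (1 / 2 * ∑ a, ∑ j, w.D a j x ^ 2 + 1 / ε ^ 2 * (1 - ‖w.w x‖) ^ 2)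

end SobolevMap

/-! ### The lattice `εℤ²`; the point `(εk₁, εk₂)` is labelled by `k ∈ ℤ²` -/

/-- The point of the lattice with label `k`. -/
def latticePt (ε : ℝ) (k : ℤ × ℤ) : Plane := !₂[ε * k.1, ε * k.2]

/-- The centre of the closed cell whose lower left corner has label `k`. -/
def cellCenter (ε : ℝ) (k : ℤ × ℤ) : Plane := !₂[ε * k.1 + ε / 2, ε * k.2 + ε / 2]

/-- `Ω_ε⁰`: the lattice points in `Ω`. -/
def Site (Ω : Set Plane) (ε : ℝ) : Type := {k : ℤ × ℤ // latticePt ε k ∈ Ω}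

/-- `Ω_ε¹`: the pairs `(i, j)` of nearest neighbours in `Ω_ε⁰` with `i ≤ j` componentwise. -/
def Bond (Ω : Set Plane) (ε : ℝ) : Type :=
  {b : Site Ω ε × Site Ω ε // b.2.1 = b.1.1 + (1, 0) ∨ b.2.1 = b.1.1 + (0, 1)}

/-- `Ω_ε²`: the lower left corners of the closed cells contained in `Ω`. -/
def cells (Ω : Set Plane) (ε : ℝ) : Set (ℤ × ℤ) :=
  {k | latticePt ε k ∈ Ω ∧ ∀ x : Plane, x 0 ∈ Set.Icc (ε * k.1) (ε * k.1 + ε) →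
    x 1 ∈ Set.Icc (ε * k.2) (ε * k.2 + ε) → x ∈ Ω}

/-! ### Screw dislocations -/

/-- The projection of `ℝ` on `ℤ`: the nearest integer, and the one of smaller modulus if there
are two. -/
def projInt (t : ℝ) : ℤ := if 0 ≤ t then ⌈t - 1 / 2⌉ else ⌊t + 1 / 2⌋

/-- The elastic part `t - P t` of a slip `t`. -/
def elastic (t : ℝ) : ℝ := t - projInt t

variable {Ω : Set Plane} {ε : ℝ}

/-- The energy `½ ∑_{(i,j)} |β^e_{i,j}|²` of a displacement `u : Ω_ε⁰ → ℝ`. -/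
def energySD (u : Site Ω ε → ℝ) : ℝ≥0∞ :=
  1 / 2 * ∑' b : Bond Ω ε, ENNReal.ofReal (elastic (u b.1.2 - u b.1.1) ^ 2)

/-- The elastic strain `β^e_{k,l}` on the bond from `k` to `l` (only meaningful if both ends are
sites; `u` is extended by zero). -/
def elasticStrain (u : Site Ω ε → ℝ) (k l : ℤ × ℤ) : ℝ :=
  elastic (Function.extend Subtype.val u 0 l - Function.extend Subtype.val u 0 k)

/-- The discrete dislocation function: the discrete curl of the elastic strain on the cell `k`. -/
def dislocation (u : Site Ω ε → ℝ) (k : ℤ × ℤ) : ℝ :=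
  elasticStrain u k (k + (0, 1)) + elasticStrain u (k + (0, 1)) (k + (1, 1))
    - elasticStrain u (k + (1, 0)) (k + (1, 1)) - elasticStrain u k (k + (1, 0))

/-- The measure `μ_u`, a finite sum of Dirac masses at centres of cells when `Ω` is bounded. -/
def dislocationMeasure (u : Site Ω ε → ℝ) : SingSpace Ω :=
  ∑ᶠ k ∈ cells Ω ε, dislocation u k • dirac Ω (cellCenter ε k)

/-! ### XY spins -/

/-- The energy `½ ∑_{(i,j)} |v(i) - v(j)|²` of a spin field `v : Ω_ε⁰ → S¹`. -/
def energyXY (v : Site Ω ε → Circle) : ℝ≥0∞ :=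
  1 / 2 * ∑' b : Bond Ω ε, ENNReal.ofReal (‖(v b.1.1 : ℂ) - (v b.1.2 : ℂ)‖ ^ 2)

/-- The phase in `[0, 2π)`. -/
def phase (z : Circle) : ℝ := toIcoMod Real.two_pi_pos 0 (Complex.arg z)

/-- The discrete vorticity measure `μ_v`. -/
def vorticityMeasure (v : Site Ω ε → Circle) : SingSpace Ω :=
  dislocationMeasure fun i => 1 / (2 * Real.pi) * phase (v i)

/-! ### The rescaled energies as functionals of the singularity -/

/-- The functional `𝒢ℒ_ε : X → [0, ∞]`. -/
def singGL (Ω : Set Plane) (h ε : ℝ) (μ : SingSpace Ω) : ℝ≥0∞ :=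
  (⨅ (w : SobolevMap Ω) (_ : (1 / (Real.pi * |Real.log ε| ^ (h - 1))) • w.jac = μ), w.energy ε)
    / ENNReal.ofReal (|Real.log ε| ^ h)

/-- The functional `𝒳𝒴_ε : X → [0, ∞]`. -/
def singXY (Ω : Set Plane) (h ε : ℝ) (μ : SingSpace Ω) : ℝ≥0∞ :=
  (⨅ (v : Site Ω ε → Circle)
      (_ : (1 / |Real.log ε| ^ (h - 1)) • vorticityMeasure v = μ), energyXY v)
    / ENNReal.ofReal (|Real.log ε| ^ h)

/-- The functional `𝒮𝒟_ε : X → [0, ∞]`. -/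
def singSD (Ω : Set Plane) (h ε : ℝ) (μ : SingSpace Ω) : ℝ≥0∞ :=
  ENNReal.ofReal (4 * Real.pi ^ 2) *
    (⨅ (u : Site Ω ε → ℝ)
      (_ : (1 / |Real.log ε| ^ (h - 1)) • dislocationMeasure u = μ), energySD u)
    / ENNReal.ofReal (|Real.log ε| ^ h)

/-! ### Variational equivalence -/

/-- The relation `(G_ε) ⪯ (F_ε)` between families of functionals on a metric space. -/
def VarLE {X : Type*} [PseudoMetricSpace X] (G F : ℝ → X → ℝ≥0∞) : Prop :=
  ∃ δ : ℝ → ℝ, ContinuousOn δ (Set.Ici 0) ∧ StrictMonoOn δ (Set.Ici 0) ∧ δ 0 = 0 ∧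
    ∀ (e : ℕ → ℝ) (p : ℕ → X), (∀ n, 0 < e n) → Tendsto e atTop (𝓝 0) →
      (∃ C : ℝ≥0, ∀ n, F (e n) (p n) ≤ C) →
      ∃ q : ℕ → X,
        limsup (fun n => (G (δ (e n)) (q n) : EReal) - (F (e n) (p n) : EReal)) atTop ≤ 0 ∧
        ((¬ Bornology.IsBounded (Set.range p) ∧ ¬ Bornology.IsBounded (Set.range q)) ∨
          Tendsto (fun n => dist (p n) (q n)) atTop (𝓝 0))

/-- Variational equivalence. -/
def VarEquiv {X : Type*} [PseudoMetricSpace X] (F G : ℝ → X → ℝ≥0∞) : Prop :=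
  VarLE F G ∧ VarLE G F

end TopSing

end

open Filter Topology MeasureTheory
open scoped ENNReal NNReal ContDiff

noncomputable section

namespace TopSing

section

/-! ### A uniform version of the relation `VarLE` -/

/-! The three models are compared in a cycle: a displacement yields a spin field, a spin field
yields a Sobolev map, and a Sobolev map yields a displacement. Each passage costs asymptotically no
renormalized energy and moves the singularity by a vanishing amount in the dual norm. The relation
`AsympLE` records this uniformly on sublevel sets. It is transitive and implies `VarLE`, so the
three arrows of the cycle give all six comparisons. The unbounded alternative in the definition of
`VarLE` is never needed.

Distances between measures rest on summation by parts (`abs_sum_curl_mul_le`): a discrete curl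
tested against a Lipschitz function is at most the lattice step times the sum of the bond variable
in absolute value. Quadratic errors on bonds therefore cost the step times the energy, which is
negligible since energies are powers of the logarithm.

SD to XY (same scale): take `v = exp(2πiu)`. A chord is shorter than its arc, and the singularities
differ only through ties in the rounding.

XY to GL (scale `δ ≫ ε`): interpolate the conjugate spins by a smoothed bilinear scheme with slopes
at most `1 + θ`. Convexity and the sharing of each bond between its two cells bound the Dirichlet
energy by `(1 + θ)²` times the spin energy, while the potential carries a factor `(ε/δ)²`. The
interpolant is controlled on full cells only, so it is composed with a deformation pushing `Ω` into
them (`exists_inward_field`, `exists_deformation`).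

GL to SD (scale `δ ≫ ε`): the same kind of deformation makes room for mollification and for a
translation of the lattice. By averaging, some translate of the grid of step `δ` carries edge energy
at most `E/δ`. On such edges the modulus is close to one, the phase can be lifted, and its
increments have energy at most `E/(1 - η)²`. The circulation of the current around a cell is twice
the integral of the Jacobian, which identifies the dislocations.

The new scale is `δ = ε (K + log⁺(1/ε))^K` with `K ≥ h + 1`: large enough that `(ε/δ)|log ε|^h → 0`,
small enough that `|log δ|/|log ε| → 1` and `δ|log ε|^h → 0`. -/

/-- Recovery of almost optimal competitors at scale `δ ε`, uniformly on sublevel sets. -/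
def AsympLE {X : Type*} [PseudoMetricSpace X] (G F : ℝ → X → ℝ≥0∞) : Prop :=
  ∃ δ : ℝ → ℝ, ContinuousOn δ (Set.Ici 0) ∧ StrictMonoOn δ (Set.Ici 0) ∧ δ 0 = 0 ∧
    ∀ (C : ℝ≥0) (η : ℝ), 0 < η → ∃ ε₀ > 0, ∀ ε, 0 < ε → ε < ε₀ → ∀ p, F ε p ≤ C →
      ∃ q, G (δ ε) q ≤ F ε p + ENNReal.ofReal η ∧ dist p q ≤ η

theorem AsympLE.trans {X : Type*} [PseudoMetricSpace X] {H G F : ℝ → X → ℝ≥0∞}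
    (hHG : AsympLE H G) (hGF : AsympLE G F) : AsympLE H F := by
  obtain ⟨δ₁, hc₁, hm₁, h0₁, h₁⟩ := hHG
  obtain ⟨δ₂, hc₂, hm₂, h0₂, h₂⟩ := hGF
  have hmaps : Set.MapsTo δ₂ (Set.Ici 0) (Set.Ici 0) := by
    intro x hx
    rw [Set.mem_Ici, ← h0₂]
    exact hm₂.monotoneOn (Set.mem_Ici.2 le_rfl) hx hx
  refine ⟨δ₁ ∘ δ₂, hc₁.comp hc₂ hmaps, hm₁.comp hm₂ hmaps, by simp [h0₁, h0₂], ?_⟩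
  intro C η hη
  -- The intermediate competitor may exceed the level `C`, but by at most one because its tolerance
  -- is capped at one.
  obtain ⟨ε₁, hε₁, H₁⟩ := h₁ (C + 1) (η / 2) (half_pos hη)
  obtain ⟨ε₂, hε₂, H₂⟩ := h₂ C (min (η / 2) 1) (by positivity)
  have hcont : Tendsto δ₂ (𝓝[Set.Ici 0] 0) (𝓝 0) := by
    have := hc₂ 0 (Set.mem_Ici.2 le_rfl)
    rwa [ContinuousWithinAt, h0₂] at this
  have hev : ∀ᶠ x in 𝓝[Set.Ici 0] 0, δ₂ x < ε₁ := hcont.eventually_lt_const hε₁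
  rw [eventually_nhdsWithin_iff, Metric.eventually_nhds_iff] at hev
  obtain ⟨ε₃, hε₃, H₃⟩ := hev
  refine ⟨min ε₂ ε₃, lt_min hε₂ hε₃, fun ε hε hlt p hp => ?_⟩
  obtain ⟨q, hq, hpq⟩ := H₂ ε hε (hlt.trans_le (min_le_left _ _)) p hp
  have hδpos : 0 < δ₂ ε := by
    rw [← h0₂]; exact hm₂ (Set.mem_Ici.2 le_rfl) hε.le hε
  have hδlt : δ₂ ε < ε₁ := by
    refine H₃ ?_ (Set.mem_Ici.2 hε.le)
    rw [Real.dist_eq, sub_zero, abs_of_pos hε]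
    exact hlt.trans_le (min_le_right _ _)
  have hqC : G (δ₂ ε) q ≤ ((C + 1 : ℝ≥0) : ℝ≥0∞) := by
    refine hq.trans ?_
    push_cast
    refine add_le_add hp ?_
    rw [← ENNReal.ofReal_one]
    exact ENNReal.ofReal_le_ofReal (min_le_right _ _)
  obtain ⟨r, hr, hqr⟩ := H₁ (δ₂ ε) hδpos hδlt q hqC
  refine ⟨r, ?_, ?_⟩
  · calc H ((δ₁ ∘ δ₂) ε) r ≤ G (δ₂ ε) q + ENNReal.ofReal (η / 2) := hr
      _ ≤ F ε p + ENNReal.ofReal (η / 2) + ENNReal.ofReal (η / 2) := by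
        refine add_le_add (hq.trans (add_le_add le_rfl ?_)) le_rfl
        exact ENNReal.ofReal_le_ofReal (min_le_left _ _)
      _ = F ε p + ENNReal.ofReal η := by
        rw [add_assoc, ← ENNReal.ofReal_add (by positivity) (by positivity), add_halves]
  · calc dist p r ≤ dist p q + dist q r := dist_triangle _ _ _
      _ ≤ η / 2 + η / 2 := add_le_add (hpq.trans (min_le_left _ _)) hqr
      _ = η := add_halves η

/-- One sequence has to serve all tolerances at once, so each `q n` is taken for an almost smallest
tolerance admissible at the index `n`. -/
theorem AsympLE.varLE {X : Type*} [PseudoMetricSpace X] {G F : ℝ → X → ℝ≥0∞}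
    (hGF : AsympLE G F) : VarLE G F := by
  obtain ⟨δ, hc, hm, h0, hδ⟩ := hGF
  refine ⟨δ, hc, hm, h0, ?_⟩
  rintro e p he helim ⟨C, hC⟩
  set P : ℕ → ℝ → Prop := fun n η =>
    ∃ q, G (δ (e n)) q ≤ F (e n) (p n) + ENNReal.ofReal η ∧ dist (p n) q ≤ η
  have hP : ∀ η > 0, ∀ᶠ n in atTop, P n η := by
    intro η hη
    obtain ⟨ε₀, hε₀, H⟩ := hδ C η hη
    filter_upwards [helim.eventually_lt_const hε₀] with n hn
    exact H (e n) (he n) hn (p n) (hC n)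
  have hex : ∀ n, ∃ q, ∀ η : ℝ, 0 < η → P n (η / 2) → (1 / ((n : ℝ) + 1) ≤ η / 2) →
      G (δ (e n)) q ≤ F (e n) (p n) + ENNReal.ofReal η ∧ dist (p n) q ≤ η := by
    intro n
    by_cases hne : ∃ η, 0 < η ∧ P n η
    · have hpos : (0 : ℝ) < 1 / ((n : ℝ) + 1) := by positivity
      -- The tolerance `η₀` lies within `1/(n+1)` of the infimum, hence below `η/2 + η/2` for every
      -- `η` concerned.
      obtain ⟨η₀, ⟨hη₀, hPη₀⟩, hlt⟩ := Real.lt_sInf_add_pos (s := {η | 0 < η ∧ P n η}) hne hpos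
      obtain ⟨q, hq1, hq2⟩ := hPη₀
      refine ⟨q, fun η hη hPη hn => ?_⟩
      have hle : η₀ ≤ η := by
        have : sInf {η | 0 < η ∧ P n η} ≤ η / 2 :=
          csInf_le ⟨0, fun y hy => hy.1.le⟩ ⟨half_pos hη, hPη⟩
        linarith
      exact ⟨hq1.trans (add_le_add le_rfl (ENNReal.ofReal_le_ofReal hle)), hq2.trans hle⟩
    · exact ⟨p n, fun η hη hPη _ => (hne ⟨η / 2, half_pos hη, hPη⟩).elim⟩
  choose q hq using hex
  have hmain : ∀ η > 0, ∀ᶠ n in atTop,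
      G (δ (e n)) (q n) ≤ F (e n) (p n) + ENNReal.ofReal η ∧ dist (p n) (q n) ≤ η := by
    intro η hη
    have h1 : ∀ᶠ n : ℕ in atTop, 1 / ((n : ℝ) + 1) < η / 2 :=
      tendsto_one_div_add_atTop_nhds_zero_nat.eventually_lt_const (half_pos hη)
    filter_upwards [hP (η / 2) (half_pos hη), h1] with n h2 h3
    exact hq n η hη h2 h3.le
  refine ⟨q, ?_, Or.inr ?_⟩
  · refine EReal.le_of_forall_lt_iff_le.1 fun z hz => ?_
    have hz' : 0 < z := by exact_mod_cast hz
    refine limsup_le_of_le (by isBoundedDefault) ?_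
    filter_upwards [hmain z hz'] with n hn
    have hF : F (e n) (p n) ≠ ⊤ := ne_top_of_le_ne_top ENNReal.coe_ne_top (hC n)
    refine EReal.sub_le_of_le_add ?_
    have := EReal.coe_ennreal_le_coe_ennreal_iff.2 hn.1
    refine this.trans ?_
    rw [EReal.coe_ennreal_add, EReal.coe_ennreal_ofReal, max_eq_left hz'.le, add_comm]
  · rw [Metric.tendsto_atTop]
    intro η hη
    obtain ⟨N, hN⟩ := eventually_atTop.1 (hmain (η / 2) (half_pos hη))
    refine ⟨N, fun n hn => ?_⟩
    rw [Real.dist_eq, sub_zero, abs_of_nonneg dist_nonneg]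
    linarith [(hN n hn).2]

end

/-! ### Lattice calculus and dual norms of discrete curls -/

section

/-! ### Elementary estimates in the plane and for Lipschitz functions -/

theorem dist_le_of_abs_sub_le {x y : Plane} {a b : ℝ} (h0 : |x 0 - y 0| ≤ a)
    (h1 : |x 1 - y 1| ≤ b) : dist x y ≤ a + b := by
  have ha : 0 ≤ a := (abs_nonneg _).trans h0
  have hb : 0 ≤ b := (abs_nonneg _).trans h1
  rw [EuclideanSpace.dist_eq, Fin.sum_univ_two, Real.dist_eq, Real.dist_eq]
  refine Real.sqrt_le_iff.2 ⟨by positivity, ?_⟩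
  have e0 : |x 0 - y 0| ^ 2 ≤ a ^ 2 := by gcongr
  have e1 : |x 1 - y 1| ^ 2 ≤ b ^ 2 := by gcongr
  nlinarith

theorem abs_coord_le_norm (x : Plane) (j : Fin 2) : |x j| ≤ ‖x‖ := by
  simpa using PiLp.norm_apply_le x j

theorem latticePt_zero (ε : ℝ) (k : ℤ × ℤ) : latticePt ε k 0 = ε * k.1 := rfl
theorem latticePt_one (ε : ℝ) (k : ℤ × ℤ) : latticePt ε k 1 = ε * k.2 := rfl
theorem cellCenter_zero (ε : ℝ) (k : ℤ × ℤ) : cellCenter ε k 0 = ε * k.1 + ε / 2 := rfl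
theorem cellCenter_one (ε : ℝ) (k : ℤ × ℤ) : cellCenter ε k 1 = ε * k.2 + ε / 2 := rfl

namespace LipC

variable {Ω : Set Plane}

theorem abs_sub_le (φ : LipC Ω) (x y : Plane) : |φ x - φ y| ≤ ‖φ‖ * dist x y := by
  rcases eq_or_ne x y with rfl | hxy
  · simp
  have hd : 0 < dist x y := dist_pos.2 hxy
  have := φ.quot_le_lipConst (x, y)
  rw [div_le_iff₀ hd] at this
  refine this.trans (mul_le_mul_of_nonneg_right ?_ dist_nonneg)
  rw [norm_def]
  exact le_add_of_nonneg_left φ.supNorm_nonneg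

theorem eq_zero_of_notMem (φ : LipC Ω) {x : Plane} (hx : x ∉ Ω) : φ x = 0 :=
  image_eq_zero_of_notMem_tsupport fun h => hx (φ.2.2.2 h)

theorem abs_le_of_notMem (φ : LipC Ω) (x : Plane) {y : Plane} (hy : y ∉ Ω) :
    |φ x| ≤ ‖φ‖ * dist x y := by
  have := φ.abs_sub_le x y
  rwa [φ.eq_zero_of_notMem hy, sub_zero] at this

end LipC

theorem SingSpace.dist_le {Ω : Set Plane} {S T : SingSpace Ω} {M : ℝ} (hM : 0 ≤ M)
    (h : ∀ φ : LipC Ω, |S φ - T φ| ≤ M * ‖φ‖) : dist S T ≤ M := by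
  rw [dist_eq_norm]
  exact ContinuousLinearMap.opNorm_le_bound _ hM fun φ => h φ

theorem SingSpace.norm_le {Ω : Set Plane} {T : SingSpace Ω} {M : ℝ} (hM : 0 ≤ M)
    (h : ∀ φ : LipC Ω, |T φ| ≤ M * ‖φ‖) : ‖T‖ ≤ M :=
  ContinuousLinearMap.opNorm_le_bound _ hM fun φ => h φ

/-! ### Sites, bonds and cells -/

variable {Ω : Set Plane} {ε : ℝ}

theorem mem_Icc_of_latticePt_mem {R : ℝ} (hR : ∀ x ∈ Ω, ‖x‖ ≤ R) (hε : 0 < ε) {k : ℤ × ℤ}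
    (hk : latticePt ε k ∈ Ω) :
    k ∈ (Finset.Icc ⌈-(R / ε)⌉ ⌊R / ε⌋) ×ˢ (Finset.Icc ⌈-(R / ε)⌉ ⌊R / ε⌋) := by
  have h0 := (abs_coord_le_norm _ 0).trans (hR _ hk)
  have h1 := (abs_coord_le_norm _ 1).trans (hR _ hk)
  rw [latticePt_zero, abs_le] at h0
  rw [latticePt_one, abs_le] at h1
  simp only [Finset.mem_product, Finset.mem_Icc, Int.ceil_le, Int.le_floor]
  have key : ∀ z : ℤ, -R ≤ ε * z ∧ ε * z ≤ R → -(R / ε) ≤ (z : ℝ) ∧ (z : ℝ) ≤ R / ε := by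
    intro z hz
    constructor
    · rw [← neg_div, div_le_iff₀ hε]; linarith
    · rw [le_div_iff₀ hε]; linarith
  exact ⟨key _ h0, key _ h1⟩

theorem finite_sites (hbdd : Bornology.IsBounded Ω) (hε : 0 < ε) :
    {k : ℤ × ℤ | latticePt ε k ∈ Ω}.Finite := by
  obtain ⟨R, hR⟩ := hbdd.exists_norm_le
  exact (Finset.finite_toSet _).subset fun k hk => mem_Icc_of_latticePt_mem hR hε hk

/-- The left ends of the horizontal bonds. -/
def hBonds (Ω : Set Plane) (ε : ℝ) : Set (ℤ × ℤ) :=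
  {k | latticePt ε k ∈ Ω ∧ latticePt ε (k + (1, 0)) ∈ Ω}

/-- The lower ends of the vertical bonds. -/
def vBonds (Ω : Set Plane) (ε : ℝ) : Set (ℤ × ℤ) :=
  {k | latticePt ε k ∈ Ω ∧ latticePt ε (k + (0, 1)) ∈ Ω}

theorem finite_hBonds (hbdd : Bornology.IsBounded Ω) (hε : 0 < ε) : (hBonds Ω ε).Finite :=
  (finite_sites hbdd hε).subset fun _ hk => hk.1

theorem finite_vBonds (hbdd : Bornology.IsBounded Ω) (hε : 0 < ε) : (vBonds Ω ε).Finite :=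
  (finite_sites hbdd hε).subset fun _ hk => hk.1

theorem finite_cells (hbdd : Bornology.IsBounded Ω) (hε : 0 < ε) : (cells Ω ε).Finite :=
  (finite_sites hbdd hε).subset fun _ hk => hk.1

/-- The number of sites is of order `ε⁻²`. -/
theorem exists_card_sites_le (hbdd : Bornology.IsBounded Ω) :
    ∃ N : ℝ, 0 < N ∧ ∀ ε : ℝ, 0 < ε → ε ≤ 1 → ∀ s : Finset (ℤ × ℤ),
      (∀ k ∈ s, latticePt ε k ∈ Ω) → (s.card : ℝ) ≤ N / ε ^ 2 := by
  obtain ⟨R, hR0, hR⟩ := hbdd.exists_pos_norm_le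
  refine ⟨(2 * R + 1) ^ 2, by positivity, fun ε hε hε1 s hs => ?_⟩
  have hsub : s ⊆ (Finset.Icc ⌈-(R / ε)⌉ ⌊R / ε⌋) ×ˢ (Finset.Icc ⌈-(R / ε)⌉ ⌊R / ε⌋) :=
    fun k hk => mem_Icc_of_latticePt_mem hR hε (hs k hk)
  have hcard := Finset.card_le_card hsub
  rw [Finset.card_product, Int.card_Icc] at hcard
  have h1 : (((⌊R / ε⌋ + 1 - ⌈-(R / ε)⌉).toNat : ℕ) : ℝ) ≤ (2 * R + 1) / ε := by
    have hnn : (0 : ℝ) ≤ (2 * R + 1) / ε := by positivity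
    rcases le_total 0 (⌊R / ε⌋ + 1 - ⌈-(R / ε)⌉) with h | h
    · have : (((⌊R / ε⌋ + 1 - ⌈-(R / ε)⌉).toNat : ℤ) : ℝ) ≤ (2 * R + 1) / ε := by
        rw [Int.toNat_of_nonneg h]
        push_cast
        have a1 := Int.floor_le (R / ε)
        have a2 := Int.le_ceil (-(R / ε))
        have a3 : 1 ≤ 1 / ε := by rw [le_div_iff₀ hε]; linarith
        have a4 : (2 * R + 1) / ε = 2 * (R / ε) + 1 / ε := by ring
        rw [a4]; linarith
      exact_mod_cast this
    · rw [Int.toNat_of_nonpos h]; simpa using hnn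
  calc (s.card : ℝ) ≤ (((⌊R / ε⌋ + 1 - ⌈-(R / ε)⌉).toNat : ℕ) : ℝ) *
        (((⌊R / ε⌋ + 1 - ⌈-(R / ε)⌉).toNat : ℕ) : ℝ) := by exact_mod_cast hcard
    _ ≤ (2 * R + 1) / ε * ((2 * R + 1) / ε) := by gcongr
    _ = (2 * R + 1) ^ 2 / ε ^ 2 := by ring

/-- Bonds split into horizontal and vertical ones, each labelled by its left or lower end. Energies
thus become finite real sums. -/
theorem tsum_bond (hbdd : Bornology.IsBounded Ω) (hε : 0 < ε)
    (F : ℤ × ℤ → ℤ × ℤ → ℝ≥0∞) :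
    ∑' b : Bond Ω ε, F b.1.1.1 b.1.2.1 =
      ∑ k ∈ (finite_hBonds hbdd hε).toFinset, F k (k + (1, 0)) +
        ∑ k ∈ (finite_vBonds hbdd hε).toFinset, F k (k + (0, 1)) := by
  let f : hBonds Ω ε ⊕ vBonds Ω ε → Bond Ω ε := fun s =>
    match s with
    | Sum.inl k => ⟨(⟨k.1, k.2.1⟩, ⟨k.1 + (1, 0), k.2.2⟩), Or.inl rfl⟩
    | Sum.inr k => ⟨(⟨k.1, k.2.1⟩, ⟨k.1 + (0, 1), k.2.2⟩), Or.inr rfl⟩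
  have hne : ∀ k : ℤ × ℤ, k + (1, 0) ≠ k + (0, 1) := by
    intro k h
    have := add_left_cancel h
    simp at this
  have hf : Function.Bijective f := by
    constructor
    · intro s t h
      have h1 : (f s).1.1.1 = (f t).1.1.1 := by rw [h]
      have h2 : (f s).1.2.1 = (f t).1.2.1 := by rw [h]
      rcases s with ⟨k, hk⟩ | ⟨k, hk⟩ <;> rcases t with ⟨l, hl⟩ | ⟨l, hl⟩ <;>
        change k = l at h1 <;> subst h1
      · rfl
      · exact (hne k h2).elim
      · exact (hne k h2.symm).elim
      · rfl
    · rintro ⟨⟨⟨k, hk⟩, ⟨l, hl⟩⟩, h⟩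
      rcases h with h | h <;> simp only at h <;> subst h
      · exact ⟨Sum.inl ⟨k, hk, hl⟩, rfl⟩
      · exact ⟨Sum.inr ⟨k, hk, hl⟩, rfl⟩
  rw [← (Equiv.ofBijective f hf).tsum_eq, ENNReal.summable.tsum_sum ENNReal.summable]
  congr 1
  · rw [← Finset.tsum_subtype]
    exact (Equiv.subtypeEquivRight (q := fun k => k ∈ (finite_hBonds hbdd hε).toFinset)
      (p := fun k => k ∈ hBonds Ω ε) (fun k => by simp)).tsum_eq
      (fun k : {k // k ∈ (finite_hBonds hbdd hε).toFinset} => F k.1 (k.1 + (1, 0)))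
  · rw [← Finset.tsum_subtype]
    exact (Equiv.subtypeEquivRight (q := fun k => k ∈ (finite_vBonds hbdd hε).toFinset)
      (p := fun k => k ∈ vBonds Ω ε) (fun k => by simp)).tsum_eq
      (fun k : {k // k ∈ (finite_vBonds hbdd hε).toFinset} => F k.1 (k.1 + (0, 1)))

/-- The sum of `x` over the horizontal bonds and of `y` over the vertical ones. -/
def bondSum (Ω : Set Plane) (ε : ℝ) (x y : ℤ × ℤ → ℝ) : ℝ :=
  ∑ᶠ k ∈ hBonds Ω ε, x k + ∑ᶠ k ∈ vBonds Ω ε, y k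

theorem bondSum_eq (hbdd : Bornology.IsBounded Ω) (hε : 0 < ε) (x y : ℤ × ℤ → ℝ) :
    bondSum Ω ε x y = ∑ k ∈ (finite_hBonds hbdd hε).toFinset, x k +
      ∑ k ∈ (finite_vBonds hbdd hε).toFinset, y k := by
  rw [bondSum, finsum_mem_eq_finite_toFinset_sum _ (finite_hBonds hbdd hε),
    finsum_mem_eq_finite_toFinset_sum _ (finite_vBonds hbdd hε)]

theorem bondSum_nonneg (hbdd : Bornology.IsBounded Ω) (hε : 0 < ε) {x y : ℤ × ℤ → ℝ}
    (hx : ∀ k, 0 ≤ x k) (hy : ∀ k, 0 ≤ y k) : 0 ≤ bondSum Ω ε x y := by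
  rw [bondSum_eq hbdd hε]
  exact add_nonneg (Finset.sum_nonneg fun k _ => hx k) (Finset.sum_nonneg fun k _ => hy k)

theorem bondSum_mono (hbdd : Bornology.IsBounded Ω) (hε : 0 < ε) {x y x' y' : ℤ × ℤ → ℝ}
    (hx : ∀ k ∈ hBonds Ω ε, x k ≤ x' k) (hy : ∀ k ∈ vBonds Ω ε, y k ≤ y' k) :
    bondSum Ω ε x y ≤ bondSum Ω ε x' y' := by
  rw [bondSum_eq hbdd hε, bondSum_eq hbdd hε]
  refine add_le_add (Finset.sum_le_sum fun k hk => hx k ?_)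
    (Finset.sum_le_sum fun k hk => hy k ?_) <;> simpa using hk

theorem bondSum_const_mul (hbdd : Bornology.IsBounded Ω) (hε : 0 < ε) (c : ℝ)
    (x y : ℤ × ℤ → ℝ) :
    bondSum Ω ε (fun k => c * x k) (fun k => c * y k) = c * bondSum Ω ε x y := by
  rw [bondSum_eq hbdd hε, bondSum_eq hbdd hε, mul_add, Finset.mul_sum, Finset.mul_sum]

theorem tsum_bond_ofReal (hbdd : Bornology.IsBounded Ω) (hε : 0 < ε)
    (F : ℤ × ℤ → ℤ × ℤ → ℝ) (hF : ∀ k l, 0 ≤ F k l) :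
    1 / 2 * ∑' b : Bond Ω ε, ENNReal.ofReal (F b.1.1.1 b.1.2.1) =
      ENNReal.ofReal (1 / 2 * bondSum Ω ε (fun k => F k (k + (1, 0)))
        (fun k => F k (k + (0, 1)))) := by
  rw [tsum_bond hbdd hε (fun k l => ENNReal.ofReal (F k l)), bondSum_eq hbdd hε,
    ← ENNReal.ofReal_sum_of_nonneg (fun k _ => hF _ _),
    ← ENNReal.ofReal_sum_of_nonneg (fun k _ => hF _ _),
    ← ENNReal.ofReal_add (Finset.sum_nonneg fun k _ => hF _ _)
      (Finset.sum_nonneg fun k _ => hF _ _), ENNReal.ofReal_mul (by norm_num)]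
  congr 1
  rw [ENNReal.ofReal_div_of_pos (by norm_num)]
  simp

theorem extend_site (u : Site Ω ε → ℝ) (i : Site Ω ε) :
    Function.extend Subtype.val u 0 i.1 = u i :=
  Subtype.val_injective.extend_apply _ _ _

theorem energySD_eq (hbdd : Bornology.IsBounded Ω) (hε : 0 < ε) (u : Site Ω ε → ℝ) :
    energySD u = ENNReal.ofReal (1 / 2 * bondSum Ω ε
      (fun k => elasticStrain u k (k + (1, 0)) ^ 2)
      (fun k => elasticStrain u k (k + (0, 1)) ^ 2)) := by
  rw [← tsum_bond_ofReal hbdd hε (fun k l => elasticStrain u k l ^ 2) (fun _ _ => sq_nonneg _),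
    energySD]
  simp only [elasticStrain, extend_site]

/-! ### Summation by parts on the lattice -/

/-- The circulation of a bond function around the cell `k`, in the orientation of
`dislocation`. -/
def curl (x y : ℤ × ℤ → ℝ) (k : ℤ × ℤ) : ℝ :=
  y k + x (k + (0, 1)) - y (k + (1, 0)) - x k

theorem dislocation_eq_curl (u : Site Ω ε → ℝ) (k : ℤ × ℤ) :
    dislocation u k = curl (fun k => elasticStrain u k (k + (1, 0)))
      (fun k => elasticStrain u k (k + (0, 1))) k := by
  simp only [dislocation, curl, add_assoc]
  norm_num

theorem dislocationMeasure_apply (hbdd : Bornology.IsBounded Ω) (hε : 0 < ε)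
    (u : Site Ω ε → ℝ) (φ : LipC Ω) :
    dislocationMeasure u φ =
      ∑ k ∈ (finite_cells hbdd hε).toFinset, dislocation u k * φ (cellCenter ε k) := by
  rw [dislocationMeasure, finsum_mem_eq_finite_toFinset_sum _ (finite_cells hbdd hε),
    sum_apply]
  rfl

theorem exists_notMem_of_notMem_cells (hε : 0 ≤ ε) {k : ℤ × ℤ} (hk : k ∉ cells Ω ε) :
    ∃ z : Plane, z 0 ∈ Set.Icc (ε * k.1) (ε * k.1 + ε) ∧
      z 1 ∈ Set.Icc (ε * k.2) (ε * k.2 + ε) ∧ z ∉ Ω := by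
  by_contra! hcon
  refine hk ⟨hcon _ ?_ ?_, hcon⟩
  · rw [latticePt_zero]; constructor <;> linarith
  · rw [latticePt_one]; constructor <;> linarith

/-- The values of `φ` at the centres of the cells, extended by zero. -/
def cellVal (φ : LipC Ω) (ε : ℝ) (k : ℤ × ℤ) : ℝ :=
  open Classical in if k ∈ cells Ω ε then φ (cellCenter ε k) else 0

/-- A square which is not a cell contains a point outside `Ω`, where `φ` vanishes. The coordinate
gaps from that point to a neighbouring centre add up to at most `ε + ε/2 + ε/2`. -/
theorem abs_cellCenter_le (hε : 0 ≤ ε) (φ : LipC Ω) {k l : ℤ × ℤ} (hk : k ∉ cells Ω ε)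
    (hkl : |k.1 - l.1| + |k.2 - l.2| ≤ 1) : |φ (cellCenter ε l)| ≤ 2 * ε * ‖φ‖ := by
  obtain ⟨z, h0, h1, hz⟩ := exists_notMem_of_notMem_cells hε hk
  refine (φ.abs_le_of_notMem (cellCenter ε l) hz).trans ?_
  rw [mul_comm]
  refine mul_le_mul_of_nonneg_right ?_ (norm_nonneg _)
  have key : ∀ (a b : ℤ) (t : ℝ), t ∈ Set.Icc (ε * a) (ε * a + ε) →
      |ε * b + ε / 2 - t| ≤ ε * |(a : ℝ) - b| + ε / 2 := by
    intro a b t ht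
    have h3 : |ε * b + ε / 2 - t| ≤ |ε * ((b : ℝ) - a)| + |ε * a + ε / 2 - t| := by
      rw [show ε * b + ε / 2 - t = ε * ((b : ℝ) - a) + (ε * a + ε / 2 - t) by ring]
      exact abs_add_le _ _
    have h4 : |ε * a + ε / 2 - t| ≤ ε / 2 := by
      rw [abs_le]; constructor <;> linarith [ht.1, ht.2]
    rw [abs_mul, abs_of_nonneg hε, abs_sub_comm (b : ℝ)] at h3
    linarith
  have hd := dist_le_of_abs_sub_le (x := cellCenter ε l) (y := z) (key _ _ _ h0) (key _ _ _ h1)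
  refine hd.trans ?_
  have : (|(k.1 : ℝ) - l.1| + |(k.2 : ℝ) - l.2|) ≤ 1 := by exact_mod_cast hkl
  nlinarith

/-- The jump created by extending the samples by zero is no larger than an ordinary difference of
neighbouring samples. This removes boundary terms from the summation by parts. -/
theorem abs_cellVal_sub_le (hε : 0 ≤ ε) (φ : LipC Ω) {k l : ℤ × ℤ}
    (hkl : |k.1 - l.1| + |k.2 - l.2| ≤ 1) :
    |cellVal φ ε k - cellVal φ ε l| ≤ 2 * ε * ‖φ‖ := by
  have hlk : |l.1 - k.1| + |l.2 - k.2| ≤ 1 := by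
    rwa [abs_sub_comm l.1, abs_sub_comm l.2]
  unfold cellVal
  split_ifs with hk hl hl
  · refine (φ.abs_sub_le _ _).trans ?_
    have hd : dist (cellCenter ε k) (cellCenter ε l) ≤
        ε * |(k.1 : ℝ) - l.1| + ε * |(k.2 : ℝ) - l.2| := by
      refine dist_le_of_abs_sub_le (le_of_eq ?_) (le_of_eq ?_)
      · rw [cellCenter_zero, cellCenter_zero, ← abs_of_nonneg hε, ← abs_mul, abs_of_nonneg hε]
        ring_nf
      · rw [cellCenter_one, cellCenter_one, ← abs_of_nonneg hε, ← abs_mul, abs_of_nonneg hε]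
        ring_nf
    have h1 : (|(k.1 : ℝ) - l.1| + |(k.2 : ℝ) - l.2|) ≤ 1 := by exact_mod_cast hkl
    have h2 : dist (cellCenter ε k) (cellCenter ε l) ≤ 2 * ε := by nlinarith
    rw [mul_comm]
    exact mul_le_mul_of_nonneg_right h2 (norm_nonneg _)
  · rw [sub_zero]; exact abs_cellCenter_le hε φ hl hlk
  · rw [zero_sub, abs_neg]; exact abs_cellCenter_le hε φ hk hkl
  · rw [sub_zero, abs_zero]; positivity

theorem latticePt_mem_of_mem_cells (hε : 0 ≤ ε) {k : ℤ × ℤ} (hk : k ∈ cells Ω ε) {i j : ℤ}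
    (hi : i = 0 ∨ i = 1) (hj : j = 0 ∨ j = 1) : latticePt ε (k + (i, j)) ∈ Ω := by
  refine hk.2 _ ?_ ?_
  · rw [latticePt_zero]
    rcases hi with rfl | rfl <;> simp [hε, mul_add]
  · rw [latticePt_one]
    rcases hj with rfl | rfl <;> simp [hε, mul_add]

theorem sum_shift_mul {C H : Finset (ℤ × ℤ)} (e : ℤ × ℤ) (x z : ℤ × ℤ → ℝ)
    (hz : ∀ k, k ∉ C → z k = 0) (hC : ∀ k ∈ C, k + e ∈ H) :
    ∑ k ∈ C, x (k + e) * z k = ∑ k ∈ H, x k * z (k - e) := by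
  have h1 : ∑ k ∈ C, x (k + e) * z k = ∑ k ∈ C.map (addRightEmbedding e), x k * z (k - e) := by
    rw [Finset.sum_map]
    simp
  rw [h1]
  refine Finset.sum_subset ?_ ?_
  · intro k hk
    obtain ⟨l, hl, rfl⟩ := Finset.mem_map.1 hk
    exact hC l hl
  · intro k _ hk
    rw [hz, mul_zero]
    intro hk'
    exact hk (Finset.mem_map.2 ⟨_, hk', by simp⟩)

/-- The flat norm of a discrete curl is controlled by the lattice spacing. -/
theorem abs_sum_curl_mul_le (hbdd : Bornology.IsBounded Ω) (hε : 0 < ε) (x y : ℤ × ℤ → ℝ)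
    (φ : LipC Ω) :
    |∑ k ∈ (finite_cells hbdd hε).toFinset, curl x y k * φ (cellCenter ε k)| ≤
      2 * ε * ‖φ‖ * bondSum Ω ε (fun k => |x k|) (fun k => |y k|) := by
  set C := (finite_cells hbdd hε).toFinset with hCdef
  set H := (finite_hBonds hbdd hε).toFinset with hHdef
  set W := (finite_vBonds hbdd hε).toFinset with hWdef
  set z := cellVal φ ε with hz
  have hzC : ∀ k, k ∉ C → z k = 0 := by
    intro k hk
    have : k ∉ cells Ω ε := by simpa [hCdef] using hk
    simp [hz, cellVal, this]
  have hmem : ∀ k ∈ C, k ∈ cells Ω ε := fun k hk => by simpa [hCdef] using hk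
  have hpt : ∀ k ∈ C, ∀ i j : ℤ, (i = 0 ∨ i = 1) → (j = 0 ∨ j = 1) →
      latticePt ε (k + (i, j)) ∈ Ω := fun k hk i j hi hj =>
    latticePt_mem_of_mem_cells hε.le (hmem k hk) hi hj
  have e1 : ∑ k ∈ C, curl x y k * φ (cellCenter ε k) =
      ∑ k ∈ C, y (k + 0) * z k + ∑ k ∈ C, x (k + (0, 1)) * z k
        - ∑ k ∈ C, y (k + (1, 0)) * z k - ∑ k ∈ C, x (k + 0) * z k := by
    rw [← Finset.sum_add_distrib, ← Finset.sum_sub_distrib, ← Finset.sum_sub_distrib]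
    refine Finset.sum_congr rfl fun k hk => ?_
    have : z k = φ (cellCenter ε k) := by simp [hz, cellVal, hmem k hk]
    rw [this, curl, add_zero]
    ring
  have hadd : ∀ (k : ℤ × ℤ) (a b c d : ℤ), k + (a, b) + (c, d) = k + (a + c, b + d) := by
    intro k a b c d; rw [add_assoc]; rfl
  rw [e1, sum_shift_mul (H := W) 0 y z hzC, sum_shift_mul (H := H) (0, 1) x z hzC,
    sum_shift_mul (H := W) (1, 0) y z hzC, sum_shift_mul (H := H) 0 x z hzC]
  -- Each bond value is now multiplied by the difference of `z` over the two cells sharing that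
  -- bond. Bonds near the boundary need no separate treatment, as `z` vanishes off the cells.
  · have e2 : ∑ k ∈ W, y k * z (k - 0) + ∑ k ∈ H, x k * z (k - (0, 1)) -
        ∑ k ∈ W, y k * z (k - (1, 0)) - ∑ k ∈ H, x k * z (k - 0) =
        ∑ k ∈ H, x k * (z (k - (0, 1)) - z k) + ∑ k ∈ W, y k * (z k - z (k - (1, 0))) := by
      simp only [mul_sub, Finset.sum_sub_distrib, sub_zero]
      ring
    rw [e2, bondSum_eq hbdd hε, mul_add, Finset.mul_sum, Finset.mul_sum]
    refine (abs_add_le _ _).trans (add_le_add ?_ ?_)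
    · refine (Finset.abs_sum_le_sum_abs _ _).trans (Finset.sum_le_sum fun k _ => ?_)
      rw [abs_mul, mul_comm]
      refine mul_le_mul_of_nonneg_right (abs_cellVal_sub_le hε.le φ ?_) (abs_nonneg _)
      simp
    · refine (Finset.abs_sum_le_sum_abs _ _).trans (Finset.sum_le_sum fun k _ => ?_)
      rw [abs_mul, mul_comm]
      refine mul_le_mul_of_nonneg_right (abs_cellVal_sub_le hε.le φ ?_) (abs_nonneg _)
      simp
  · intro k hk
    have h1 : latticePt ε (k + (0, 0)) ∈ Ω := hpt k hk 0 0 (Or.inl rfl) (Or.inl rfl)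
    have h2 := hpt k hk 1 0 (Or.inr rfl) (Or.inl rfl)
    rw [← Prod.zero_eq_mk] at h1
    simp only [hHdef, hBonds, Set.Finite.mem_toFinset, Set.mem_ofPred_eq]
    exact ⟨h1, by rwa [add_zero]⟩
  · intro k hk
    have h1 := hpt k hk 1 0 (Or.inr rfl) (Or.inl rfl)
    have h2 := hpt k hk 1 1 (Or.inr rfl) (Or.inr rfl)
    simp only [hWdef, vBonds, Set.Finite.mem_toFinset, Set.mem_ofPred_eq, hadd]
    exact ⟨h1, h2⟩
  · intro k hk
    have h1 := hpt k hk 0 1 (Or.inl rfl) (Or.inr rfl)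
    have h2 := hpt k hk 1 1 (Or.inr rfl) (Or.inr rfl)
    simp only [hHdef, hBonds, Set.Finite.mem_toFinset, Set.mem_ofPred_eq, hadd]
    exact ⟨h1, h2⟩
  · intro k hk
    have h1 : latticePt ε (k + (0, 0)) ∈ Ω := hpt k hk 0 0 (Or.inl rfl) (Or.inl rfl)
    have h2 := hpt k hk 0 1 (Or.inl rfl) (Or.inr rfl)
    rw [← Prod.zero_eq_mk] at h1
    simp only [hWdef, vBonds, Set.Finite.mem_toFinset, Set.mem_ofPred_eq]
    exact ⟨h1, by rwa [add_zero]⟩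

/-- A priori bound of the flat norm of the dislocation measure. -/
theorem exists_norm_dislocationMeasure_le (hbdd : Bornology.IsBounded Ω) :
    ∃ M : ℝ, 0 < M ∧ ∀ ε : ℝ, 0 < ε → ε ≤ 1 → ∀ (u : Site Ω ε → ℝ) (E : ℝ), 0 ≤ E →
      energySD u ≤ ENNReal.ofReal E → ‖dislocationMeasure u‖ ≤ M * √E := by
  obtain ⟨N, hN, hcard⟩ := exists_card_sites_le hbdd
  refine ⟨4 * √(2 * N), by positivity, fun ε hε hε1 u E h0 hE => ?_⟩
  refine SingSpace.norm_le (by positivity) fun φ => ?_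
  rw [dislocationMeasure_apply hbdd hε]
  simp only [dislocation_eq_curl]
  refine (abs_sum_curl_mul_le hbdd hε _ _ φ).trans ?_
  rw [energySD_eq hbdd hε] at hE
  set x := fun k => elasticStrain u k (k + (1, 0))
  set y := fun k => elasticStrain u k (k + (0, 1))
  have hE' : bondSum Ω ε (fun k => x k ^ 2) (fun k => y k ^ 2) ≤ 2 * E := by
    rw [ENNReal.ofReal_le_ofReal_iff h0] at hE
    linarith
  -- Cauchy–Schwarz over the `O(ε⁻²)` bonds. The resulting `ε⁻¹` is cancelled by the factor `ε` of
  -- the summation by parts.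
  have hbond : bondSum Ω ε (fun k => |x k|) (fun k => |y k|) ≤ 2 * (√(2 * N) / ε * √E) := by
    have key : ∀ (s : Finset (ℤ × ℤ)) (f : ℤ × ℤ → ℝ), (∀ k ∈ s, latticePt ε k ∈ Ω) →
        ∑ k ∈ s, f k ^ 2 ≤ 2 * E → ∑ k ∈ s, |f k| ≤ √(2 * N) / ε * √E := by
      intro s f hs hf
      have h1 : (∑ k ∈ s, |f k|) ^ 2 ≤ s.card * ∑ k ∈ s, |f k| ^ 2 := sq_sum_le_card_mul_sum_sq
      simp only [sq_abs] at h1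
      have h2 : (∑ k ∈ s, |f k|) ^ 2 ≤ N / ε ^ 2 * (2 * E) := by
        refine h1.trans (mul_le_mul (hcard ε hε hε1 s hs) hf ?_ (by positivity))
        exact Finset.sum_nonneg fun k _ => sq_nonneg _
      have h3 : √(2 * N) / ε * √E = √(N / ε ^ 2 * (2 * E)) := by
        rw [show N / ε ^ 2 * (2 * E) = (2 * N) / ε ^ 2 * E by ring,
          Real.sqrt_mul (x := 2 * N / ε ^ 2) (by positivity),
          Real.sqrt_div (x := 2 * N) (by positivity), Real.sqrt_sq hε.le]
      rw [h3]
      exact Real.le_sqrt_of_sq_le h2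
    rw [bondSum_eq hbdd hε] at hE' ⊢
    have a1 := Finset.sum_nonneg (s := (finite_hBonds hbdd hε).toFinset)
      (fun k _ => sq_nonneg (x k))
    have a2 := Finset.sum_nonneg (s := (finite_vBonds hbdd hε).toFinset)
      (fun k _ => sq_nonneg (y k))
    have b1 := key _ x (fun k hk => ((finite_hBonds hbdd hε).mem_toFinset.1 hk).1) (by linarith)
    have b2 := key _ y (fun k hk => ((finite_vBonds hbdd hε).mem_toFinset.1 hk).1) (by linarith)
    linarith
  calc 2 * ε * ‖φ‖ * bondSum Ω ε (fun k => |x k|) (fun k => |y k|)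
      ≤ 2 * ε * ‖φ‖ * (2 * (√(2 * N) / ε * √E)) := by gcongr
    _ = 4 * √(2 * N) * √E * ‖φ‖ := by field_simp; ring

end

/-! ### From screw dislocations to spins at the same scale -/

section

variable {Ω : Set Plane} {ε : ℝ}

/-! ### Elastic parts -/

theorem abs_elastic_le (t : ℝ) : |elastic t| ≤ 1 / 2 := by
  unfold elastic projInt
  split_ifs with h
  · have h1 := Int.le_ceil (t - 1 / 2)
    have h2 := Int.ceil_lt_add_one (t - 1 / 2)
    rw [abs_le]; constructor <;> linarith
  · have h1 := Int.floor_le (t + 1 / 2)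
    have h2 := Int.lt_floor_add_one (t + 1 / 2)
    rw [abs_le]; constructor <;> linarith

theorem elastic_eq_sub_int (t : ℝ) : ∃ n : ℤ, elastic t = t - n := ⟨projInt t, rfl⟩

/-- If `|b| < 1/2`, the integer has modulus below one, so `e = b`. Otherwise `|e - b| ≤ 2|b| ≤ 4b²`.
The point is that the error is quadratic, hence controlled by the energy. -/
theorem abs_sub_le_of_sub_int {e b : ℝ} (he : |e| ≤ 1 / 2) (n : ℤ) (hn : e - b = n) :
    |e - b| ≤ 4 * b ^ 2 := by
  rcases lt_or_ge |b| (1 / 2) with hb | hb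
  · have h1 : |e - b| < 1 := (abs_sub e b).trans_lt (by linarith)
    rw [hn, ← Int.cast_abs] at h1
    have h2 : |n| < 1 := by exact_mod_cast h1
    rw [Int.abs_lt_one_iff] at h2
    rw [hn, h2]
    simp only [Int.cast_zero, abs_zero]
    positivity
  · have h1 : |e - b| ≤ 2 * |b| := (abs_sub e b).trans (by linarith)
    rw [← sq_abs b]
    nlinarith [abs_nonneg b]

/-- A representative modulo `ℤ` of modulus at most `1/2` is a shortest one. -/
theorem sq_le_sq_of_sub_int {e b : ℝ} (he : |e| ≤ 1 / 2) (n : ℤ) (hn : e - b = n) :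
    e ^ 2 ≤ b ^ 2 := by
  rw [sq_le_sq]
  rcases lt_or_ge |b| (1 / 2) with hb | hb
  · have h1 : |e - b| < 1 := (abs_sub e b).trans_lt (by linarith)
    rw [hn, ← Int.cast_abs] at h1
    have h2 : |n| < 1 := by exact_mod_cast h1
    rw [Int.abs_lt_one_iff] at h2
    rw [h2, Int.cast_zero, sub_eq_zero] at hn
    rw [hn]
  · exact he.trans hb

theorem dist_dislocationMeasure_le (hbdd : Bornology.IsBounded Ω) (hε : 0 < ε)
    (u u' : Site Ω ε → ℝ) :
    dist (dislocationMeasure u) (dislocationMeasure u') ≤ 2 * ε * bondSum Ω ε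
      (fun k => |elasticStrain u k (k + (1, 0)) - elasticStrain u' k (k + (1, 0))|)
      (fun k => |elasticStrain u k (k + (0, 1)) - elasticStrain u' k (k + (0, 1))|) := by
  refine SingSpace.dist_le ?_ fun φ => ?_
  · exact mul_nonneg (by positivity) (bondSum_nonneg hbdd hε (fun _ => abs_nonneg _)
      (fun _ => abs_nonneg _))
  · have := abs_sum_curl_mul_le hbdd hε
      (fun k => elasticStrain u k (k + (1, 0)) - elasticStrain u' k (k + (1, 0)))
      (fun k => elasticStrain u k (k + (0, 1)) - elasticStrain u' k (k + (0, 1))) φ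
    rw [dislocationMeasure_apply hbdd hε, dislocationMeasure_apply hbdd hε,
      ← Finset.sum_sub_distrib]
    calc _ = _ := by
          congr 1
          refine Finset.sum_congr rfl fun k _ => ?_
          rw [← sub_mul, dislocation_eq_curl, dislocation_eq_curl]
          congr 1
          simp only [curl]
          ring
      _ ≤ _ := this
      _ = _ := by ring

/-! ### Almost minimizers -/

theorem exists_le_of_iInf_div {ι : Type*} {P : ι → Prop} {f : ι → ℝ≥0∞} {D : ℝ≥0∞} (hD0 : D ≠ 0)
    (hDt : D ≠ ⊤) {η : ℝ≥0∞} (hη : η ≠ 0) (h : (⨅ (i) (_ : P i), f i) / D ≠ ⊤) :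
    ∃ i, P i ∧ f i ≤ ((⨅ (i) (_ : P i), f i) / D + η) * D := by
  have h1 : (⨅ (i) (_ : P i), f i) / D < (⨅ (i) (_ : P i), f i) / D + η :=
    ENNReal.lt_add_right h hη
  have h2 : (⨅ (i) (_ : P i), f i) < ((⨅ (i) (_ : P i), f i) / D + η) * D :=
    (ENNReal.div_lt_iff (Or.inl hD0) (Or.inl hDt)).1 h1
  obtain ⟨i, hi⟩ := iInf_lt_iff.1 h2
  obtain ⟨hP, hi⟩ := iInf_lt_iff.1 hi
  exact ⟨i, hP, hi.le⟩

theorem abs_log_pos {ε : ℝ} (hε : 0 < ε) (hε1 : ε < 1) : 0 < |Real.log ε| :=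
  abs_pos.2 (Real.log_neg hε hε1).ne

/-- The constant `4π²` is moved to the denominator to match the form of `exists_le_of_iInf_div`. -/
theorem singSD_eq (Ω : Set Plane) (h : ℝ) {ε : ℝ} (hε : 0 < ε) (hε1 : ε < 1) (μ : SingSpace Ω) :
    singSD Ω h ε μ = (⨅ (u : Site Ω ε → ℝ)
      (_ : (1 / |Real.log ε| ^ (h - 1)) • dislocationMeasure u = μ), energySD u) /
        ENNReal.ofReal (|Real.log ε| ^ h / (4 * Real.pi ^ 2)) := by
  have hL := Real.rpow_pos_of_pos (abs_log_pos hε hε1) h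
  have hpi : 0 < 4 * Real.pi ^ 2 := by positivity
  rw [singSD, ENNReal.ofReal_div_of_pos hpi, mul_comm, mul_div_assoc, div_eq_mul_inv (iInf _),
    ENNReal.inv_div (Or.inl ENNReal.ofReal_ne_top) (Or.inl (ENNReal.ofReal_pos.2 hpi).ne')]

theorem singGL_le (h : ℝ) {ε : ℝ} (w : SobolevMap Ω) :
    singGL Ω h ε ((1 / (Real.pi * |Real.log ε| ^ (h - 1))) • w.jac) ≤
      w.energy ε / ENNReal.ofReal (|Real.log ε| ^ h) := by
  refine ENNReal.div_le_div_right ?_ _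
  exact iInf_le_of_le w (iInf_le _ rfl)

theorem singXY_le (h : ℝ) (v : Site Ω ε → Circle) :
    singXY Ω h ε ((1 / |Real.log ε| ^ (h - 1)) • vorticityMeasure v) ≤
      energyXY v / ENNReal.ofReal (|Real.log ε| ^ h) := by
  refine ENNReal.div_le_div_right ?_ _
  exact iInf_le_of_le v (iInf_le _ rfl)

theorem singSD_le (h : ℝ) (u : Site Ω ε → ℝ) :
    singSD Ω h ε ((1 / |Real.log ε| ^ (h - 1)) • dislocationMeasure u) ≤
      ENNReal.ofReal (4 * Real.pi ^ 2) * energySD u / ENNReal.ofReal (|Real.log ε| ^ h) := by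
  refine ENNReal.div_le_div_right (mul_le_mul' le_rfl ?_) _
  exact iInf_le_of_le u (iInf_le _ rfl)

/-! ### Spins and displacements -/

theorem circle_exp_phase (z : Circle) : Circle.exp (phase z) = z := by
  have h1 : phase z = Complex.arg z - toIcoDiv Real.two_pi_pos 0 (Complex.arg z) * (2 * Real.pi) := by
    rw [phase, toIcoMod, zsmul_eq_mul]
  rw [h1, Circle.exp_sub, Circle.exp_arg]
  have h2 : Circle.exp (toIcoDiv Real.two_pi_pos 0 (Complex.arg z) * (2 * Real.pi)) = 1 := by
    rw [Circle.exp_eq_one]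
    exact ⟨_, rfl⟩
  rw [h2, div_one]

theorem exists_phase_exp (t : ℝ) :
    ∃ n : ℤ, 1 / (2 * Real.pi) * phase (Circle.exp (2 * Real.pi * t)) = t + n := by
  have h := circle_exp_phase (Circle.exp (2 * Real.pi * t))
  rw [Circle.exp_eq_exp] at h
  obtain ⟨n, hn⟩ := h
  refine ⟨n, ?_⟩
  rw [hn]
  field_simp

/-- The chord is at most the arc, and the arc can be measured with any representative of `t - s`
modulo `ℤ`, in particular the elastic part. -/
theorem norm_circle_exp_sub_sq_le (s t : ℝ) :
    ‖(Circle.exp (2 * Real.pi * s) : ℂ) - (Circle.exp (2 * Real.pi * t) : ℂ)‖ ^ 2 ≤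
      4 * Real.pi ^ 2 * elastic (t - s) ^ 2 := by
  obtain ⟨n, hn⟩ := elastic_eq_sub_int (t - s)
  have h1 : (Circle.exp (2 * Real.pi * t)) =
      Circle.exp (2 * Real.pi * s) * Circle.exp (2 * Real.pi * elastic (t - s)) := by
    rw [← Circle.exp_add, Circle.exp_eq_exp]
    refine ⟨n, ?_⟩
    rw [hn]; ring
  have h2 : (Circle.exp (2 * Real.pi * s) : ℂ) - (Circle.exp (2 * Real.pi * t) : ℂ) =
      -((Circle.exp (2 * Real.pi * s) : ℂ) *
        ((Circle.exp (2 * Real.pi * elastic (t - s)) : ℂ) - 1)) := by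
    rw [h1, Circle.coe_mul]; ring
  rw [h2, norm_neg, norm_mul, Circle.norm_coe, one_mul, Circle.coe_exp, mul_comm _ Complex.I]
  have h3 := Real.norm_exp_I_mul_ofReal_sub_one_le (x := 2 * Real.pi * elastic (t - s))
  calc _ ≤ ‖2 * Real.pi * elastic (t - s)‖ ^ 2 := by gcongr
    _ = _ := by rw [Real.norm_eq_abs, sq_abs]; ring

theorem energyXY_exp_le (u : Site Ω ε → ℝ) :
    energyXY (fun i => Circle.exp (2 * Real.pi * u i)) ≤
      ENNReal.ofReal (4 * Real.pi ^ 2) * energySD u := by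
  rw [energyXY, energySD, mul_left_comm, ← ENNReal.tsum_mul_left (a := ENNReal.ofReal _)]
  refine mul_le_mul' le_rfl (ENNReal.tsum_le_tsum fun b => ?_)
  rw [← ENNReal.ofReal_mul (by positivity)]
  exact ENNReal.ofReal_le_ofReal (norm_circle_exp_sub_sq_le _ _)

/-- At each site `u` and the phase differ by an integer, so the strains can differ only at ties,
where rounding towards zero is not periodic. There the strain is `±1/2`, so the number of
exceptional bonds is bounded by the energy. -/
theorem dist_vorticityMeasure_exp_le (hbdd : Bornology.IsBounded Ω) (hε : 0 < ε)
    (u : Site Ω ε → ℝ) {E : ℝ} (hE : energySD u ≤ ENNReal.ofReal E) (hE0 : 0 ≤ E) :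
    dist (dislocationMeasure u) (vorticityMeasure fun i => Circle.exp (2 * Real.pi * u i)) ≤
      16 * ε * E := by
  refine (dist_dislocationMeasure_le hbdd hε _ _).trans ?_
  set u' : Site Ω ε → ℝ := fun i =>
    1 / (2 * Real.pi) * phase (Circle.exp (2 * Real.pi * u i)) with hu'
  rw [energySD_eq hbdd hε, ENNReal.ofReal_le_ofReal_iff hE0] at hE
  have key : ∀ k l : ℤ × ℤ, latticePt ε k ∈ Ω → latticePt ε l ∈ Ω →
      |elasticStrain u k l - elasticStrain u' k l| ≤ 4 * elasticStrain u k l ^ 2 := by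
    intro k l hk hl
    rw [abs_sub_comm]
    obtain ⟨m, hm⟩ := exists_phase_exp (u ⟨k, hk⟩)
    obtain ⟨n, hn⟩ := exists_phase_exp (u ⟨l, hl⟩)
    have e1 := extend_site u ⟨k, hk⟩
    have e2 := extend_site u ⟨l, hl⟩
    have e3 := extend_site u' ⟨k, hk⟩
    have e4 := extend_site u' ⟨l, hl⟩
    obtain ⟨a, ha⟩ := elastic_eq_sub_int (Function.extend Subtype.val u 0 l -
      Function.extend Subtype.val u 0 k)
    obtain ⟨b, hb⟩ := elastic_eq_sub_int (Function.extend Subtype.val u' 0 l -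
      Function.extend Subtype.val u' 0 k)
    refine abs_sub_le_of_sub_int (abs_elastic_le _) (n - m - b + a) ?_
    rw [elasticStrain, elasticStrain, ha, hb, e1, e2, e3, e4, hu']
    simp only [hm, hn]
    push_cast
    ring
  calc _ ≤ 2 * ε * bondSum Ω ε (fun k => 4 * elasticStrain u k (k + (1, 0)) ^ 2)
        (fun k => 4 * elasticStrain u k (k + (0, 1)) ^ 2) := by
        refine mul_le_mul_of_nonneg_left ?_ (by positivity)
        exact bondSum_mono hbdd hε (fun k hk => key _ _ hk.1 hk.2) (fun k hk => key _ _ hk.1 hk.2)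
    _ = 16 * ε * (1 / 2 * bondSum Ω ε (fun k => elasticStrain u k (k + (1, 0)) ^ 2)
        (fun k => elasticStrain u k (k + (0, 1)) ^ 2)) := by
        rw [bondSum_const_mul hbdd hε]; ring
    _ ≤ 16 * ε * E := by gcongr

theorem SingSpace.dist_smul {Ω : Set Plane} (c : ℝ) (S T : SingSpace Ω) :
    dist (c • S) (c • T) = |c| * dist S T := by
  have h : c • S - c • T = c • (S - T) := by
    ext φ
    change c * S φ - c * T φ = c * (S φ - T φ)
    ring
  rw [dist_eq_norm, dist_eq_norm, h]
  exact norm_smul c (S - T)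
theorem SingSpace.norm_smul {Ω : Set Plane} (c : ℝ) (S : SingSpace Ω) :
    ‖c • S‖ = |c| * ‖S‖ := by
  exact _root_.norm_smul c S

/-! ### Spin systems are dominated by screw dislocations -/

theorem asympLE_of_eventually {X : Type*} [PseudoMetricSpace X] {G F : ℝ → X → ℝ≥0∞} (δ : ℝ → ℝ)
    (hc : ContinuousOn δ (Set.Ici 0)) (hm : StrictMonoOn δ (Set.Ici 0)) (h0 : δ 0 = 0)
    (H : ∀ (C : ℝ≥0) (η : ℝ), 0 < η → ∀ᶠ ε in 𝓝[>] (0 : ℝ), ∀ p, F ε p ≤ C →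
      ∃ q, G (δ ε) q ≤ F ε p + ENNReal.ofReal η ∧ dist p q ≤ η) : AsympLE G F := by
  refine ⟨δ, hc, hm, h0, fun C η hη => ?_⟩
  have := H C η hη
  rw [eventually_nhdsWithin_iff, Metric.eventually_nhds_iff] at this
  obtain ⟨ε₀, hε₀, h⟩ := this
  refine ⟨ε₀, hε₀, fun ε hε hlt => h ?_ hε⟩
  rwa [Real.dist_eq, sub_zero, abs_of_pos hε]

theorem eventually_pos_lt {a : ℝ} (ha : 0 < a) : ∀ᶠ ε in 𝓝[>] (0 : ℝ), 0 < ε ∧ ε < a :=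
  Ioo_mem_nhdsGT ha

theorem tendsto_mul_abs_log_rpow (r : ℝ) :
    Tendsto (fun ε : ℝ => ε * |Real.log ε| ^ r) (𝓝[>] 0) (𝓝 0) := by
  have h1 : Tendsto (fun x : ℝ => x ^ r * Real.exp (-x)) atTop (𝓝 0) := by
    simpa using tendsto_rpow_mul_exp_neg_mul_atTop_nhds_zero r 1 one_pos
  have h2 : Tendsto (fun ε : ℝ => -Real.log ε) (𝓝[>] 0) atTop :=
    tendsto_neg_atBot_atTop.comp Real.tendsto_log_nhdsGT_zero
  refine (h1.comp h2).congr' ?_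
  filter_upwards [eventually_pos_lt one_pos] with ε hε
  rw [Function.comp_apply, neg_neg, Real.exp_log hε.1, abs_of_neg (Real.log_neg hε.1 hε.2), mul_comm]

theorem asympLE_singXY_singSD (hbdd : Bornology.IsBounded Ω) (h : ℝ) :
    AsympLE (singXY Ω h) (singSD Ω h) := by
  refine asympLE_of_eventually id continuousOn_id (strictMono_id.strictMonoOn _) rfl ?_
  intro C η hη
  -- The error `16 ε E / |log ε|^(h-1)` with `E ≤ (C + η)|log ε|^h` leaves one power of the
  -- logarithm.
  have hlim : Tendsto (fun ε : ℝ => 16 * (C + η) * (ε * |Real.log ε| ^ (1 : ℝ))) (𝓝[>] 0) (𝓝 0) := by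
    simpa using (tendsto_mul_abs_log_rpow 1).const_mul (16 * ((C : ℝ) + η))
  filter_upwards [eventually_pos_lt one_pos, hlim.eventually_lt_const hη] with ε ⟨hε, hε1⟩ hsmall
  intro p hp
  have hL := abs_log_pos hε hε1
  have hLh := Real.rpow_pos_of_pos hL h
  have hLh1 := Real.rpow_pos_of_pos hL (h - 1)
  have hp' := hp
  rw [singSD_eq Ω h hε hε1] at hp'
  obtain ⟨u, hu, hE⟩ := exists_le_of_iInf_div (η := ENNReal.ofReal η)
    (ENNReal.ofReal_pos.2 (by positivity)).ne' ENNReal.ofReal_ne_top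
    (ENNReal.ofReal_pos.2 hη).ne' (ne_top_of_le_ne_top ENNReal.coe_ne_top hp')
  rw [← singSD_eq Ω h hε hε1] at hE
  refine ⟨(1 / |Real.log ε| ^ (h - 1)) • vorticityMeasure fun i => Circle.exp (2 * Real.pi * u i),
    ?_, ?_⟩
  · refine (singXY_le h _).trans (ENNReal.div_le_of_le_mul ((energyXY_exp_le u).trans ?_))
    calc ENNReal.ofReal (4 * Real.pi ^ 2) * energySD u
        ≤ ENNReal.ofReal (4 * Real.pi ^ 2) * ((singSD Ω h ε p + ENNReal.ofReal η) *
          ENNReal.ofReal (|Real.log ε| ^ h / (4 * Real.pi ^ 2))) := by gcongr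
      _ = (singSD Ω h ε p + ENNReal.ofReal η) * ENNReal.ofReal (|Real.log ε| ^ h) := by
        rw [mul_left_comm, ← ENNReal.ofReal_mul (by positivity)]
        congr 2
        field_simp
  · have hE2 : energySD u ≤ ENNReal.ofReal ((C + η) * |Real.log ε| ^ h) := by
      rw [ENNReal.ofReal_mul (by positivity), ENNReal.ofReal_add (by positivity) hη.le,
        ENNReal.ofReal_coe_nnreal]
      refine hE.trans (mul_le_mul' (add_le_add hp le_rfl) (ENNReal.ofReal_le_ofReal ?_))
      refine div_le_self hLh.le ?_
      nlinarith [Real.pi_gt_three]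
    rw [← hu, SingSpace.dist_smul, abs_of_nonneg (by positivity)]
    refine (mul_le_mul_of_nonneg_left (dist_vorticityMeasure_exp_le hbdd hε u hE2 (by positivity))
      (by positivity)).trans (le_trans (le_of_eq ?_) hsmall.le)
    have : |Real.log ε| ^ h = |Real.log ε| ^ (h - 1) * |Real.log ε| ^ (1 : ℝ) := by
      rw [← Real.rpow_add hL]; ring_nf
    rw [this]
    field_simp

end

/-! ### Pushing a Lipschitz domain into itself and deforming maps -/

section

/-! ### Inward vector fields of Lipschitz domains -/

/-- A perturbation `v` changes the height of the point by at most `‖v‖` and that of the graph below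
it by at most `K‖v‖`; a descent of length `s` pays for both. -/
theorem mem_of_chart {Ω : Set Plane} {x : Plane} {r : ℝ} {R : Plane ≃ₗᵢ[ℝ] Plane} {K : ℝ≥0}
    {g : ℝ → ℝ} (hg : LipschitzWith K g)
    (h : ∀ y ∈ Metric.ball x r, y ∈ Ω ↔ R y 1 < g (R y 0)) {z v : Plane} {s : ℝ} (hzΩ : z ∈ Ω)
    (hz : z ∈ Metric.ball x r)
    (hz' : z + s • R.symm (EuclideanSpace.single 1 (-1)) + v ∈ Metric.ball x r)
    (hv : (1 + K) * ‖v‖ ≤ s) : z + s • R.symm (EuclideanSpace.single 1 (-1)) + v ∈ Ω := by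
  rw [h _ hz']
  have h0 := (h _ hz).1 hzΩ
  simp only [map_add, map_smul, LinearIsometryEquiv.apply_symm_apply, PiLp.add_apply,
    PiLp.smul_apply, PiLp.single_apply, smul_eq_mul]
  norm_num
  have hv0 : |R v 0| ≤ ‖v‖ := (abs_coord_le_norm _ 0).trans (R.norm_map v).le
  have hv1 : |R v 1| ≤ ‖v‖ := (abs_coord_le_norm _ 1).trans (R.norm_map v).le
  have hgd := hg.dist_le_mul (R z 0) (R z 0 + R v 0)
  rw [Real.dist_eq, Real.dist_eq, sub_add_cancel_left, abs_neg] at hgd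
  have h1 := (abs_le.1 hgd).2
  have h2 := (abs_le.1 hv1).2
  have h3 : (K : ℝ) * |R v 0| ≤ K * ‖v‖ := mul_le_mul_of_nonneg_left hv0 K.2
  linarith

/-- A connected set that meets `Ω` and misses its frontier cannot leave `Ω`. -/
theorem ball_subset_of_disjoint_frontier {Ω : Set Plane} {y : Plane} {ρ : ℝ} (hy : y ∈ Ω)
    (hρ : Disjoint (Metric.ball y ρ) (frontier Ω)) : Metric.ball y ρ ⊆ Ω := by
  rcases le_or_gt ρ 0 with h0 | h0
  · rw [Metric.ball_eq_empty.2 h0]; exact Set.empty_subset _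
  by_contra hcon
  obtain ⟨z, hz, hzΩ⟩ := Set.not_subset.1 hcon
  have hpre : IsPreconnected (Metric.ball y ρ) := (convex_ball y ρ).isPreconnected
  have hcover : Metric.ball y ρ ⊆ interior Ω ∪ (closure Ω)ᶜ := by
    intro w hw
    by_contra hcon
    rw [Set.mem_union, not_or, Set.mem_compl_iff, not_not] at hcon
    exact Set.disjoint_left.1 hρ hw ⟨hcon.2, hcon.1⟩
  have hyi : y ∈ interior Ω := (hcover (Metric.mem_ball_self h0)).resolve_right
    fun hy' => hy' (subset_closure hy)
  have hzc : z ∈ (closure Ω)ᶜ := (hcover hz).resolve_left fun hz' => hzΩ (interior_subset hz')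
  obtain ⟨w, -, hw1, hw2⟩ := hpre _ _ isOpen_interior isClosed_closure.isOpen_compl hcover
    ⟨y, Metric.mem_ball_self h0, hyi⟩ ⟨z, hz, hzc⟩
  exact hw2 (subset_closure (interior_subset hw1))

/-- A bounded Lipschitz domain has a smooth field pushing it into itself. -/
theorem exists_inward_field {Ω : Set Plane} (hbdd : Bornology.IsBounded Ω)
    (hlip : HasLipschitzBoundary Ω) :
    ∃ V : Plane → Plane, ContDiff ℝ ∞ V ∧ HasCompactSupport V ∧ ∃ c > 0, ∃ t₀ > 0,
      ∀ t : ℝ, 0 < t → t ≤ t₀ → ∀ y ∈ Ω, Metric.ball (y + t • V y) (c * t) ⊆ Ω := by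
  choose r R K g hr hg h using hlip
  let ι := {x // x ∈ frontier Ω}
  have hcpt : IsCompact (frontier Ω) :=
    Metric.isCompact_of_isClosed_isBounded isClosed_frontier
      (hbdd.closure.subset frontier_subset_closure)
  -- The bump is one on the quarter ball used in the covering and zero beyond half the radius; the
  -- other half leaves room for displacements inside the chart.
  let ψ : (i : ι) → ContDiffBump (i : Plane) := fun i =>
    ⟨r i i.2 / 4, r i i.2 / 2, by linarith [hr i i.2], by linarith [hr i i.2]⟩
  let d : ι → Plane := fun i => (R i i.2).symm (EuclideanSpace.single 1 (-1))
  have hd : ∀ i, ‖d i‖ = 1 := fun i => by simp [d]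
  obtain ⟨s, hs⟩ := hcpt.elim_finite_subcover (fun i : ι => Metric.ball (i : Plane) (r i i.2 / 4))
    (fun _ => Metric.isOpen_ball)
    (fun x hx => Set.mem_iUnion.2 ⟨⟨x, hx⟩, Metric.mem_ball_self (by linarith [hr x hx])⟩)
  have hU : IsOpen (⋃ i ∈ s, Metric.ball (i : Plane) (r i i.2 / 4)) :=
    isOpen_biUnion fun _ _ => Metric.isOpen_ball
  obtain ⟨ρ, hρ, hρU⟩ := hcpt.exists_thickening_subset_open hU hs
  set N : ℝ := (s.card : ℝ) with hN
  have hN0 : 0 ≤ N := Nat.cast_nonneg _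
  -- Chosen so that `c (1 + K_i) ≤ 1` for every chart `i`: a descent of length `t` in any one chart
  -- absorbs a perturbation shorter than `c t`.
  set c : ℝ := 1 / (1 + ∑ i ∈ s, (K i i.2 : ℝ)) with hc
  have hKsum : 0 ≤ ∑ i ∈ s, (K i i.2 : ℝ) := Finset.sum_nonneg fun i _ => (K i i.2).2
  have hcpos : 0 < c := by positivity
  have hc1 : c ≤ 1 := by
    rw [hc, div_le_one (by positivity)]; linarith
  obtain ⟨m, hm0, hm⟩ : ∃ m : ℝ, 0 < m ∧ ∀ i ∈ s, m ≤ r i i.2 / 2 := by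
    rcases s.eq_empty_or_nonempty with rfl | hne
    · exact ⟨1, one_pos, by simp⟩
    · refine ⟨s.inf' hne fun i => r i i.2 / 2, ?_, fun i hi => Finset.inf'_le _ hi⟩
      rw [Finset.lt_inf'_iff]
      exact fun i _ => by linarith [hr i i.2]
  -- All displacements below have length at most `t (N + 2)`; dividing by `N + 3` makes them
  -- strictly smaller than `ρ` and than every half radius.
  refine ⟨fun y => ∑ i ∈ s, ψ i y • d i, ?_, ?_, c, hcpos, min ρ m / (N + 3), by positivity, ?_⟩
  · exact ContDiff.sum fun i _ => (ψ i).contDiff.smul contDiff_const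
  · refine HasCompactSupport.intro (K := ⋃ i ∈ s, Metric.closedBall (i : Plane) (r i i.2 / 2))
      (s.isCompact_biUnion fun i _ => isCompact_closedBall _ _) fun x hx => ?_
    refine Finset.sum_eq_zero fun i hi => ?_
    have : x ∉ Metric.closedBall (i : Plane) (r i i.2 / 2) := fun hx' =>
      hx (Set.mem_biUnion hi hx')
    rw [(ψ i).zero_of_le_dist, zero_smul]
    rw [Metric.mem_closedBall, not_le] at this
    exact this.le
  · intro t ht ht0 y hy z hz
    have htN : t * (N + 3) ≤ min ρ m := by rwa [le_div_iff₀ (by positivity)] at ht0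
    have htρ := htN.trans (min_le_left _ _)
    have htm := htN.trans (min_le_right _ _)
    set v := z - (y + t • ∑ i ∈ s, ψ i y • d i) with hv
    have hvn : ‖v‖ < c * t := by rw [hv, ← dist_eq_norm]; exact hz
    have hct : c * t ≤ t := mul_le_of_le_one_left ht.le hc1
    have hzv : z = y + v + t • ∑ i ∈ s, ψ i y • d i := by rw [hv]; abel
    have hψ : ∀ i, ‖ψ i y • d i‖ ≤ 1 := fun i => by
      rw [norm_smul, hd, mul_one, Real.norm_of_nonneg (ψ i).nonneg]
      exact (ψ i).le_one
    have hsum : ∀ S : Finset ι, S ⊆ s → ‖t • ∑ i ∈ S, ψ i y • d i‖ ≤ t * N := by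
      intro S hS
      rw [norm_smul, Real.norm_of_nonneg ht.le]
      refine mul_le_mul_of_nonneg_left ((norm_sum_le _ _).trans ?_) ht.le
      refine (Finset.sum_le_card_nsmul _ _ 1 fun i _ => hψ i).trans ?_
      rw [nsmul_eq_mul, mul_one, hN]
      exact_mod_cast Finset.card_le_card hS
    by_cases hyU : y ∈ ⋃ i ∈ s, Metric.ball (i : Plane) (r i i.2 / 4)
    · obtain ⟨i₀, hi₀, hyi₀⟩ := Set.mem_iUnion₂.1 hyU
      have hψ1 : ψ i₀ y = 1 := (ψ i₀).one_of_mem_closedBall (Metric.ball_subset_closedBall hyi₀)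
      classical
      -- The descent with full weight in chart `i₀` pays for the perturbation `v`. The other
      -- descents are added one at a time, each in its own chart and with no further perturbation,
      -- so every intermediate point stays in `Ω`.
      have hind : ∀ S : Finset ι, S ⊆ s.erase i₀ →
          y + t • d i₀ + v + t • ∑ i ∈ S, ψ i y • d i ∈ Ω := by
        intro S
        induction S using Finset.induction_on with
        | empty =>
          intro _
          rw [Finset.sum_empty, smul_zero, add_zero]
          have hy2 : dist y i₀ < r i₀ i₀.2 / 4 := hyi₀
          refine mem_of_chart (hg _ _) (h i₀ i₀.2) hy ?_ ?_ ?_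
          · rw [Metric.mem_ball]; linarith [hr i₀ i₀.2]
          · rw [Metric.mem_ball]
            have h1 : dist (y + t • d i₀ + v) y ≤ 2 * t := by
              rw [dist_eq_norm, show y + t • d i₀ + v - y = t • d i₀ + v by abel]
              refine (norm_add_le _ _).trans ?_
              rw [norm_smul, hd, mul_one, Real.norm_of_nonneg ht.le]
              linarith
            have h2 := hm i₀ hi₀
            have h3 := dist_triangle (y + t • d i₀ + v) y i₀
            nlinarith
          · have h4 : (K i₀ i₀.2 : ℝ) ≤ ∑ i ∈ s, (K i i.2 : ℝ) :=
              Finset.single_le_sum (f := fun i : ι => (K i i.2 : ℝ)) (fun i _ => (K i i.2).2) hi₀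
            calc (1 + (K i₀ i₀.2 : ℝ)) * ‖v‖ ≤ (1 + ∑ i ∈ s, (K i i.2 : ℝ)) * (c * t) := by
                  gcongr
              _ = t := by rw [hc]; field_simp
        | insert j S hj ih =>
          intro hS
          have hjs : j ∈ s := Finset.mem_of_mem_erase (hS (Finset.mem_insert_self _ _))
          have hSs : S ⊆ s := fun i hi => Finset.mem_of_mem_erase (hS (Finset.mem_insert_of_mem hi))
          have hI := ih fun i hi => hS (Finset.mem_insert_of_mem hi)
          by_cases hψj : ψ j y = 0
          · rwa [Finset.sum_insert hj, hψj, zero_smul, zero_add]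
          have hyj : dist y j < r j j.2 / 2 := by
            by_contra hcon
            exact hψj ((ψ j).zero_of_le_dist (not_lt.1 hcon))
          have hclose : ∀ w : Plane, ‖w‖ ≤ t * (N + 2) → y + w ∈ Metric.ball (j : Plane) (r j j.2) := by
            intro w hw
            rw [Metric.mem_ball]
            have h1 : dist (y + w) y = ‖w‖ := by simp [dist_eq_norm]
            have h2 := hm j hjs
            have h3 := dist_triangle (y + w) y j
            nlinarith
          have hbase : ∀ S' : Finset ι, S' ⊆ s →
              ‖t • d i₀ + v + t • ∑ i ∈ S', ψ i y • d i‖ ≤ t * (N + 2) := by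
            intro S' hS'
            refine (norm_add_le _ _).trans ?_
            have h1 := hsum S' hS'
            have h2 : ‖t • d i₀ + v‖ ≤ 2 * t := by
              refine (norm_add_le _ _).trans ?_
              rw [norm_smul, hd, mul_one, Real.norm_of_nonneg ht.le]
              linarith
            linarith
          have heq : y + t • d i₀ + v + t • ∑ i ∈ insert j S, ψ i y • d i =
              (y + t • d i₀ + v + t • ∑ i ∈ S, ψ i y • d i) +
                (t * ψ j y) • (R j j.2).symm (EuclideanSpace.single 1 (-1)) + 0 := by
            rw [Finset.sum_insert hj, smul_add, smul_smul]
            change _ = _ + (t * ψ j y) • d j + 0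
            abel
          rw [heq]
          refine mem_of_chart (hg _ _) (h j j.2) hI ?_ ?_ ?_
          · have := hclose _ (hbase S hSs)
            rwa [← add_assoc, ← add_assoc] at this
          · rw [← heq]
            have := hclose _ (hbase (insert j S) (Finset.insert_subset hjs hSs))
            rwa [← add_assoc, ← add_assoc] at this
          · rw [norm_zero, mul_zero]
            exact mul_nonneg ht.le (ψ j).nonneg
      have := hind (s.erase i₀) subset_rfl
      rw [hzv, ← Finset.add_sum_erase s _ hi₀, hψ1, one_smul, smul_add]
      convert this using 1
      abel
    -- Outside the covering, `y` is at distance at least `ρ` from the frontier, further than the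
    -- total displacement.
    · refine ball_subset_of_disjoint_frontier (ρ := ρ) hy ?_ ?_
      · rw [Set.disjoint_left]
        intro w hw hwf
        exact hyU (hρU (Metric.mem_thickening_iff.2 ⟨w, hwf, by rwa [dist_comm]⟩))
      · rw [Metric.mem_ball, dist_eq_norm, hzv,
          show y + v + t • ∑ i ∈ s, ψ i y • d i - y = v + t • ∑ i ∈ s, ψ i y • d i by abel]
        refine (norm_add_le _ _).trans_lt ?_
        have := hsum s subset_rfl
        nlinarith

end

section

/-! ### Differentiable maps of the plane -/

theorem plane_eq_sum (v : Plane) :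
    v = v 0 • EuclideanSpace.single 0 1 + v 1 • EuclideanSpace.single 1 1 := by
  ext i
  fin_cases i <;> simp

theorem clm_apply_eq {E : Type*} [NormedAddCommGroup E] [NormedSpace ℝ E] (L : Plane →L[ℝ] E)
    (v : Plane) :
    L v = v 0 • L (EuclideanSpace.single 0 1) + v 1 • L (EuclideanSpace.single 1 1) := by
  conv_lhs => rw [plane_eq_sum v]
  rw [map_add, map_smul, map_smul]

/-- The partial derivative of the component `f_a` in the direction `j`. -/
def grad (f : Plane → Plane) (a j : Fin 2) (x : Plane) : ℝ :=
  fderiv ℝ f x (EuclideanSpace.single j 1) a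

/-- The Jacobian determinant. -/
def jacDet (f : Plane → Plane) (x : Plane) : ℝ :=
  grad f 0 0 x * grad f 1 1 x - grad f 0 1 x * grad f 1 0 x

/-- The squared Frobenius norm of the gradient. -/
def gradSq (f : Plane → Plane) (x : Plane) : ℝ := ∑ a, ∑ j, grad f a j x ^ 2

/-- The Ginzburg-Landau energy density. -/
def glDensity (ε : ℝ) (f : Plane → Plane) (x : Plane) : ℝ :=
  1 / 2 * gradSq f x + 1 / ε ^ 2 * (1 - ‖f x‖) ^ 2

theorem gradSq_eq (f : Plane → Plane) (x : Plane) : gradSq f x =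
    grad f 0 0 x ^ 2 + grad f 0 1 x ^ 2 + grad f 1 0 x ^ 2 + grad f 1 1 x ^ 2 := by
  simp only [gradSq, Fin.sum_univ_two]; ring

theorem gradSq_nonneg (f : Plane → Plane) (x : Plane) : 0 ≤ gradSq f x := by
  rw [gradSq_eq]; positivity

theorem glDensity_nonneg (ε : ℝ) (f : Plane → Plane) (x : Plane) : 0 ≤ glDensity ε f x := by
  have := gradSq_nonneg f x
  unfold glDensity; positivity

theorem abs_jacDet_le (f : Plane → Plane) (x : Plane) : |jacDet f x| ≤ 1 / 2 * gradSq f x := by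
  rw [jacDet, gradSq_eq, abs_le]
  constructor
  · nlinarith [sq_nonneg (grad f 0 0 x + grad f 1 1 x), sq_nonneg (grad f 0 1 x - grad f 1 0 x)]
  · nlinarith [sq_nonneg (grad f 0 0 x - grad f 1 1 x), sq_nonneg (grad f 0 1 x + grad f 1 0 x)]

theorem abs_jacDet_le_glDensity (ε : ℝ) (f : Plane → Plane) (x : Plane) :
    |jacDet f x| ≤ glDensity ε f x :=
  (abs_jacDet_le f x).trans (le_add_of_nonneg_right (by positivity))

theorem continuous_grad {f : Plane → Plane} (hf : ContDiff ℝ 1 f) (a j : Fin 2) :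
    Continuous (grad f a j) := by
  have h : Continuous fun x => fderiv ℝ f x (EuclideanSpace.single j 1) :=
    (hf.continuous_fderiv one_ne_zero).clm_apply continuous_const
  exact (EuclideanSpace.proj a).continuous.comp h

theorem continuous_jacDet {f : Plane → Plane} (hf : ContDiff ℝ 1 f) : Continuous (jacDet f) :=
  ((continuous_grad hf 0 0).mul (continuous_grad hf 1 1)).sub
    ((continuous_grad hf 0 1).mul (continuous_grad hf 1 0))

theorem clm_det_eq (L : Plane →L[ℝ] Plane) :
    L.det = L (EuclideanSpace.single 0 1) 0 * L (EuclideanSpace.single 1 1) 1 -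
      L (EuclideanSpace.single 1 1) 0 * L (EuclideanSpace.single 0 1) 1 := by
  have h := LinearMap.det_toMatrix (EuclideanSpace.basisFun (Fin 2) ℝ).toBasis
    (L : Plane →ₗ[ℝ] Plane)
  rw [ContinuousLinearMap.det, ← h, Matrix.det_fin_two]
  simp [LinearMap.toMatrix_apply]

theorem jacDet_eq_det (f : Plane → Plane) (x : Plane) : jacDet f x = (fderiv ℝ f x).det := by
  rw [clm_det_eq]; rfl

theorem integrableOn_of_continuous {Ω : Set Plane} (hbdd : Bornology.IsBounded Ω) {F : Plane → ℝ}
    (hF : Continuous F) : IntegrableOn F Ω :=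
  (hF.continuousOn.integrableOn_compact hbdd.isCompact_closure).mono_set subset_closure

theorem memLp_two_of_continuous {E : Type*} [NormedAddCommGroup E] {Ω : Set Plane}
    (hbdd : Bornology.IsBounded Ω) {F : Plane → E} (hF : Continuous F)
    [SecondCountableTopologyEither Plane E] :
    MemLp F 2 (volume.restrict Ω) := by
  have hfin : IsFiniteMeasure (volume.restrict (closure Ω)) :=
    ⟨by rw [Measure.restrict_apply_univ]; exact hbdd.isCompact_closure.measure_lt_top⟩
  obtain ⟨C, hC⟩ := hbdd.isCompact_closure.exists_bound_of_continuousOn hF.continuousOn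
  exact (MemLp.of_bound hF.aestronglyMeasurable C
    (ae_restrict_of_forall_mem isClosed_closure.measurableSet hC)).mono_measure
    (Measure.restrict_mono subset_closure le_rfl)

theorem fderiv_component {f : Plane → Plane} (hf : ContDiff ℝ 1 f) (a : Fin 2) (x v : Plane) :
    fderiv ℝ (fun y => f y a) x v = fderiv ℝ f x v a := by
  have h := (EuclideanSpace.proj a : Plane →L[ℝ] ℝ).hasFDerivAt.comp x
    ((hf.differentiable one_ne_zero) x).hasFDerivAt
  rw [show (fun y => f y a) = (EuclideanSpace.proj a : Plane →L[ℝ] ℝ) ∘ f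
    from rfl, h.fderiv]
  rfl

/-- A `C¹` map as an element of `H¹(Ω; ℝ²)`. -/
def SobolevMap.ofContDiff {Ω : Set Plane} (hbdd : Bornology.IsBounded Ω) (f : Plane → Plane)
    (hf : ContDiff ℝ 1 f) : SobolevMap Ω where
  w := f
  D := grad f
  memLp_w := memLp_two_of_continuous hbdd hf.continuous
  memLp_D a j := memLp_two_of_continuous hbdd (continuous_grad hf a j)
  weak_deriv ψ hψ hψc hψs a j := by
    have hψ1 : ContDiff ℝ 1 ψ := hψ.of_le (by exact_mod_cast le_top)
    have hfa : ContDiff ℝ 1 fun y => f y a :=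
      (EuclideanSpace.proj a : Plane →L[ℝ] ℝ).contDiff.comp hf
    have hcψ' : Continuous fun x => fderiv ℝ ψ x (EuclideanSpace.single j 1) :=
      (hψ1.continuous_fderiv one_ne_zero).clm_apply continuous_const
    have hsupp' : ∀ x, x ∉ tsupport ψ → fderiv ℝ ψ x (EuclideanSpace.single j 1) = 0 := by
      intro x hx
      have : fderiv ℝ ψ x = 0 := image_eq_zero_of_notMem_tsupport fun h =>
        hx (tsupport_fderiv_subset ℝ h)
      rw [this]; rfl
    have hcomp' : HasCompactSupport fun x => fderiv ℝ ψ x (EuclideanSpace.single j 1) :=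
      HasCompactSupport.intro hψc hsupp'
    have h1 : ∫ x in Ω, f x a * fderiv ℝ ψ x (EuclideanSpace.single j 1) =
        ∫ x, f x a * fderiv ℝ ψ x (EuclideanSpace.single j 1) := by
      refine setIntegral_eq_integral_of_forall_compl_eq_zero fun x hx => ?_
      rw [hsupp' x fun h => hx (hψs h), mul_zero]
    have h2 : ∫ x in Ω, grad f a j x * ψ x = ∫ x, grad f a j x * ψ x := by
      refine setIntegral_eq_integral_of_forall_compl_eq_zero fun x hx => ?_
      rw [image_eq_zero_of_notMem_tsupport fun h => hx (hψs h), mul_zero]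
    have hg : ∀ x, grad f a j x = fderiv ℝ (fun y => f y a) x (EuclideanSpace.single j 1) :=
      fun x => (fderiv_component hf a x _).symm
    rw [h1, h2]
    simp only [hg]
    refine integral_mul_fderiv_eq_neg_fderiv_mul_of_integrable ?_ ?_ ?_
      (fun x _ => (hfa.differentiable one_ne_zero) x)
      (fun x _ => (hψ1.differentiable one_ne_zero) x)
    · simp only [← hg]
      exact ((continuous_grad hf a j).mul hψ1.continuous).integrable_of_hasCompactSupport
        hψc.mul_left
    · exact (hfa.continuous.mul hcψ').integrable_of_hasCompactSupport hcomp'.mul_left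
    · exact (hfa.continuous.mul hψ1.continuous).integrable_of_hasCompactSupport hψc.mul_left

theorem SobolevMap.energy_ofContDiff {Ω : Set Plane} (hbdd : Bornology.IsBounded Ω)
    (f : Plane → Plane) (hf : ContDiff ℝ 1 f) (ε : ℝ) :
    (SobolevMap.ofContDiff hbdd f hf).energy ε =
      ∫⁻ x in Ω, ENNReal.ofReal (glDensity ε f x) := rfl

/-! ### Deformations of the plane -/

theorem grad_comp {f Ψ : Plane → Plane} {B : Plane →L[ℝ] Plane} {x : Plane} {t : ℝ}
    (hf : DifferentiableAt ℝ f (Ψ x))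
    (hΨ : HasFDerivAt Ψ (ContinuousLinearMap.id ℝ Plane + t • B) x) (a j : Fin 2) :
    grad (f ∘ Ψ) a j x = grad f a j (Ψ x) +
      t * (B (EuclideanSpace.single j 1) 0 * grad f a 0 (Ψ x) +
        B (EuclideanSpace.single j 1) 1 * grad f a 1 (Ψ x)) := by
  rw [grad, (hf.hasFDerivAt.comp x hΨ).fderiv]
  simp only [ContinuousLinearMap.comp_apply, add_apply,
    ContinuousLinearMap.id_apply, smul_apply, map_add, map_smul]
  rw [clm_apply_eq (fderiv ℝ f (Ψ x)) (B (EuclideanSpace.single j 1))]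
  rfl

/-- Young's inequality with weight `t`: `(G + tH)² ≤ (1 + t)G² + (t + t²)H²`, where `H` is bounded
by the gradient times the norm of `B`. -/
theorem gradSq_comp_le {f Ψ : Plane → Plane} {B : Plane →L[ℝ] Plane} {x : Plane} {t L : ℝ}
    (ht : 0 < t) (ht1 : t ≤ 1) (hB : ‖B‖ ≤ L) (hf : DifferentiableAt ℝ f (Ψ x))
    (hΨ : HasFDerivAt Ψ (ContinuousLinearMap.id ℝ Plane + t • B) x) :
    gradSq (f ∘ Ψ) x ≤ (1 + (1 + 8 * L ^ 2) * t) * gradSq f (Ψ x) := by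
  have hL : 0 ≤ L := (norm_nonneg _).trans hB
  have hb : ∀ i j : Fin 2, B (EuclideanSpace.single j 1) i ^ 2 ≤ L ^ 2 := by
    intro i j
    rw [← sq_abs]
    have h1 : |B (EuclideanSpace.single j 1) i| ≤ L := by
      refine (abs_coord_le_norm _ i).trans ((B.le_opNorm _).trans ?_)
      simpa using hB
    gcongr
  have key : ∀ a j : Fin 2, grad (f ∘ Ψ) a j x ^ 2 ≤ (1 + t) * grad f a j (Ψ x) ^ 2 +
      (t + t ^ 2) * (2 * L ^ 2) * (grad f a 0 (Ψ x) ^ 2 + grad f a 1 (Ψ x) ^ 2) := by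
    intro a j
    rw [grad_comp hf hΨ]
    set G := grad f a j (Ψ x)
    set G0 := grad f a 0 (Ψ x)
    set G1 := grad f a 1 (Ψ x)
    set b0 := B (EuclideanSpace.single j 1) 0
    set b1 := B (EuclideanSpace.single j 1) 1
    have h1 : (G + t * (b0 * G0 + b1 * G1)) ^ 2 ≤
        (1 + t) * G ^ 2 + (t + t ^ 2) * (b0 * G0 + b1 * G1) ^ 2 := by
      nlinarith [mul_nonneg ht.le (sq_nonneg (G - (b0 * G0 + b1 * G1)))]
    have h2 : (b0 * G0 + b1 * G1) ^ 2 ≤ (2 * L ^ 2) * (G0 ^ 2 + G1 ^ 2) := by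
      have e0 : b0 ^ 2 * G0 ^ 2 ≤ L ^ 2 * G0 ^ 2 :=
      mul_le_mul_of_nonneg_right (hb 0 j) (sq_nonneg _)
      have e1 : b1 ^ 2 * G1 ^ 2 ≤ L ^ 2 * G1 ^ 2 :=
      mul_le_mul_of_nonneg_right (hb 1 j) (sq_nonneg _)
      nlinarith [sq_nonneg (b0 * G0 - b1 * G1)]
    have h3 := mul_le_mul_of_nonneg_left h2 (show 0 ≤ t + t ^ 2 by positivity)
    linarith
  have hsum : gradSq (f ∘ Ψ) x ≤ (1 + t) * gradSq f (Ψ x) +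
      (t + t ^ 2) * (4 * L ^ 2) * gradSq f (Ψ x) := by
    rw [gradSq_eq, gradSq_eq]
    linarith [key 0 0, key 0 1, key 1 0, key 1 1]
  refine hsum.trans ?_
  rw [← add_mul]
  refine mul_le_mul_of_nonneg_right ?_ (gradSq_nonneg _ _)
  nlinarith [mul_nonneg (sq_nonneg L) (mul_nonneg ht.le (sub_nonneg.2 ht1))]

theorem le_det_id_add_smul {B : Plane →L[ℝ] Plane} {t L : ℝ} (ht : 0 < t) (ht1 : t ≤ 1)
    (hB : ‖B‖ ≤ L) :
    1 - (2 * L + 2 * L ^ 2) * t ≤ (ContinuousLinearMap.id ℝ Plane + t • B).det := by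
  have hL : 0 ≤ L := (norm_nonneg _).trans hB
  have hb : ∀ i j : Fin 2, |B (EuclideanSpace.single j 1) i| ≤ L := by
    intro i j
    refine (abs_coord_le_norm _ i).trans ((B.le_opNorm _).trans ?_)
    simpa using hB
  rw [clm_det_eq]
  simp only [add_apply, ContinuousLinearMap.id_apply,
    smul_apply, PiLp.add_apply, PiLp.smul_apply, PiLp.single_apply,
    smul_eq_mul]
  norm_num
  set p := B (EuclideanSpace.single 0 1) 0
  set q := B (EuclideanSpace.single 1 1) 1
  set r := B (EuclideanSpace.single 1 1) 0
  set s := B (EuclideanSpace.single 0 1) 1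
  have hp : |p| ≤ L := hb 0 0
  have hq : |q| ≤ L := hb 1 1
  have h1 : |p * q| ≤ L * L := by rw [abs_mul]; exact mul_le_mul hp hq (abs_nonneg _) hL
  have h2 : |r * s| ≤ L * L := by
    rw [abs_mul]; exact mul_le_mul (hb 0 1) (hb 1 0) (abs_nonneg _) hL
  have e1 := (abs_le.1 h1).1
  have e2 := (abs_le.1 h2).2
  have e3 := (abs_le.1 hp).1
  have e4 := (abs_le.1 hq).1
  have htt : t ^ 2 ≤ t := by nlinarith
  have e5 : t * (-L) ≤ t * p := mul_le_mul_of_nonneg_left e3 ht.le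
  have e6 : t * (-L) ≤ t * q := mul_le_mul_of_nonneg_left e4 ht.le
  have e7 : t ^ 2 * (-(2 * (L * L))) ≤ t ^ 2 * (p * q - r * s) :=
    mul_le_mul_of_nonneg_left (by linarith) (sq_nonneg t)
  have e8 : t ^ 2 * (2 * (L * L)) ≤ t * (2 * (L * L)) :=
    mul_le_mul_of_nonneg_right htt (by positivity)
  linarith

/-- Quantitative properties of a deformation close to the identity. -/
structure IsDeformation (Ψ : Plane ≃ₜ Plane) (s t C : ℝ) : Prop where
  contDiff : ContDiff ℝ ∞ Ψ
  dist_le : ∀ x, dist (Ψ x) x ≤ s + C * t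
  energy_le : ∀ f : Plane → Plane, ContDiff ℝ 1 f → ∀ (ε : ℝ) (A : Set Plane), MeasurableSet A →
    ∫⁻ x in A, ENNReal.ofReal (glDensity ε (f ∘ Ψ) x) ≤
      ENNReal.ofReal (1 + C * t) * ∫⁻ x in Ψ '' A, ENNReal.ofReal (glDensity ε f x)
  integral_jacDet : ∀ f : Plane → Plane, ContDiff ℝ 1 f → ∀ (φ : Plane → ℝ) (A : Set Plane),
    MeasurableSet A →
    ∫ x in A, jacDet (f ∘ Ψ) x * φ x = ∫ x in Ψ '' A, jacDet f x * φ (Ψ.symm x)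

/-- For small `t` the field `tV` has Lipschitz constant at most `1/2`, so `id + tV` is a
homeomorphism. Its Jacobian is positive and at least `1 - bt`, so energies grow by a factor `1 +
O(t)`. Integrals of Jacobians are transported exactly, since determinants multiply. The translation
acts first because it later encodes a shift of the lattice. -/
theorem exists_deformation {V : Plane → Plane} (hV : ContDiff ℝ ∞ V) (hVc : HasCompactSupport V) :
    ∃ C > 0, ∃ t₁ > 0, ∀ t, 0 < t → t ≤ t₁ → ∀ τ : Plane, ∃ Ψ : Plane ≃ₜ Plane,
      (∀ x, Ψ x = x + τ + t • V (x + τ)) ∧ IsDeformation Ψ ‖τ‖ t C := by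
  have hV1 : ContDiff ℝ 1 V := hV.of_le (by exact_mod_cast le_top)
  obtain ⟨L, hL⟩ := hV1.lipschitzWith_of_hasCompactSupport hVc one_ne_zero
  obtain ⟨M, hM⟩ := hVc.exists_bound_of_continuous hV.continuous
  have hM0 : 0 ≤ M := (norm_nonneg _).trans (hM 0)
  have hL0 : (0 : ℝ) ≤ L := L.2
  have hfd : ∀ x, ‖fderiv ℝ V x‖ ≤ L := fun x => norm_fderiv_le_of_lipschitz ℝ hL
  set a : ℝ := 1 + 8 * (L : ℝ) ^ 2 with ha
  set b : ℝ := 2 * (L : ℝ) + 2 * (L : ℝ) ^ 2 with hb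
  have ha0 : 0 < a := by positivity
  have hb0 : 0 ≤ b := by positivity
  -- The first three terms come from `(1 + at)(1 + 2bt)` with `t² ≤ t`, and `M` bounds the
  -- displacement. The bound on `t` forces `tL` and `tb` below `1/2`.
  refine ⟨a + 2 * b + 2 * a * b + M, by positivity, 1 / (2 * (1 + L + b)), by positivity, ?_⟩
  intro t ht ht1 τ
  rw [le_div_iff₀ (by positivity)] at ht1
  have htb : t * b ≤ 1 / 2 := by nlinarith
  have htL : t * L ≤ 1 / 2 := by nlinarith
  have ht1' : t ≤ 1 := by nlinarith
  set Φ : Plane → Plane := fun x => x + t • V x with hΦ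
  have happrox : ApproximatesLinearOn Φ
      ((ContinuousLinearEquiv.refl ℝ Plane : Plane ≃L[ℝ] Plane) : Plane →L[ℝ] Plane) Set.univ
      (Real.toNNReal (1 / 2)) := by
    intro x _ y _
    have : Φ x - Φ y - ((ContinuousLinearEquiv.refl ℝ Plane : Plane ≃L[ℝ] Plane) :
        Plane →L[ℝ] Plane) (x - y) = t • (V x - V y) := by
      simp only [hΦ, ContinuousLinearEquiv.coe_coe, ContinuousLinearEquiv.refl_apply, smul_sub]
      abel
    rw [this, norm_smul, Real.norm_of_nonneg ht.le, Real.coe_toNNReal _ (by norm_num)]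
    have h1 := hL.dist_le_mul x y
    rw [dist_eq_norm, dist_eq_norm] at h1
    calc t * ‖V x - V y‖ ≤ t * (L * ‖x - y‖) := by gcongr
      _ = (t * L) * ‖x - y‖ := by ring
      _ ≤ 1 / 2 * ‖x - y‖ := by gcongr
  have hcinv : Real.toNNReal (1 / 2) <
      ‖((ContinuousLinearEquiv.refl ℝ Plane).symm : Plane →L[ℝ] Plane)‖₊⁻¹ := by
    have h1 : ‖((ContinuousLinearEquiv.refl ℝ Plane).symm : Plane →L[ℝ] Plane)‖₊ = 1 := by
      rw [← NNReal.coe_inj, coe_nnnorm]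
      exact ContinuousLinearMap.norm_id
    rw [h1, inv_one, ← NNReal.coe_lt_coe, Real.coe_toNNReal _ (by norm_num)]
    norm_num
  let Φh : Plane ≃ₜ Plane := happrox.toHomeomorph Φ (Or.inr hcinv)
  have hΦh : ∀ x, Φh x = Φ x := fun x => rfl
  let Ψ : Plane ≃ₜ Plane := (Homeomorph.addRight τ).trans Φh
  have hΨ : ∀ x, Ψ x = x + τ + t • V (x + τ) := fun x => rfl
  have hΨfun : (Ψ : Plane → Plane) = fun x => x + τ + t • V (x + τ) := funext hΨ
  have hder : ∀ x, HasFDerivAt Ψ (ContinuousLinearMap.id ℝ Plane + t • fderiv ℝ V (x + τ)) x := by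
    intro x
    rw [hΨfun]
    have h1 : HasFDerivAt (fun x : Plane => x + τ) (ContinuousLinearMap.id ℝ Plane) x :=
      (hasFDerivAt_id x).add_const τ
    have h2 := ((hV1.differentiable one_ne_zero) (x + τ)).hasFDerivAt.comp x h1
    exact h1.add (h2.const_smul t)
  have hdet : ∀ x, 1 - b * t ≤
      (ContinuousLinearMap.id ℝ Plane + t • fderiv ℝ V (x + τ)).det := fun x =>
    le_det_id_add_smul ht ht1' (hfd _)
  have hdetpos : ∀ x, 0 <
      (ContinuousLinearMap.id ℝ Plane + t • fderiv ℝ V (x + τ)).det := fun x => by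
    have := hdet x; nlinarith
  refine ⟨Ψ, hΨ, ⟨?_, ?_, ?_, ?_⟩⟩
  · rw [hΨfun]
    have h1 : ContDiff ℝ ∞ fun x : Plane => x + τ := contDiff_id.add contDiff_const
    exact h1.add ((hV.comp h1).const_smul t)
  · intro x
    rw [hΨ, dist_eq_norm, show x + τ + t • V (x + τ) - x = τ + t • V (x + τ) by abel]
    refine (norm_add_le _ _).trans (add_le_add le_rfl ?_)
    rw [norm_smul, Real.norm_of_nonneg ht.le, mul_comm]
    refine mul_le_mul_of_nonneg_right ((hM _).trans ?_) ht.le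
    have : 0 ≤ a + 2 * b + 2 * a * b := by positivity
    linarith
  · intro f hf ε A hA
    rw [lintegral_image_eq_lintegral_abs_det_fderiv_mul volume hA
      (fun x _ => (hder x).hasFDerivWithinAt) Ψ.injective.injOn,
      ← lintegral_const_mul' _ _ ENNReal.ofReal_ne_top]
    refine lintegral_mono fun x => ?_
    rw [← ENNReal.ofReal_mul (abs_nonneg _), ← ENNReal.ofReal_mul (by positivity)]
    refine ENNReal.ofReal_le_ofReal ?_
    rw [abs_of_pos (hdetpos x)]
    set J := (ContinuousLinearMap.id ℝ Plane + t • fderiv ℝ V (x + τ)).det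
    have hJ : 1 - b * t ≤ J := hdet x
    have h1 : glDensity ε (f ∘ Ψ) x ≤ (1 + a * t) * glDensity ε f (Ψ x) := by
      have h2 := gradSq_comp_le ht ht1' (hfd (x + τ)) ((hf.differentiable one_ne_zero) (Ψ x))
        (hder x)
      have h3 : 0 ≤ 1 / ε ^ 2 * (1 - ‖f (Ψ x)‖) ^ 2 := by positivity
      have h4 : 0 ≤ a * t * (1 / ε ^ 2 * (1 - ‖f (Ψ x)‖) ^ 2) := by positivity
      simp only [glDensity, Function.comp_apply]
      linarith
    -- `(1 + 2x)(1 - x) ≥ 1` for `0 ≤ x ≤ 1/2`, applied to `x = bt`.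
    have h5 : 1 ≤ (1 + 2 * b * t) * J := by
      have : 1 ≤ (1 + 2 * b * t) * (1 - b * t) := by
        have hbt : 0 ≤ b * t := by positivity
        nlinarith
      refine this.trans (mul_le_mul_of_nonneg_left hJ (by positivity))
    have h6 : (1 + a * t) * (1 + 2 * b * t) ≤ 1 + (a + 2 * b + 2 * a * b + M) * t := by
      have h7 : 0 ≤ a * b * (t * (1 - t)) := by
        have : 0 ≤ 1 - t := by linarith
        positivity
      have h8 : 0 ≤ M * t := by positivity
      nlinarith
    have hg := glDensity_nonneg ε f (Ψ x)
    have hJ0 : 0 < J := hdetpos x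
    calc glDensity ε (f ∘ Ψ) x ≤ (1 + a * t) * glDensity ε f (Ψ x) * 1 := by rwa [mul_one]
      _ ≤ (1 + a * t) * glDensity ε f (Ψ x) * ((1 + 2 * b * t) * J) := by gcongr
      _ = (1 + a * t) * (1 + 2 * b * t) * (J * glDensity ε f (Ψ x)) := by ring
      _ ≤ _ := by gcongr
  · intro f hf φ A hA
    rw [integral_image_eq_integral_abs_det_fderiv_smul volume hA
      (fun x _ => (hder x).hasFDerivWithinAt) Ψ.injective.injOn]
    refine integral_congr_ae (Eventually.of_forall fun x => ?_)
    simp only [smul_eq_mul, Homeomorph.symm_apply_apply]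
    rw [abs_of_pos (hdetpos x), jacDet_eq_det, jacDet_eq_det,
      ((hf.differentiable one_ne_zero (Ψ x)).hasFDerivAt.comp x (hder x)).fderiv]
    simp only [ContinuousLinearMap.det, ContinuousLinearMap.toLinearMap_comp, LinearMap.det_comp]
    ring

end

/-! ### Smooth approximation in energy and in Jacobian -/

section

/-! ### Mollification -/

/-- Convolution with a normalized bump function. -/
def moll (ρ : ContDiffBump (0 : Plane)) (g : Plane → ℝ) : Plane → ℝ :=
  convolution (ρ.normed volume) g (ContinuousLinearMap.lsmul ℝ ℝ) volume

theorem moll_apply (ρ : ContDiffBump (0 : Plane)) (g : Plane → ℝ) (x : Plane) :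
    moll ρ g x = ∫ t, ρ.normed volume t * g (x - t) := by
  rw [moll, convolution_def]; rfl

theorem moll_eq_convolution (ρ : ContDiffBump (0 : Plane)) (g : Plane → ℝ) :
    moll ρ g = convolution g (ρ.normed volume) (ContinuousLinearMap.lsmul ℝ ℝ) volume := by
  rw [moll, ← convolution_flip]
  congr 1
  ext
  simp

theorem moll_apply_swap (ρ : ContDiffBump (0 : Plane)) (g : Plane → ℝ) (x : Plane) :
    moll ρ g x = ∫ t, g t * ρ.normed volume (x - t) := by
  rw [moll_eq_convolution, convolution_def]; rfl

theorem contDiff_moll (ρ : ContDiffBump (0 : Plane)) {g : Plane → ℝ}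
    (hg : LocallyIntegrable g volume) : ContDiff ℝ ∞ (moll ρ g) :=
  ρ.hasCompactSupport_normed.contDiff_convolution_left _ ρ.contDiff_normed hg

theorem fderiv_moll (ρ : ContDiffBump (0 : Plane)) {g : Plane → ℝ}
    (hg : LocallyIntegrable g volume) (x v : Plane) :
    fderiv ℝ (moll ρ g) x v = ∫ t, g t * fderiv ℝ (ρ.normed volume) (x - t) v := by
  have h1 : ContDiff ℝ 1 (ρ.normed volume) := ρ.contDiff_normed (n := 1)
  have h2 := (ρ.hasCompactSupport_normed (μ := volume)).hasFDerivAt_convolution_right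
    (ContinuousLinearMap.lsmul ℝ ℝ) hg h1 x
  rw [moll_eq_convolution, h2.fderiv, convolution_precompR_apply _ hg
    ((ρ.hasCompactSupport_normed).fderiv ℝ) (h1.continuous_fderiv one_ne_zero), convolution_def]
  rfl

/-- Convolution with a probability density is a contraction of `L²`. -/
theorem eLpNorm_moll_le (ρ : ContDiffBump (0 : Plane)) {g : Plane → ℝ}
    (hg : AEStronglyMeasurable g volume) :
    eLpNorm (moll ρ g) 2 volume ≤ eLpNorm g 2 volume := by
  set k : Plane → ℝ≥0∞ := fun t => ‖ρ.normed volume t‖ₑ with hk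
  have hkm : Measurable k := (ρ.continuous_normed (μ := volume)).enorm.measurable
  have hkfin : ∀ t, k t < ⊤ := fun t => enorm_lt_top
  have hk1 : ∫⁻ t, k t = 1 := by
    have h1 := ofReal_integral_eq_lintegral_ofReal (ρ.integrable_normed (μ := volume))
      (Eventually.of_forall ρ.nonneg_normed)
    rw [ρ.integral_normed, ENNReal.ofReal_one] at h1
    rw [h1]
    exact lintegral_congr fun t => Real.enorm_of_nonneg (ρ.nonneg_normed t)
  -- The kernel is read as a probability measure, so that Jensen becomes the comparison of the
  -- `L¹(μ)` and `L²(μ)` norms. Fubini and translation invariance then conclude.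
  set μ : Measure Plane := volume.withDensity k with hμ
  have hprob : IsProbabilityMeasure μ :=
    ⟨by rw [hμ, withDensity_apply _ MeasurableSet.univ, Measure.restrict_univ, hk1]⟩
  have hac : μ ≪ volume := withDensity_absolutelyContinuous _ _
  have hpt : ∀ x, ‖moll ρ g x‖ₑ ^ (2 : ℝ) ≤ ∫⁻ t, k t * ‖g (x - t)‖ₑ ^ (2 : ℝ) := by
    intro x
    have hgx : AEStronglyMeasurable (fun t => g (x - t)) volume :=
      hg.comp_quasiMeasurePreserving (quasiMeasurePreserving_sub_left volume x)
    have h1 : ‖moll ρ g x‖ₑ ≤ eLpNorm (fun t => g (x - t)) 1 μ := by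
      rw [eLpNorm_one_eq_lintegral_enorm, hμ,
        lintegral_withDensity_eq_lintegral_mul_non_measurable _ hkm
          (Eventually.of_forall hkfin), moll_apply]
      refine (enorm_integral_le_lintegral_enorm _).trans (le_of_eq (lintegral_congr fun t => ?_))
      rw [enorm_mul]; rfl
    have h2 : eLpNorm (fun t => g (x - t)) 1 μ ≤ eLpNorm (fun t => g (x - t)) 2 μ :=
      eLpNorm_le_eLpNorm_of_exponent_le (by norm_num) (hgx.mono_ac hac)
    have h3 : eLpNorm (fun t => g (x - t)) 2 μ ^ (2 : ℝ) =
        ∫⁻ t, k t * ‖g (x - t)‖ₑ ^ (2 : ℝ) := by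
      have := eLpNorm_nnreal_pow_eq_lintegral (f := fun t => g (x - t)) (p := 2) (μ := μ)
        (by norm_num)
      push_cast at this
      rw [this, hμ, lintegral_withDensity_eq_lintegral_mul_non_measurable _ hkm
          (Eventually.of_forall hkfin)]
      rfl
    rw [← h3]
    exact ENNReal.rpow_le_rpow (h1.trans h2) (by norm_num)
  have hL : ∀ f : Plane → ℝ, eLpNorm f 2 volume ^ (2 : ℝ) = ∫⁻ x, ‖f x‖ₑ ^ (2 : ℝ) := by
    intro f
    have := eLpNorm_nnreal_pow_eq_lintegral (f := f) (p := 2) (μ := (volume : Measure Plane))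
      (by norm_num)
    push_cast at this
    exact this
  rw [← ENNReal.rpow_le_rpow_iff (z := 2) (by norm_num), hL, hL]
  calc ∫⁻ x, ‖moll ρ g x‖ₑ ^ (2 : ℝ) ≤ ∫⁻ x, ∫⁻ t, k t * ‖g (x - t)‖ₑ ^ (2 : ℝ) :=
        lintegral_mono hpt
    _ = ∫⁻ t, ∫⁻ x, k t * ‖g (x - t)‖ₑ ^ (2 : ℝ) := by
        refine lintegral_lintegral_swap ?_
        refine AEMeasurable.mul (hkm.comp measurable_snd).aemeasurable ?_
        refine AEMeasurable.pow_const ?_ _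
        exact (hg.comp_quasiMeasurePreserving (quasiMeasurePreserving_sub volume volume)).enorm
    _ = ∫⁻ t, k t * ∫⁻ x, ‖g x‖ₑ ^ (2 : ℝ) := by
        refine lintegral_congr fun t => ?_
        rw [lintegral_const_mul' _ _ (hkfin t).ne]
        congr 1
        exact lintegral_sub_right_eq_self (fun x => ‖g x‖ₑ ^ (2 : ℝ)) t
    _ = ∫⁻ x, ‖g x‖ₑ ^ (2 : ℝ) := by
        rw [lintegral_mul_const _ hkm, hk1, one_mul]

theorem locallyIntegrable_of_memLp_two {g : Plane → ℝ} (hg : MemLp g 2 volume) :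
    LocallyIntegrable g volume :=
  hg.locallyIntegrable (by norm_num)

theorem moll_sub (ρ : ContDiffBump (0 : Plane)) {g h : Plane → ℝ}
    (hg : LocallyIntegrable g volume) (hh : LocallyIntegrable h volume) (x : Plane) :
    moll ρ (g - h) x = moll ρ g x - moll ρ h x := by
  have hc : Continuous fun t => ρ.normed volume (x - t) :=
    (ρ.continuous_normed (μ := volume)).comp (continuous_const.sub continuous_id)
  have hs : HasCompactSupport fun t => ρ.normed volume (x - t) :=
    (ρ.hasCompactSupport_normed (μ := volume)).comp_homeomorph (Homeomorph.subLeft x)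
  simp only [moll_apply_swap]
  rw [← integral_sub]
  · simp only [Pi.sub_apply, sub_mul]
  · simpa only [smul_eq_mul, mul_comm] using hg.integrable_smul_left_of_hasCompactSupport hc hs
  · simpa only [smul_eq_mul, mul_comm] using hh.integrable_smul_left_of_hasCompactSupport hc hs

/-- Mollifications converge in `L²`. -/
theorem exists_eLpNorm_moll_sub_le {g : Plane → ℝ} (hg : MemLp g 2 volume) {κ : ℝ≥0∞}
    (hκ : κ ≠ 0) : ∃ r > 0, ∀ ρ : ContDiffBump (0 : Plane), ρ.rOut ≤ r →
      eLpNorm (fun x => moll ρ g x - g x) 2 volume ≤ κ := by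
  have hκ3 : κ / 3 ≠ 0 := (ENNReal.div_pos hκ (by norm_num)).ne'
  -- One third of the error comes from replacing `g` by a continuous compactly supported `h`, one
  -- third from the mollified difference, by contraction, and one third from the uniform continuity
  -- of `h`.
  obtain ⟨h, hhc, hgh, hhcont, hhmem⟩ :=
    hg.exists_hasCompactSupport_eLpNorm_sub_le (by norm_num) hκ3
  have hhl := locallyIntegrable_of_memLp_two hhmem
  have hgl := locallyIntegrable_of_memLp_two hg
  set S : Set Plane := Metric.cthickening 1 (tsupport h) with hS
  have hScpt : IsCompact S := IsCompact.cthickening hhc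
  have hSfin : volume S ≠ ⊤ := hScpt.measure_lt_top.ne
  obtain ⟨η, hη, hηle⟩ : ∃ η : ℝ, 0 < η ∧
      ENNReal.ofReal η * volume S ^ (1 / (2 : ℝ)) ≤ κ / 3 := by
    have hfin : volume S ^ (1 / (2 : ℝ)) ≠ ⊤ := ENNReal.rpow_ne_top_of_nonneg (by norm_num) hSfin
    obtain ⟨η, hη, hlt⟩ := ENNReal.exists_nnreal_pos_mul_lt hfin hκ3
    exact ⟨η, by exact_mod_cast hη, by rw [ENNReal.ofReal_coe_nnreal]; exact hlt.le⟩
  have huc : UniformContinuous h := hhc.uniformContinuous_of_continuous hhcont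
  obtain ⟨r, hr, hrh⟩ := Metric.uniformContinuous_iff.1 huc η hη
  refine ⟨min r 1, by positivity, fun ρ hρ => ?_⟩
  have e3 : eLpNorm (fun x => moll ρ h x - h x) 2 volume ≤ κ / 3 := by
    have hpt : ∀ x, ‖moll ρ h x - h x‖ ≤ S.indicator (fun _ => η) x := by
      intro x
      by_cases hx : x ∈ S
      · rw [Set.indicator_of_mem hx, ← dist_eq_norm]
        refine ρ.dist_normed_convolution_le hhcont.aestronglyMeasurable fun y hy => ?_
        exact (hrh ((Metric.mem_ball.1 hy).trans_le (hρ.trans (min_le_left _ _)))).le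
      · rw [Set.indicator_of_notMem hx]
        have hz : ∀ y ∈ Metric.ball x 1, h y = 0 := by
          intro y hy
          by_contra hne
          refine hx (Metric.mem_cthickening_of_dist_le x y 1 _ (subset_tsupport _ hne) ?_)
          rw [dist_comm]; exact (Metric.mem_ball.1 hy).le
        have hx0 := hz x (Metric.mem_ball_self one_pos)
        rw [← dist_eq_norm]
        refine ρ.dist_normed_convolution_le hhcont.aestronglyMeasurable fun y hy => ?_
        rw [hz y (Metric.ball_subset_ball (hρ.trans (min_le_right _ _)) hy), hx0, dist_self]
    refine (eLpNorm_mono_real hpt).trans ?_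
    rw [eLpNorm_indicator_const hScpt.measurableSet (by norm_num) (by norm_num),
      Real.enorm_of_nonneg hη.le]
    simpa using hηle
  have hm1 : AEStronglyMeasurable (moll ρ (g - h)) volume :=
    (contDiff_moll ρ (hgl.sub hhl)).continuous.aestronglyMeasurable
  have hm2 : AEStronglyMeasurable (fun x => moll ρ h x - h x) volume :=
    (((contDiff_moll ρ hhl).continuous).sub hhcont).aestronglyMeasurable
  have e1 : eLpNorm (moll ρ (g - h)) 2 volume ≤ κ / 3 :=
    (eLpNorm_moll_le ρ (hg.sub hhmem).aestronglyMeasurable).trans hgh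
  have hsplit : (fun x => moll ρ g x - g x) =
      (moll ρ (g - h) + fun x => moll ρ h x - h x) - (g - h) := by
    ext x
    simp only [Pi.add_apply, Pi.sub_apply, moll_sub ρ hgl hhl]
    ring
  rw [hsplit]
  calc _ ≤ eLpNorm (moll ρ (g - h) + fun x => moll ρ h x - h x) 2 volume +
        eLpNorm (g - h) 2 volume :=
        eLpNorm_sub_le (hm1.add hm2) (hg.sub hhmem).aestronglyMeasurable (by norm_num)
    _ ≤ (κ / 3 + κ / 3) + κ / 3 :=
        add_le_add ((eLpNorm_add_le hm1 hm2 (by norm_num)).trans (add_le_add e1 e3)) hgh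
    _ = κ := ENNReal.add_thirds κ

end

section

/-! ### Smooth approximation of Sobolev maps -/

/-- The kernel centred at `x` has its support in `Ω`, so it is an admissible test function, and the
extension by zero is not felt there. -/
theorem grad_moll {Ω : Set Plane} (hopen : IsOpen Ω) (w : SobolevMap Ω)
    (ρ : ContDiffBump (0 : Plane)) {g : Plane → ℝ} {a : Fin 2}
    (hg : g = Ω.indicator fun x => w.w x a) (hgl : LocallyIntegrable g volume) {x : Plane}
    (hx : Metric.closedBall x ρ.rOut ⊆ Ω) (j : Fin 2) :
    fderiv ℝ (moll ρ g) x (EuclideanSpace.single j 1) = moll ρ (Ω.indicator (w.D a j)) x := by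
  rw [fderiv_moll ρ hgl, moll_apply_swap]
  set ψ : Plane → ℝ := fun t => ρ.normed volume (x - t) with hψ
  have hψd : ContDiff ℝ ∞ ψ := ρ.contDiff_normed.comp (contDiff_const.sub contDiff_id)
  have hψs : tsupport ψ ⊆ Metric.closedBall x ρ.rOut := by
    refine closure_minimal (fun t ht => ?_) Metric.isClosed_closedBall
    have h1 : x - t ∈ Function.support (ρ.normed volume) := ht
    rw [ρ.support_normed_eq, Metric.mem_ball, dist_zero_right] at h1
    rw [Metric.mem_closedBall, dist_comm, dist_eq_norm]
    exact h1.le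
  have hψc : HasCompactSupport ψ :=
    (isCompact_closedBall x ρ.rOut).of_isClosed_subset (isClosed_tsupport _) hψs
  have hder : ∀ t, fderiv ℝ ψ t (EuclideanSpace.single j 1) =
      -fderiv ℝ (ρ.normed volume) (x - t) (EuclideanSpace.single j 1) := by
    intro t
    have h1 : HasFDerivAt (fun t : Plane => x - t) (-ContinuousLinearMap.id ℝ Plane) t := by
      simpa using (hasFDerivAt_id t).const_sub x
    have h2 := (((ρ.contDiff_normed (μ := volume) (n := 1)).differentiable one_ne_zero)
      (x - t)).hasFDerivAt.comp t h1
    rw [show ψ = (ρ.normed volume) ∘ fun t => x - t from rfl, h2.fderiv]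
    simp
  have hw := w.weak_deriv ψ hψd hψc (hψs.trans hx) a j
  have e1 : ∫ t, g t * fderiv ℝ (ρ.normed volume) (x - t) (EuclideanSpace.single j 1) =
      -∫ t in Ω, w.w t a * fderiv ℝ ψ t (EuclideanSpace.single j 1) := by
    rw [← integral_indicator hopen.measurableSet, ← integral_neg]
    refine integral_congr_ae (Eventually.of_forall fun t => ?_)
    by_cases ht : t ∈ Ω <;> simp [hg, ht, hder]
  have e2 : ∫ t, Ω.indicator (w.D a j) t * ρ.normed volume (x - t) =
      ∫ t in Ω, w.D a j t * ψ t := by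
    rw [← integral_indicator hopen.measurableSet]
    refine integral_congr_ae (Eventually.of_forall fun t => ?_)
    by_cases ht : t ∈ Ω <;> simp [ht, hψ]
  rw [e1, e2, hw, neg_neg]

/-- Squared distance between two first order jets. -/
def SobolevMap.jetDistSq {Ω : Set Plane} (w : SobolevMap Ω) (f : Plane → Plane) (x : Plane) : ℝ :=
  ∑ a, ∑ j, (grad f a j x - w.D a j x) ^ 2 + ∑ a, (f x a - w.w x a) ^ 2

theorem lintegral_sq_le_of_eLpNorm_le {F : Plane → ℝ} {κ : ℝ} (hκ : 0 ≤ κ)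
    (h : eLpNorm F 2 volume ≤ ENNReal.ofReal κ) :
    ∫⁻ x, ENNReal.ofReal (F x ^ 2) ≤ ENNReal.ofReal (κ ^ 2) := by
  have h1 := eLpNorm_nnreal_pow_eq_lintegral (f := F) (p := 2) (μ := (volume : Measure Plane))
    (by norm_num)
  push_cast at h1
  calc ∫⁻ x, ENNReal.ofReal (F x ^ 2) = ∫⁻ x, ‖F x‖ₑ ^ (2 : ℝ) := by
        refine lintegral_congr fun x => ?_
        rw [← sq_abs, ENNReal.ofReal_pow (abs_nonneg _), ← Real.norm_eq_abs, ofReal_norm]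
        norm_num
    _ = eLpNorm F 2 volume ^ (2 : ℝ) := h1.symm
    _ ≤ ENNReal.ofReal κ ^ (2 : ℝ) := ENNReal.rpow_le_rpow h (by norm_num)
    _ = ENNReal.ofReal (κ ^ 2) := by rw [ENNReal.ofReal_pow hκ]; norm_num

/-- The two components and four weak derivatives, extended by zero, are mollified with one radius
below the margin `s`. On `A` the gradient then commutes with mollification. -/
theorem exists_smooth_jet_approx {Ω : Set Plane} (hopen : IsOpen Ω) (w : SobolevMap Ω) {s : ℝ}
    (hs : 0 < s) {A : Set Plane} (hA : MeasurableSet A) (hAs : ∀ x ∈ A, Metric.ball x s ⊆ Ω)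
    {κ : ℝ} (hκ : 0 < κ) :
    ∃ f : Plane → Plane, ContDiff ℝ ∞ f ∧
      ∫⁻ x in A, ENNReal.ofReal (w.jetDistSq f x) ≤ ENNReal.ofReal κ := by
  set W : Fin 2 → Plane → ℝ := fun a => Ω.indicator fun x => w.w x a with hW
  set G : Fin 2 → Fin 2 → Plane → ℝ := fun a j => Ω.indicator (w.D a j) with hG
  have hWm : ∀ a, MemLp (W a) 2 volume := fun a => by
    rw [hW, memLp_indicator_iff_restrict hopen.measurableSet]
    exact (EuclideanSpace.proj a : Plane →L[ℝ] ℝ).comp_memLp' w.memLp_w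
  have hGm : ∀ a j, MemLp (G a j) 2 volume := fun a j => by
    rw [hG, memLp_indicator_iff_restrict hopen.measurableSet]
    exact w.memLp_D a j
  -- Six squared errors are added, and `κ' ≤ 1` gives `6 κ'² ≤ κ`.
  set κ' : ℝ := min 1 (κ / 6) with hκ'
  have hκ'0 : 0 < κ' := by positivity
  have hκ'2 : 6 * κ' ^ 2 ≤ κ := by
    have h1 : κ' ≤ 1 := min_le_left _ _
    have h2 : κ' ≤ κ / 6 := min_le_right _ _
    nlinarith
  have hne : ENNReal.ofReal κ' ≠ 0 := (ENNReal.ofReal_pos.2 hκ'0).ne'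
  choose r hr hrW using fun a => exists_eLpNorm_moll_sub_le (hWm a) hne
  choose q hq hqG using fun a j => exists_eLpNorm_moll_sub_le (hGm a j) hne
  obtain ⟨R, hR0, hRs, hRr, hRq⟩ : ∃ R : ℝ, 0 < R ∧ R < s ∧ (∀ a, R ≤ r a) ∧ ∀ a j, R ≤ q a j := by
    have hev : ∀ᶠ R in 𝓝[>] (0 : ℝ), R < s ∧ (∀ a, R ≤ r a) ∧ ∀ a j, R ≤ q a j := by
      have h0 : ∀ b : ℝ, 0 < b → ∀ᶠ R in 𝓝[>] (0 : ℝ), R < b := fun b hb =>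
        (eventually_pos_lt hb).mono fun _ h => h.2
      refine (h0 s hs).and ((eventually_all.2 fun a => ?_).and (eventually_all.2 fun a =>
        eventually_all.2 fun j => ?_))
      · exact (h0 _ (hr a)).mono fun _ h => h.le
      · exact (h0 _ (hq a j)).mono fun _ h => h.le
    obtain ⟨R, hR, hR0⟩ := (hev.and self_mem_nhdsWithin).exists
    exact ⟨R, hR0, hR.1, hR.2.1, hR.2.2⟩
  let ρ : ContDiffBump (0 : Plane) := ⟨R / 2, R, by positivity, by linarith⟩
  have hWl : ∀ a, LocallyIntegrable (W a) volume := fun a => locallyIntegrable_of_memLp_two (hWm a)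
  have hGl : ∀ a j, LocallyIntegrable (G a j) volume := fun a j =>
    locallyIntegrable_of_memLp_two (hGm a j)
  set f : Plane → Plane := fun x => WithLp.toLp 2 fun a => moll ρ (W a) x with hf
  have hfd : ContDiff ℝ ∞ f := by
    rw [contDiff_euclidean]
    exact fun a => contDiff_moll ρ (hWl a)
  refine ⟨f, hfd, ?_⟩
  have hfd1 : ContDiff ℝ 1 f := hfd.of_le (by exact_mod_cast le_top)
  have hgrad : ∀ x ∈ A, ∀ a j, grad f a j x = moll ρ (G a j) x := by
    intro x hx a j
    rw [grad, ← fderiv_component hfd1]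
    exact grad_moll hopen w ρ rfl (hWl a) ((Metric.closedBall_subset_ball hRs).trans (hAs x hx)) j
  have hAΩ : A ⊆ Ω := fun x hx => hAs x hx (Metric.mem_ball_self hs)
  have hpt : ∀ x ∈ A, w.jetDistSq f x =
      ∑ a, ∑ j, (moll ρ (G a j) x - G a j x) ^ 2 + ∑ a, (moll ρ (W a) x - W a x) ^ 2 := by
    intro x hx
    have h1 : ∀ a, W a x = w.w x a := fun a => Set.indicator_of_mem (hAΩ hx) _
    have h2 : ∀ a j, G a j x = w.D a j x := fun a j => Set.indicator_of_mem (hAΩ hx) _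
    simp only [SobolevMap.jetDistSq, hgrad x hx, h1, h2]
    rfl
  have hFW : ∀ a, ∫⁻ x in A, ENNReal.ofReal ((moll ρ (W a) x - W a x) ^ 2) ≤
      ENNReal.ofReal (κ' ^ 2) := fun a =>
    (setLIntegral_le_lintegral _ _).trans
      (lintegral_sq_le_of_eLpNorm_le hκ'0.le (hrW a ρ (hRr a)))
  have hFG : ∀ a j, ∫⁻ x in A, ENNReal.ofReal ((moll ρ (G a j) x - G a j x) ^ 2) ≤
      ENNReal.ofReal (κ' ^ 2) := fun a j =>
    (setLIntegral_le_lintegral _ _).trans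
      (lintegral_sq_le_of_eLpNorm_le hκ'0.le (hqG a j ρ (hRq a j)))
  have hmW : ∀ a, AEMeasurable (fun x => ENNReal.ofReal ((moll ρ (W a) x - W a x) ^ 2))
      (volume.restrict A) := fun a =>
    ((((contDiff_moll ρ (hWl a)).continuous.aemeasurable).sub
      (hWm a).aestronglyMeasurable.aemeasurable).pow_const 2).ennreal_ofReal.restrict
  have hmG : ∀ a j, AEMeasurable (fun x => ENNReal.ofReal ((moll ρ (G a j) x - G a j x) ^ 2))
      (volume.restrict A) := fun a j =>
    ((((contDiff_moll ρ (hGl a j)).continuous.aemeasurable).sub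
      (hGm a j).aestronglyMeasurable.aemeasurable).pow_const 2).ennreal_ofReal.restrict
  calc ∫⁻ x in A, ENNReal.ofReal (w.jetDistSq f x)
      = ∫⁻ x in A, (∑ a, ∑ j, ENNReal.ofReal ((moll ρ (G a j) x - G a j x) ^ 2) +
          ∑ a, ENNReal.ofReal ((moll ρ (W a) x - W a x) ^ 2)) := by
        refine setLIntegral_congr_fun hA fun x hx => ?_
        rw [hpt x hx, ENNReal.ofReal_add (by positivity) (by positivity),
          ENNReal.ofReal_sum_of_nonneg (fun _ _ => by positivity),
          ENNReal.ofReal_sum_of_nonneg (fun _ _ => by positivity)]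
        congr 1
        exact Finset.sum_congr rfl fun a _ =>
          ENNReal.ofReal_sum_of_nonneg (fun _ _ => by positivity)
    _ = (∑ a, ∑ j, ∫⁻ x in A, ENNReal.ofReal ((moll ρ (G a j) x - G a j x) ^ 2)) +
          ∑ a, ∫⁻ x in A, ENNReal.ofReal ((moll ρ (W a) x - W a x) ^ 2) := by
        rw [lintegral_add_right' _ (Finset.aemeasurable_fun_sum _ fun a _ => hmW a),
          lintegral_finsetSum' _ fun a _ => hmW a,
          lintegral_finsetSum' _ fun a _ => Finset.aemeasurable_fun_sum _ fun j _ => hmG a j]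
        congr 1
        exact Finset.sum_congr rfl fun a _ => lintegral_finsetSum' _ fun j _ => hmG a j
    _ ≤ ∑ _a : Fin 2, ∑ _j : Fin 2, ENNReal.ofReal (κ' ^ 2) +
          ∑ _a : Fin 2, ENNReal.ofReal (κ' ^ 2) :=
        add_le_add (Finset.sum_le_sum fun a _ => Finset.sum_le_sum fun j _ => hFG a j)
          (Finset.sum_le_sum fun a _ => hFW a)
    _ = ENNReal.ofReal (6 * κ' ^ 2) := by
        simp only [Fin.sum_univ_two]
        repeat rw [← ENNReal.ofReal_add (by positivity) (by positivity)]
        congr 1; ring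
    _ ≤ ENNReal.ofReal κ := ENNReal.ofReal_le_ofReal hκ'2

/-- The energy density of a Sobolev map. -/
def SobolevMap.density {Ω : Set Plane} (ε : ℝ) (w : SobolevMap Ω) (x : Plane) : ℝ :=
  1 / 2 * ∑ a, ∑ j, w.D a j x ^ 2 + 1 / ε ^ 2 * (1 - ‖w.w x‖) ^ 2

theorem SobolevMap.abs_det_le_density {Ω : Set Plane} (ε : ℝ) (w : SobolevMap Ω) (x : Plane) :
    |w.det x| ≤ w.density ε x := by
  have h : 0 ≤ 1 / ε ^ 2 * (1 - ‖w.w x‖) ^ 2 := by positivity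
  simp only [density, det, Fin.sum_univ_two]
  rw [abs_le]
  constructor
  · nlinarith [sq_nonneg (w.D 0 0 x + w.D 1 1 x), sq_nonneg (w.D 0 1 x - w.D 1 0 x)]
  · nlinarith [sq_nonneg (w.D 0 0 x - w.D 1 1 x), sq_nonneg (w.D 0 1 x + w.D 1 0 x)]

theorem add_sq_le_of_pos {θ : ℝ} (hθ : 0 < θ) (p d : ℝ) :
    (p + d) ^ 2 ≤ (1 + θ) * p ^ 2 + (1 + 1 / θ) * d ^ 2 := by
  have h : (1 + θ) * p ^ 2 + (1 + 1 / θ) * d ^ 2 - (p + d) ^ 2 = (θ * p - d) ^ 2 / θ := by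
    field_simp; ring
  have : 0 ≤ (θ * p - d) ^ 2 / θ := by positivity
  linarith

theorem SobolevMap.glDensity_le {Ω : Set Plane} (w : SobolevMap Ω) (f : Plane → Plane) (x : Plane)
    (ε : ℝ) {θ : ℝ} (hθ : 0 < θ) :
    glDensity ε f x ≤ (1 + θ) * w.density ε x +
      (1 + 1 / θ) * (1 + 1 / ε ^ 2) * w.jetDistSq f x := by
  have hgrad : gradSq f x ≤ (1 + θ) * ∑ a, ∑ j, w.D a j x ^ 2 +
      (1 + 1 / θ) * ∑ a, ∑ j, (grad f a j x - w.D a j x) ^ 2 := by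
    rw [gradSq, Finset.mul_sum, Finset.mul_sum, ← Finset.sum_add_distrib]
    refine Finset.sum_le_sum fun a _ => ?_
    rw [Finset.mul_sum, Finset.mul_sum, ← Finset.sum_add_distrib]
    refine Finset.sum_le_sum fun j _ => ?_
    have := add_sq_le_of_pos hθ (w.D a j x) (grad f a j x - w.D a j x)
    rwa [add_sub_cancel] at this
  have hpot : (1 - ‖f x‖) ^ 2 ≤ (1 + θ) * (1 - ‖w.w x‖) ^ 2 +
      (1 + 1 / θ) * ∑ a, (f x a - w.w x a) ^ 2 := by
    have h1 := add_sq_le_of_pos hθ (1 - ‖w.w x‖) (‖w.w x‖ - ‖f x‖)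
    have h2 : (‖w.w x‖ - ‖f x‖) ^ 2 ≤ ∑ a, (f x a - w.w x a) ^ 2 := by
      have h3 : ∑ a, (f x a - w.w x a) ^ 2 = ‖f x - w.w x‖ ^ 2 := by
        rw [EuclideanSpace.norm_sq_eq]; simp
      rw [h3, ← sq_abs]
      have := abs_norm_sub_norm_le (w.w x) (f x)
      rw [norm_sub_rev] at this
      gcongr
    rw [sub_add_sub_cancel] at h1
    have h4 : 0 < 1 + 1 / θ := by positivity
    nlinarith
  set S := ∑ a, ∑ j, (grad f a j x - w.D a j x) ^ 2 with hS
  set T := ∑ a, (f x a - w.w x a) ^ 2 with hT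
  have hS0 : 0 ≤ S := by positivity
  have hT0 : 0 ≤ T := by positivity
  have hθ' : 0 < 1 + 1 / θ := by positivity
  have hε : 0 ≤ 1 / ε ^ 2 := by positivity
  have h5 := mul_le_mul_of_nonneg_left hpot hε
  have h6 : (1 + 1 / θ) * (1 / 2 * S + 1 / ε ^ 2 * T) ≤
      (1 + 1 / θ) * ((1 + 1 / ε ^ 2) * (S + T)) := by
    refine mul_le_mul_of_nonneg_left ?_ hθ'.le
    nlinarith [mul_nonneg hε hS0]
  have h7 : w.jetDistSq f x = S + T := rfl
  rw [glDensity, density, h7]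
  nlinarith

/-- The determinant is quadratic: its increment consists of products of a derivative with an error,
treated by Young's inequality with weight `θ`, and of products of two errors. -/
theorem SobolevMap.abs_jacDet_sub_det_le {Ω : Set Plane} (w : SobolevMap Ω) (f : Plane → Plane)
    (x : Plane) (ε : ℝ) {θ : ℝ} (hθ : 0 < θ) :
    |jacDet f x - w.det x| ≤ θ * w.density ε x + (1 + 1 / θ) * w.jetDistSq f x := by
  have hpos : 0 ≤ 1 / ε ^ 2 * (1 - ‖w.w x‖) ^ 2 := by positivity
  have hT0 : 0 ≤ ∑ a, (f x a - w.w x a) ^ 2 := by positivity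
  have hprod : ∀ p d : ℝ, |p * d| ≤ 1 / 2 * (θ * p ^ 2 + 1 / θ * d ^ 2) := by
    intro p d
    have h1 : θ * p ^ 2 + 1 / θ * d ^ 2 - 2 * (p * d) = (θ * p - d) ^ 2 / θ := by
      field_simp; ring
    have h2 : θ * p ^ 2 + 1 / θ * d ^ 2 + 2 * (p * d) = (θ * p + d) ^ 2 / θ := by
      field_simp; ring
    have h3 : 0 ≤ (θ * p - d) ^ 2 / θ := by positivity
    have h4 : 0 ≤ (θ * p + d) ^ 2 / θ := by positivity
    rw [abs_le]; constructor <;> linarith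
  have hprod2 : ∀ p d : ℝ, |p * d| ≤ 1 / 2 * (p ^ 2 + d ^ 2) := by
    intro p d
    rw [abs_le]; constructor <;> nlinarith [sq_nonneg (p - d), sq_nonneg (p + d)]
  simp only [density, jetDistSq, jacDet, det]
  simp only [Fin.sum_univ_two] at hT0 ⊢
  set T := (f x 0 - w.w x 0) ^ 2 + (f x 1 - w.w x 1) ^ 2
  obtain ⟨d00, h00⟩ : ∃ d, d = grad f 0 0 x - w.D 0 0 x := ⟨_, rfl⟩
  obtain ⟨d01, h01⟩ : ∃ d, d = grad f 0 1 x - w.D 0 1 x := ⟨_, rfl⟩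
  obtain ⟨d10, h10⟩ : ∃ d, d = grad f 1 0 x - w.D 1 0 x := ⟨_, rfl⟩
  obtain ⟨d11, h11⟩ : ∃ d, d = grad f 1 1 x - w.D 1 1 x := ⟨_, rfl⟩
  rw [← h00, ← h01, ← h10, ← h11]
  have e : grad f 0 0 x * grad f 1 1 x - grad f 0 1 x * grad f 1 0 x -
      (w.D 0 0 x * w.D 1 1 x - w.D 0 1 x * w.D 1 0 x) =
      w.D 0 0 x * d11 + w.D 1 1 x * d00 - w.D 0 1 x * d10 - w.D 1 0 x * d01 +
        d00 * d11 - d01 * d10 := by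
    rw [h00, h01, h10, h11]; ring
  rw [e]
  have a1 := abs_le.1 (hprod (w.D 0 0 x) d11)
  have a2 := abs_le.1 (hprod (w.D 1 1 x) d00)
  have a3 := abs_le.1 (hprod (w.D 0 1 x) d10)
  have a4 := abs_le.1 (hprod (w.D 1 0 x) d01)
  have a5 := abs_le.1 (hprod2 d00 d11)
  have a6 := abs_le.1 (hprod2 d01 d10)
  have hθT : 0 ≤ (1 + 1 / θ) * T := by positivity
  have hθp := mul_nonneg hθ.le hpos
  have hq : 0 ≤ 1 / θ * (d00 ^ 2 + d01 ^ 2 + d10 ^ 2 + d11 ^ 2) := by positivity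
  have hq2 : 0 ≤ d00 ^ 2 + d01 ^ 2 + d10 ^ 2 + d11 ^ 2 := by positivity
  rw [abs_le]
  constructor <;> linarith

/-- Smooth approximation in energy and in Jacobian, away from the boundary. -/
theorem exists_smooth_approx {Ω : Set Plane} (hopen : IsOpen Ω) (w : SobolevMap Ω) {s : ℝ}
    (hs : 0 < s) {A : Set Plane} (hA : MeasurableSet A) (hAs : ∀ x ∈ A, Metric.ball x s ⊆ Ω)
    (ε : ℝ) {κ E : ℝ} (hκ : 0 < κ) (hE0 : 0 ≤ E) (hE : w.energy ε ≤ ENNReal.ofReal E) :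
    ∃ f : Plane → Plane, ContDiff ℝ ∞ f ∧
      ∫⁻ x in A, ENNReal.ofReal (glDensity ε f x) ≤ ENNReal.ofReal (E + κ) ∧
      ∫⁻ x in A, ENNReal.ofReal |jacDet f x - w.det x| ≤ ENNReal.ofReal κ := by
  -- This makes `θ E ≤ κ/2`. The other half of `κ` is reserved for the jet error, taken at most
  -- `κ/(2Q)`.
  set θ : ℝ := κ / (2 * (E + 1)) with hθ
  have hθ0 : 0 < θ := by positivity
  have hθE : θ * E ≤ κ / 2 := by
    rw [hθ, div_mul_eq_mul_div, div_le_iff₀ (by positivity)]; nlinarith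
  set Q : ℝ := (1 + 1 / θ) * (1 + 1 / ε ^ 2) with hQ
  have hQ0 : 0 < Q := by positivity
  have hQ1 : 1 + 1 / θ ≤ Q := by
    rw [hQ]
    refine le_mul_of_one_le_right (by positivity) ?_
    have : 0 ≤ 1 / ε ^ 2 := by positivity
    linarith
  obtain ⟨f, hf, hjet⟩ := exists_smooth_jet_approx hopen w hs hA hAs
    (show 0 < κ / 2 / Q by positivity)
  refine ⟨f, hf, ?_⟩
  have hAΩ : A ⊆ Ω := fun x hx => hAs x hx (Metric.mem_ball_self hs)
  have hEA : ∫⁻ x in A, ENNReal.ofReal (w.density ε x) ≤ ENNReal.ofReal E :=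
    (lintegral_mono_set hAΩ).trans hE
  have hDm : AEMeasurable (fun x => ENNReal.ofReal (w.density ε x)) (volume.restrict A) := by
    have h1 : AEMeasurable (fun x => w.density ε x) (volume.restrict Ω) := by
      refine AEMeasurable.add (AEMeasurable.const_mul ?_ _) (AEMeasurable.const_mul ?_ _)
      · exact Finset.aemeasurable_fun_sum _ fun a _ => Finset.aemeasurable_fun_sum _ fun j _ =>
          (w.memLp_D a j).aestronglyMeasurable.aemeasurable.pow_const 2
      · exact (aemeasurable_const.sub w.memLp_w.aestronglyMeasurable.norm.aemeasurable).pow_const 2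
    exact (h1.mono_measure (Measure.restrict_mono hAΩ le_rfl)).ennreal_ofReal
  have hcomb : ∀ p q : ℝ, 0 ≤ p → 0 ≤ q →
      ∫⁻ x in A, ENNReal.ofReal (p * w.density ε x + q * w.jetDistSq f x) ≤
        ENNReal.ofReal (p * E + q * (κ / 2 / Q)) := by
    intro p q hp hq
    calc ∫⁻ x in A, ENNReal.ofReal (p * w.density ε x + q * w.jetDistSq f x)
        ≤ ∫⁻ x in A, (ENNReal.ofReal p * ENNReal.ofReal (w.density ε x) +
            ENNReal.ofReal q * ENNReal.ofReal (w.jetDistSq f x)) := by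
          refine lintegral_mono fun x => ENNReal.ofReal_add_le.trans (le_of_eq ?_)
          rw [ENNReal.ofReal_mul hp, ENNReal.ofReal_mul hq]
      _ = ENNReal.ofReal p * (∫⁻ x in A, ENNReal.ofReal (w.density ε x)) +
            ENNReal.ofReal q * ∫⁻ x in A, ENNReal.ofReal (w.jetDistSq f x) := by
          rw [lintegral_add_left' (hDm.const_mul _),
            lintegral_const_mul' _ _ ENNReal.ofReal_ne_top,
            lintegral_const_mul' _ _ ENNReal.ofReal_ne_top]
      _ ≤ ENNReal.ofReal p * ENNReal.ofReal E + ENNReal.ofReal q * ENNReal.ofReal (κ / 2 / Q) := by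
          gcongr
      _ = _ := by
          rw [← ENNReal.ofReal_mul hp, ← ENNReal.ofReal_mul hq,
            ← ENNReal.ofReal_add (by positivity) (by positivity)]
  constructor
  · refine (lintegral_mono fun x => ENNReal.ofReal_le_ofReal
      (w.glDensity_le f x ε hθ0)).trans ((hcomb (1 + θ) Q (by positivity) hQ0.le).trans ?_)
    refine ENNReal.ofReal_le_ofReal ?_
    rw [mul_div_cancel₀ _ hQ0.ne']
    linarith
  · refine (lintegral_mono fun x => ENNReal.ofReal_le_ofReal
      (w.abs_jacDet_sub_det_le f x ε hθ0)).trans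
      ((hcomb θ (1 + 1 / θ) hθ0.le (by positivity)).trans ?_)
    refine ENNReal.ofReal_le_ofReal ?_
    have : (1 + 1 / θ) * (κ / 2 / Q) ≤ Q * (κ / 2 / Q) := by gcongr
    rw [mul_div_cancel₀ _ hQ0.ne'] at this
    linarith

end

/-! ### From Ginzburg–Landau maps to dislocations: phases on a translated grid -/

section

/-! ### Integrals over squares -/

/-- The half-open square with lower left corner `p` and side `δ`. -/
def box (p : Plane) (δ : ℝ) : Set Plane :=
  {x | x 0 ∈ Set.Ico (p 0) (p 0 + δ) ∧ x 1 ∈ Set.Ico (p 1) (p 1 + δ)}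

/-- Cartesian coordinates on the plane. -/
def planeEquiv : ℝ × ℝ ≃ᵐ Plane :=
  (MeasurableEquiv.finTwoArrow (α := ℝ)).symm.trans (MeasurableEquiv.toLp 2 (Fin 2 → ℝ))

theorem planeEquiv_apply (s r : ℝ) : planeEquiv (s, r) = !₂[s, r] := rfl

theorem measurePreserving_planeEquiv : MeasurePreserving planeEquiv volume volume :=
  ((volume_preserving_finTwoArrow ℝ).symm).trans
    (PiLp.volume_preserving_toLp (Fin 2))

theorem planeEquiv_eq (s r : ℝ) : planeEquiv (s, r) =
    s • EuclideanSpace.single 0 1 + r • EuclideanSpace.single 1 1 := by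
  rw [planeEquiv_apply]
  ext i
  fin_cases i <;> simp

theorem measurableSet_box (p : Plane) (δ : ℝ) : MeasurableSet (box p δ) :=
  ((measurableSet_Ico).preimage (EuclideanSpace.proj (𝕜 := ℝ) (0 : Fin 2)).measurable).inter
    ((measurableSet_Ico).preimage (EuclideanSpace.proj (𝕜 := ℝ) (1 : Fin 2)).measurable)

theorem box_zero_preimage (δ : ℝ) :
    planeEquiv ⁻¹' (box 0 δ) = Set.Ico 0 δ ×ˢ Set.Ico 0 δ := by
  ext ⟨s, r⟩
  simp [box, planeEquiv_apply]

theorem volume_box_zero {δ : ℝ} (hδ : 0 ≤ δ) : volume (box 0 δ) = ENNReal.ofReal (δ ^ 2) := by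
  rw [← measurePreserving_planeEquiv.measure_preimage (measurableSet_box 0 δ).nullMeasurableSet,
    box_zero_preimage, Measure.volume_eq_prod, Measure.prod_prod, Real.volume_Ico, sub_zero,
    ← ENNReal.ofReal_mul hδ, sq]

theorem box_preimage_add (p : Plane) (δ : ℝ) : (fun x => p + x) ⁻¹' (box p δ) = box 0 δ := by
  ext x
  simp [box]

theorem measurePreserving_const_add (p : Plane) :
    MeasurePreserving (fun x : Plane => p + x) volume volume :=
  measurePreserving_add_left volume p

theorem setIntegral_box_eq (p : Plane) (δ : ℝ) (F : Plane → ℝ) :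
    ∫ x in box p δ, F x = ∫ x in box 0 δ, F (p + x) := by
  rw [← box_preimage_add p δ]
  exact ((measurePreserving_const_add p).setIntegral_preimage_emb
    (Homeomorph.addLeft p).measurableEmbedding F (box p δ)).symm

theorem setLIntegral_box_eq (p : Plane) (δ : ℝ) (F : Plane → ℝ≥0∞) :
    ∫⁻ x in box p δ, F x = ∫⁻ x in box 0 δ, F (p + x) := by
  rw [← box_preimage_add p δ]
  exact ((measurePreserving_const_add p).setLIntegral_comp_preimage_emb
    (Homeomorph.addLeft p).measurableEmbedding F (box p δ)).symm

theorem volume_box {δ : ℝ} (hδ : 0 ≤ δ) (p : Plane) : volume (box p δ) = ENNReal.ofReal (δ ^ 2) := by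
  have h := setLIntegral_box_eq p δ 1
  simp only [Pi.one_apply, setLIntegral_one] at h
  rw [h, volume_box_zero hδ]

theorem setIntegral_box_eq_intervalIntegral (p : Plane) {δ : ℝ} (hδ : 0 ≤ δ) {F : Plane → ℝ}
    (hF : Continuous F) :
    ∫ x in box p δ, F x = ∫ s in (0 : ℝ)..δ, ∫ r in (0 : ℝ)..δ, F (p + planeEquiv (s, r)) := by
  rw [setIntegral_box_eq, ← measurePreserving_planeEquiv.setIntegral_preimage_emb
    planeEquiv.measurableEmbedding, box_zero_preimage]
  have hcont : Continuous fun z : ℝ × ℝ => F (p + planeEquiv z) := by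
    refine hF.comp (continuous_const.add ?_)
    have : (planeEquiv : ℝ × ℝ → Plane) =
        fun z => z.1 • EuclideanSpace.single 0 1 + z.2 • EuclideanSpace.single 1 1 :=
      funext fun z => planeEquiv_eq z.1 z.2
    rw [this]
    fun_prop
  rw [Measure.volume_eq_prod, setIntegral_prod]
  · simp only [intervalIntegral.integral_of_le hδ, integral_Ico_eq_integral_Ioo,
      integral_Ioc_eq_integral_Ioo]
  · exact (hcont.continuousOn.integrableOn_compact (isCompact_Icc.prod isCompact_Icc)).mono_set
      (Set.prod_mono Set.Ico_subset_Icc_self Set.Ico_subset_Icc_self)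

/-! ### Green's formula for the Jacobian -/

/-- The `j`-th component of the current `g × ∇g`. -/
def cross (g : Plane → Plane) (j : Fin 2) (x : Plane) : ℝ :=
  g x 0 * grad g 1 j x - g x 1 * grad g 0 j x

theorem continuous_cross {g : Plane → Plane} (hg : ContDiff ℝ 1 g) (j : Fin 2) :
    Continuous (cross g j) := by
  have h : ∀ a : Fin 2, Continuous fun x => g x a := fun a =>
    (EuclideanSpace.proj a : Plane →L[ℝ] ℝ).continuous.comp hg.continuous
  exact ((h 0).mul (continuous_grad hg 1 j)).sub ((h 1).mul (continuous_grad hg 0 j))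

theorem hasFDerivAt_grad {g : Plane → Plane} (hg : ContDiff ℝ 2 g) (a j : Fin 2) (x : Plane) :
    HasFDerivAt (grad g a j) ((EuclideanSpace.proj a : Plane →L[ℝ] ℝ).comp
      ((fderiv ℝ (fderiv ℝ g) x).flip (EuclideanSpace.single j 1))) x := by
  have h1 : HasFDerivAt (fderiv ℝ g) (fderiv ℝ (fderiv ℝ g) x) x :=
    ((hg.fderiv_right (m := 1) le_rfl).differentiable one_ne_zero x).hasFDerivAt
  have h2 := h1.clm_apply (hasFDerivAt_const (EuclideanSpace.single j (1 : ℝ) : Plane) x)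
  have h3 := (EuclideanSpace.proj a : Plane →L[ℝ] ℝ).hasFDerivAt.comp x h2
  refine h3.congr_fderiv ?_
  ext v
  simp

theorem hasFDerivAt_coord {g : Plane → Plane} (hg : ContDiff ℝ 1 g) (a : Fin 2) (x : Plane) :
    HasFDerivAt (fun y => g y a) ((EuclideanSpace.proj a : Plane →L[ℝ] ℝ).comp (fderiv ℝ g x)) x :=
  (EuclideanSpace.proj a : Plane →L[ℝ] ℝ).hasFDerivAt.comp x
    ((hg.differentiable one_ne_zero) x).hasFDerivAt

/-- Second derivatives cancel by symmetry, and the products of first derivatives appear twice. -/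
theorem fderiv_cross_sub {g : Plane → Plane} (hg : ContDiff ℝ 2 g) (x : Plane) :
    fderiv ℝ (cross g 1) x (EuclideanSpace.single 0 1) -
      fderiv ℝ (cross g 0) x (EuclideanSpace.single 1 1) = 2 * jacDet g x := by
  have hg1 : ContDiff ℝ 1 g := hg.of_le (by norm_num)
  have hd : ∀ j, fderiv ℝ (cross g j) x = _ := fun j =>
    (((hasFDerivAt_coord hg1 0 x).mul (hasFDerivAt_grad hg 1 j x)).sub
      ((hasFDerivAt_coord hg1 1 x).mul (hasFDerivAt_grad hg 0 j x))).fderiv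
  have hsymm : fderiv ℝ (fderiv ℝ g) x (EuclideanSpace.single 0 1) (EuclideanSpace.single 1 1) =
      fderiv ℝ (fderiv ℝ g) x (EuclideanSpace.single 1 1) (EuclideanSpace.single 0 1) :=
    (hg.contDiffAt.isSymmSndFDerivAt (by simp)).eq _ _
  have hproj : ∀ (a : Fin 2) (v : Plane), (EuclideanSpace.proj a : Plane →L[ℝ] ℝ) v = v a :=
    fun _ _ => rfl
  rw [hd 0, hd 1]
  simp only [jacDet, grad, sub_apply, add_apply, smul_apply,
    ContinuousLinearMap.comp_apply, ContinuousLinearMap.flip_apply, smul_eq_mul, hsymm,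
    hproj]
  ring

theorem contDiff_cross {g : Plane → Plane} (hg : ContDiff ℝ 2 g) (j : Fin 2) :
    ContDiff ℝ 1 (cross g j) := by
  have hg1 : ContDiff ℝ 1 g := hg.of_le (by norm_num)
  have h0 : ∀ a : Fin 2, ContDiff ℝ 1 fun x => g x a := fun a =>
    (EuclideanSpace.proj a : Plane →L[ℝ] ℝ).contDiff.comp hg1
  have h1 : ∀ a : Fin 2, ContDiff ℝ 1 (grad g a j) := fun a =>
    (EuclideanSpace.proj a : Plane →L[ℝ] ℝ).contDiff.comp
      ((hg.fderiv_right (m := 1) le_rfl).clm_apply contDiff_const)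
  exact ((h0 0).mul (h1 1)).sub ((h0 1).mul (h1 0))

/-- The circulation of the current along the edge from `p` to `p + δ e_j`. -/
def edgeCirc (g : Plane → Plane) (δ : ℝ) (j : Fin 2) (p : Plane) : ℝ :=
  ∫ s in (0 : ℝ)..δ, cross g j (p + s • EuclideanSpace.single j 1)

/-- Green's formula for the current. The boundary is run counterclockwise, opposite to the
orientation of `curl`; this is the origin of all later sign changes of the phase. -/
theorem two_mul_integral_jacDet_box {g : Plane → Plane} (hg : ContDiff ℝ 2 g) (p : Plane) {δ : ℝ}
    (hδ : 0 ≤ δ) : 2 * ∫ x in box p δ, jacDet g x =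
      edgeCirc g δ 0 p + edgeCirc g δ 1 (p + δ • EuclideanSpace.single 0 1) -
        edgeCirc g δ 0 (p + δ • EuclideanSpace.single 1 1) - edgeCirc g δ 1 p := by
  have hg1 : ContDiff ℝ 1 g := hg.of_le (by norm_num)
  set T : ℝ × ℝ →L[ℝ] Plane :=
    (ContinuousLinearMap.fst ℝ ℝ ℝ).smulRight (EuclideanSpace.single 0 1) +
      (ContinuousLinearMap.snd ℝ ℝ ℝ).smulRight (EuclideanSpace.single 1 1) with hT
  have hTe : ∀ s r : ℝ, T (s, r) = s • EuclideanSpace.single 0 1 + r • EuclideanSpace.single 1 1 :=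
    fun s r => rfl
  have hder : ∀ (j : Fin 2) (z : ℝ × ℝ), HasFDerivAt (fun z => cross g j (p + T z))
      ((fderiv ℝ (cross g j) (p + T z)).comp T) z := fun j z =>
    HasFDerivAt.comp (g := cross g j) (f := fun z => p + T z) z
      (((contDiff_cross hg j).differentiable one_ne_zero) (p + T z)).hasFDerivAt
      (T.hasFDerivAt.const_add p)
  have hc : ∀ j, Continuous fun z => cross g j (p + T z) := fun j =>
    (continuous_cross hg1 j).comp (continuous_const.add T.continuous)
  have hc' : ∀ (j : Fin 2) (v : Plane), Continuous fun z => fderiv ℝ (cross g j) (p + T z) v :=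
    fun j v => (((contDiff_cross hg j).continuous_fderiv one_ne_zero).comp
      (continuous_const.add T.continuous)).clm_apply continuous_const
  have hT10 : T (1, 0) = EuclideanSpace.single 0 1 := by rw [hTe]; simp
  have hT01 : T (0, 1) = EuclideanSpace.single 1 1 := by rw [hTe]; simp
  have hgreen := integral2_divergence_prod_of_hasFDerivAt (fun z => cross g 1 (p + T z))
    (fun z => -cross g 0 (p + T z)) (fun z => (fderiv ℝ (cross g 1) (p + T z)).comp T)
    (fun z => -((fderiv ℝ (cross g 0) (p + T z)).comp T)) 0 0 δ δ
    (hc 1).continuousOn (hc 0).neg.continuousOn (fun z _ => hder 1 z) (fun z _ => (hder 0 z).neg)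
    (by
      refine ContinuousOn.integrableOn_compact (isCompact_uIcc.prod isCompact_uIcc) ?_
      refine Continuous.continuousOn ?_
      simp only [ContinuousLinearMap.comp_apply, neg_apply, hT10, hT01]
      exact (hc' 1 _).add (hc' 0 _).neg)
  have hint : ∀ s r : ℝ, 2 * jacDet g (p + planeEquiv (s, r)) =
      (fderiv ℝ (cross g 1) (p + T (s, r))).comp T (1, 0) +
        (-((fderiv ℝ (cross g 0) (p + T (s, r))).comp T)) (0, 1) := by
    intro s r
    rw [planeEquiv_eq, ← hTe, ← fderiv_cross_sub hg]
    simp only [ContinuousLinearMap.comp_apply, neg_apply, hT10, hT01]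
    ring
  rw [← integral_const_mul, setIntegral_box_eq_intervalIntegral p hδ
    ((continuous_jacDet hg1).const_mul 2)]
  simp only [hint]
  rw [hgreen]
  simp only [edgeCirc, hTe, intervalIntegral.integral_neg, zero_smul, add_zero, zero_add,
    add_assoc, add_comm (_ • EuclideanSpace.single (0 : Fin 2) (1 : ℝ))
      (δ • EuclideanSpace.single (1 : Fin 2) (1 : ℝ))]
  ring

end

section

/-! ### Phases along an edge -/

theorem sq_intervalIntegral_le {f : ℝ → ℝ} (hf : Continuous f) {a b : ℝ} (hab : a ≤ b) :
    (∫ s in a..b, f s) ^ 2 ≤ (b - a) * ∫ s in a..b, f s ^ 2 := by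
  rcases hab.eq_or_lt with rfl | hlt
  · simp
  set m := (∫ s in a..b, f s) / (b - a) with hm
  have hba : 0 < b - a := sub_pos.2 hlt
  have h1 : 0 ≤ ∫ s in a..b, (f s - m) ^ 2 :=
    intervalIntegral.integral_nonneg hab fun s _ => sq_nonneg _
  have h2 : ∫ s in a..b, (f s - m) ^ 2 =
      (∫ s in a..b, f s ^ 2) - 2 * m * (∫ s in a..b, f s) + (b - a) * m ^ 2 := by
    have e : ∀ s, (f s - m) ^ 2 = f s ^ 2 - 2 * m * f s + m ^ 2 := fun s => by ring
    simp only [e]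
    rw [intervalIntegral.integral_add, intervalIntegral.integral_sub,
      intervalIntegral.integral_const_mul, intervalIntegral.integral_const, smul_eq_mul]
    all_goals exact Continuous.intervalIntegrable (by fun_prop) _ _
  have h3 : (∫ s in a..b, f s) = m * (b - a) := by rw [hm]; field_simp
  rw [h2, h3] at h1
  rw [h3]
  nlinarith

/-- If the energy of `γ` is small compared with `ε⁻¹`, then `|γ|` is uniformly close to `1`. -/
theorem abs_one_sub_norm_le_of_energy {γ γ' : ℝ → ℂ} (hd : ∀ s, HasDerivAt γ (γ' s) s)
    (hc : Continuous γ') {δ ε η M : ℝ} (hε : 0 < ε) (hεδ : 2 * ε ≤ δ) (hη : 0 < η)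
    (hM : ∫ s in (0 : ℝ)..δ, (1 / 2 * ‖γ' s‖ ^ 2 + 1 / 2 * (1 / ε ^ 2 * (1 - ‖γ s‖) ^ 2)) ≤ M)
    (hsmall : 8 * M * ε < η ^ 2) {s₀ : ℝ} (hs₀ : s₀ ∈ Set.Icc 0 δ) : |1 - ‖γ s₀‖| ≤ η := by
  by_contra! hcon
  have hγ : Continuous γ := continuous_iff_continuousAt.2 fun s => (hd s).continuousAt
  have hI : ∀ a b : ℝ, IntervalIntegrable (fun s => 1 / 2 * ‖γ' s‖ ^ 2 +
      1 / 2 * (1 / ε ^ 2 * (1 - ‖γ s‖) ^ 2)) volume a b := fun a b =>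
    Continuous.intervalIntegrable (by fun_prop) _ _
  have hI1 : ∀ a b : ℝ, IntervalIntegrable (fun s => 1 / 2 * ‖γ' s‖ ^ 2) volume a b := fun a b =>
    Continuous.intervalIntegrable (by fun_prop) _ _
  have hI2 : ∀ a b : ℝ, IntervalIntegrable
      (fun s => 1 / 2 * (1 / ε ^ 2 * (1 - ‖γ s‖) ^ 2)) volume a b := fun a b =>
    Continuous.intervalIntegrable (by fun_prop) _ _
  -- An interval of length `ε` containing `s₀` and lying on one side of it fits into `[0, δ]`
  -- because `2ε ≤ δ`.
  obtain ⟨p, hp0, hpδ, hsp⟩ : ∃ p, 0 ≤ p ∧ p + ε ≤ δ ∧ s₀ ∈ Set.Icc p (p + ε) := by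
    rcases le_total (s₀ + ε) δ with h | h
    · exact ⟨s₀, hs₀.1, h, le_rfl, by linarith⟩
    · exact ⟨s₀ - ε, by linarith, by linarith [hs₀.2], by linarith, by linarith⟩
  have hpp : p ≤ p + ε := by linarith
  have hsub : ∫ s in p..(p + ε), (1 / 2 * ‖γ' s‖ ^ 2 + 1 / 2 * (1 / ε ^ 2 * (1 - ‖γ s‖) ^ 2)) ≤ M := by
    refine le_trans ?_ hM
    exact intervalIntegral.integral_mono_interval hp0 hpp hpδ
      (Eventually.of_forall fun s => by positivity) (hI 0 δ)
  rw [intervalIntegral.integral_add (hI1 _ _) (hI2 _ _)] at hsub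
  have hA0 : 0 ≤ ∫ s in p..(p + ε), 1 / 2 * ‖γ' s‖ ^ 2 :=
    intervalIntegral.integral_nonneg hpp fun s _ => by positivity
  have hB0 : 0 ≤ ∫ s in p..(p + ε), 1 / 2 * (1 / ε ^ 2 * (1 - ‖γ s‖) ^ 2) :=
    intervalIntegral.integral_nonneg hpp fun s _ => by positivity
  have hA : ∫ s in p..(p + ε), ‖γ' s‖ ^ 2 ≤ 2 * M := by
    rw [intervalIntegral.integral_const_mul] at hA0 hsub
    linarith
  have hlen : (∫ s in p..(p + ε), ‖γ' s‖) ^ 2 ≤ ε * (2 * M) := by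
    have := sq_intervalIntegral_le hc.norm hpp
    rw [add_sub_cancel_left] at this
    exact this.trans (mul_le_mul_of_nonneg_left hA hε.le)
  -- Here `γ` varies by at most `√(2Mε) ≤ η/2`. The modulus therefore stays at distance `η/2` from
  -- one on the whole interval, and the potential alone costs `η²/(8ε) > M`.
  have hlen' : ∫ s in p..(p + ε), ‖γ' s‖ ≤ η / 2 := by
    refine le_of_sq_le_sq ?_ (by positivity)
    nlinarith
  have hclose : ∀ s ∈ Set.Icc p (p + ε), ‖γ s - γ s₀‖ ≤ η / 2 := by
    intro s hs
    have h1 : ∀ a b, p ≤ a → a ≤ b → b ≤ p + ε → ‖γ b - γ a‖ ≤ η / 2 := by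
      intro a b ha hab hb
      rw [← intervalIntegral.integral_eq_sub_of_hasDerivAt (fun s _ => hd s)
        (hc.intervalIntegrable _ _)]
      refine (intervalIntegral.norm_integral_le_integral_norm hab).trans (le_trans ?_ hlen')
      exact intervalIntegral.integral_mono_interval ha hab hb
        (Eventually.of_forall fun s => norm_nonneg _) (hc.norm.intervalIntegrable _ _)
    rcases le_total s₀ s with h | h
    · exact h1 _ _ hsp.1 h hs.2
    · rw [norm_sub_rev]; exact h1 _ _ hs.1 h hsp.2
  have hlow : ∀ s ∈ Set.Icc p (p + ε), 1 / 2 * (1 / ε ^ 2 * (η / 2) ^ 2) ≤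
      1 / 2 * (1 / ε ^ 2 * (1 - ‖γ s‖) ^ 2) := by
    intro s hs
    have h1 := abs_norm_sub_norm_le (γ s) (γ s₀)
    have h2 : η / 2 ≤ |1 - ‖γ s‖| := by
      have h3 : |1 - ‖γ s₀‖| ≤ |1 - ‖γ s‖| + |‖γ s‖ - ‖γ s₀‖| := by
        rw [show 1 - ‖γ s₀‖ = (1 - ‖γ s‖) + (‖γ s‖ - ‖γ s₀‖) by ring]
        exact abs_add_le _ _
      linarith [hclose s hs]
    rw [← sq_abs (1 - ‖γ s‖)]
    gcongr
  have hint : ε * (1 / 2 * (1 / ε ^ 2 * (η / 2) ^ 2)) ≤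
      ∫ s in p..(p + ε), 1 / 2 * (1 / ε ^ 2 * (1 - ‖γ s‖) ^ 2) := by
    have := intervalIntegral.integral_mono_on hpp (intervalIntegrable_const) (hI2 _ _) hlow
    rwa [intervalIntegral.integral_const, add_sub_cancel_left, smul_eq_mul] at this
  have hfin : ε * (1 / 2 * (1 / ε ^ 2 * (η / 2) ^ 2)) = η ^ 2 / (8 * ε) := by field_simp; norm_num
  have hle : η ^ 2 / (8 * ε) ≤ M := by rw [← hfin]; linarith
  rw [div_le_iff₀ (by positivity)] at hle
  linarith

/-- The function `γ exp(-∫ γ'/γ)` has zero derivative. -/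
theorem eq_mul_exp_integral {γ γ' : ℝ → ℂ} (hd : ∀ s, HasDerivAt γ (γ' s) s)
    (hc : Continuous γ') {δ : ℝ} (hδ : 0 ≤ δ) (h0 : ∀ s ∈ Set.Icc 0 δ, γ s ≠ 0) :
    γ δ = γ 0 * Complex.exp (∫ s in (0 : ℝ)..δ, γ' s / γ s) := by
  have hγ : Continuous γ := continuous_iff_continuousAt.2 fun s => (hd s).continuousAt
  set q : ℝ → ℂ := fun s => γ' s / γ s with hq
  have hqc : ∀ s ∈ Set.Icc 0 δ, ContinuousAt q s := fun s hs =>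
    hc.continuousAt.div hγ.continuousAt (h0 s hs)
  have hqm : Measurable q := hc.measurable.div hγ.measurable
  have hqi : ∀ s ∈ Set.Icc 0 δ, IntervalIntegrable q volume 0 s := by
    intro s hs
    refine ContinuousOn.intervalIntegrable fun r hr => (hqc r ?_).continuousWithinAt
    rw [Set.uIcc_of_le hs.1] at hr
    exact ⟨hr.1, hr.2.trans hs.2⟩
  have hQd : ∀ s ∈ Set.Icc 0 δ, HasDerivAt (fun s => ∫ r in (0 : ℝ)..s, q r) (q s) s := fun s hs =>
    intervalIntegral.integral_hasDerivAt_right (hqi s hs)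
      hqm.stronglyMeasurable.stronglyMeasurableAtFilter (hqc s hs)
  set F : ℝ → ℂ := fun s => γ s * Complex.exp (-∫ r in (0 : ℝ)..s, q r) with hF
  have hFd : ∀ s ∈ Set.Icc 0 δ, HasDerivAt F 0 s := by
    intro s hs
    refine ((hd s).mul (hQd s hs).neg.cexp).congr_deriv ?_
    have := h0 s hs
    simp only [hq]
    field_simp
    ring
  have hconst := constant_of_has_deriv_right_zero
    (fun s hs => (hFd s hs).continuousAt.continuousWithinAt)
    (fun s hs => (hFd s ⟨hs.1, hs.2.le⟩).hasDerivWithinAt) δ ⟨hδ, le_rfl⟩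
  simp only [hF, intervalIntegral.integral_same, neg_zero, Complex.exp_zero, mul_one] at hconst
  rw [← hconst, mul_assoc, ← Complex.exp_add]
  simp

theorem exists_arg_sub_arg_eq {γ γ' : ℝ → ℂ} (hd : ∀ s, HasDerivAt γ (γ' s) s)
    (hc : Continuous γ') {δ : ℝ} (hδ : 0 ≤ δ) (h0 : ∀ s ∈ Set.Icc 0 δ, γ s ≠ 0) :
    ∃ n : ℤ, (γ δ).arg - (γ 0).arg = (∫ s in (0 : ℝ)..δ, γ' s / γ s).im + 2 * Real.pi * n := by
  have h1 := eq_mul_exp_integral hd hc hδ h0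
  set Z := ∫ s in (0 : ℝ)..δ, γ' s / γ s
  have h2 : ((γ δ).arg : Real.Angle) = ((γ 0).arg : Real.Angle) + (Z.im : Real.Angle) := by
    rw [h1, Complex.arg_mul_coe_angle (h0 0 ⟨le_rfl, hδ⟩) (Complex.exp_ne_zero _)]
    congr 1
    rw [Complex.arg_exp]
    exact Real.Angle.coe_toIocMod _ _
  rw [← Real.Angle.coe_add, Real.Angle.angle_eq_iff_two_pi_dvd_sub] at h2
  obtain ⟨n, hn⟩ := h2
  exact ⟨n, by linarith⟩

/-- Comparison of the phase difference along an edge with the energy and with the current. -/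
theorem exists_phase_increment {γ γ' : ℝ → ℂ} (hd : ∀ s, HasDerivAt γ (γ' s) s)
    (hc : Continuous γ') {δ ε η : ℝ} (hδ : 0 ≤ δ) (hε : 0 < ε) (hη2 : η ≤ 1 / 2)
    (hclose : ∀ s ∈ Set.Icc 0 δ, |1 - ‖γ s‖| ≤ η) :
    ∃ (b : ℝ) (n : ℤ), 1 / (2 * Real.pi) * (γ δ).arg - 1 / (2 * Real.pi) * (γ 0).arg = b + n ∧
      4 * Real.pi ^ 2 * b ^ 2 ≤ δ / (1 - η) ^ 2 * ∫ s in (0 : ℝ)..δ, ‖γ' s‖ ^ 2 ∧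
      |b - 1 / (2 * Real.pi) *
          ∫ s in (0 : ℝ)..δ, ((γ s).re * (γ' s).im - (γ s).im * (γ' s).re)| ≤
        ε * ∫ s in (0 : ℝ)..δ, (1 / 2 * ‖γ' s‖ ^ 2 + 1 / 2 * (1 / ε ^ 2 * (1 - ‖γ s‖) ^ 2)) := by
  have hγ : Continuous γ := continuous_iff_continuousAt.2 fun s => (hd s).continuousAt
  have hlow : ∀ s ∈ Set.Icc 0 δ, 1 - η ≤ ‖γ s‖ := fun s hs => by
    have := (abs_le.1 (hclose s hs)).2; linarith
  have h1η : 0 < 1 - η := by linarith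
  have h0 : ∀ s ∈ Set.Icc 0 δ, γ s ≠ 0 := fun s hs => by
    rw [← norm_pos_iff]; exact h1η.trans_le (hlow s hs)
  obtain ⟨n, hn⟩ := exists_arg_sub_arg_eq hd hc hδ h0
  set q : ℝ → ℂ := fun s => γ' s / γ s with hq
  have hqcon : ContinuousOn q (Set.Icc 0 δ) := hc.continuousOn.div hγ.continuousOn h0
  have hqi : IntervalIntegrable q volume 0 δ :=
    ContinuousOn.intervalIntegrable (by rwa [Set.uIcc_of_le hδ])
  have him : (∫ s in (0 : ℝ)..δ, q s).im = ∫ s in (0 : ℝ)..δ, (q s).im :=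
    (Complex.imCLM.intervalIntegral_comp_comm hqi).symm
  have hqim : IntervalIntegrable (fun s => (q s).im) volume 0 δ := by
    refine ContinuousOn.intervalIntegrable ?_
    rw [Set.uIcc_of_le hδ]
    exact Complex.continuous_im.comp_continuousOn hqcon
  have hpi := Real.pi_pos
  have hformula : ∀ s, (q s).im * ‖γ s‖ ^ 2 = (γ s).re * (γ' s).im - (γ s).im * (γ' s).re := by
    intro s
    by_cases hs : γ s = 0
    · simp [hs]
    have hns : Complex.normSq (γ s) ≠ 0 := by rwa [Ne, Complex.normSq_eq_zero]
    rw [← Complex.normSq_eq_norm_sq]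
    simp only [hq, Complex.div_im]
    field_simp
  have hqle : ∀ s ∈ Set.Icc 0 δ, |(q s).im| ≤ ‖γ' s‖ / (1 - η) := by
    intro s hs
    refine (Complex.abs_im_le_norm _).trans ?_
    simp only [hq, norm_div]
    exact div_le_div_of_nonneg_left (norm_nonneg _) h1η (hlow s hs)
  -- `b` is the increment of the lifted phase, in turns; `n` accounts for the jumps of the principal
  -- argument.
  refine ⟨1 / (2 * Real.pi) * ∫ s in (0 : ℝ)..δ, (q s).im, n, ?_, ?_, ?_⟩
  · rw [← mul_sub, hn, him]
    field_simp
  · have h3 : |∫ s in (0 : ℝ)..δ, (q s).im| ≤ ∫ s in (0 : ℝ)..δ, ‖γ' s‖ / (1 - η) := by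
      refine (intervalIntegral.abs_integral_le_integral_abs hδ).trans ?_
      refine intervalIntegral.integral_mono_on hδ hqim.abs ?_ hqle
      exact Continuous.intervalIntegrable (by fun_prop) _ _
    have h4 := sq_intervalIntegral_le hc.norm hδ
    rw [intervalIntegral.integral_div] at h3
    rw [sub_zero] at h4
    have h5 : (∫ s in (0 : ℝ)..δ, (q s).im) ^ 2 ≤ ((∫ s in (0 : ℝ)..δ, ‖γ' s‖) / (1 - η)) ^ 2 := by
      rw [← sq_abs]; gcongr
    calc 4 * Real.pi ^ 2 * (1 / (2 * Real.pi) * ∫ s in (0 : ℝ)..δ, (q s).im) ^ 2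
        = (∫ s in (0 : ℝ)..δ, (q s).im) ^ 2 := by field_simp; norm_num
      _ ≤ ((∫ s in (0 : ℝ)..δ, ‖γ' s‖) / (1 - η)) ^ 2 := h5
      _ = (∫ s in (0 : ℝ)..δ, ‖γ' s‖) ^ 2 / (1 - η) ^ 2 := by rw [div_pow]
      _ ≤ (δ * ∫ s in (0 : ℝ)..δ, ‖γ' s‖ ^ 2) / (1 - η) ^ 2 := by gcongr
      _ = _ := by ring
  · have hcr : IntervalIntegrable (fun s => (γ s).re * (γ' s).im - (γ s).im * (γ' s).re)
        volume 0 δ := Continuous.intervalIntegrable (by fun_prop) _ _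
    rw [← mul_sub, ← intervalIntegral.integral_sub hqim hcr, abs_mul, abs_of_pos (by positivity),
      ← intervalIntegral.integral_const_mul]
    have h6 : |∫ s in (0 : ℝ)..δ, ((q s).im - ((γ s).re * (γ' s).im - (γ s).im * (γ' s).re))| ≤
        ∫ s in (0 : ℝ)..δ, 3 * (ε * (1 / 2 * ‖γ' s‖ ^ 2 + 1 / 2 * (1 / ε ^ 2 * (1 - ‖γ s‖) ^ 2))) := by
      refine (intervalIntegral.abs_integral_le_integral_abs hδ).trans ?_
      refine intervalIntegral.integral_mono_on hδ (hqim.sub hcr).abs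
        (Continuous.intervalIntegrable (by fun_prop) _ _) fun s hs => ?_
      rw [← hformula]
      have hγs : 0 < ‖γ s‖ := norm_pos_iff.2 (h0 s hs)
      have e1 : |(q s).im| ≤ ‖γ' s‖ / ‖γ s‖ := by
        refine (Complex.abs_im_le_norm _).trans ?_
        simp only [hq, norm_div, le_refl]
      -- The lifted phase and the current differ by a factor `1 - |γ|²`, so their difference is at
      -- most `3 |γ'| |1 - |γ||`. The arithmetic-geometric inequality bounds this by `3ε` times the
      -- energy density, and `3/(2π) ≤ 1`.
      have e2 : (q s).im - (q s).im * ‖γ s‖ ^ 2 = (q s).im * ((1 - ‖γ s‖) * (1 + ‖γ s‖)) := by ring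
      rw [e2, abs_mul, abs_mul, abs_of_pos (by positivity : 0 < 1 + ‖γ s‖)]
      have e3 : 1 + ‖γ s‖ ≤ 3 * ‖γ s‖ := by linarith [hlow s hs]
      have e4 : ‖γ' s‖ * |1 - ‖γ s‖| ≤
          ε * (1 / 2 * ‖γ' s‖ ^ 2 + 1 / 2 * (1 / ε ^ 2 * (1 - ‖γ s‖) ^ 2)) := by
        rw [← sq_abs (1 - ‖γ s‖)]
        have : ε * (1 / 2 * ‖γ' s‖ ^ 2 + 1 / 2 * (1 / ε ^ 2 * |1 - ‖γ s‖| ^ 2)) -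
            ‖γ' s‖ * |1 - ‖γ s‖| = (ε * ‖γ' s‖ - |1 - ‖γ s‖|) ^ 2 / (2 * ε) := by
          field_simp; ring
        have h7 : 0 ≤ (ε * ‖γ' s‖ - |1 - ‖γ s‖|) ^ 2 / (2 * ε) := by positivity
        linarith
      calc |(q s).im| * (|1 - ‖γ s‖| * (1 + ‖γ s‖))
          ≤ ‖γ' s‖ / ‖γ s‖ * (|1 - ‖γ s‖| * (3 * ‖γ s‖)) := by gcongr
        _ = 3 * (‖γ' s‖ * |1 - ‖γ s‖|) := by field_simp
        _ ≤ _ := by gcongr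
    rw [intervalIntegral.integral_const_mul] at h6
    rw [intervalIntegral.integral_const_mul] at h6 ⊢
    have hX : 0 ≤ ε * ∫ s in (0 : ℝ)..δ,
        (1 / 2 * ‖γ' s‖ ^ 2 + 1 / 2 * (1 / ε ^ 2 * (1 - ‖γ s‖) ^ 2)) :=
      mul_nonneg hε.le (intervalIntegral.integral_nonneg hδ fun s _ => by positivity)
    have h8 : 1 / (2 * Real.pi) * 3 ≤ 1 := by
      rw [one_div_mul_eq_div, div_le_one (by positivity)]
      linarith [Real.pi_gt_three]
    refine (mul_le_mul_of_nonneg_left h6 (by positivity)).trans ?_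
    rw [← mul_assoc]
    exact mul_le_of_le_one_left hX h8

end

section

variable {Ω : Set Plane} {ε : ℝ}

/-! ### Lattice edges carrying little energy -/

/-- The part of the energy density seen by an edge in direction `j`. -/
def edgeDensity (ε : ℝ) (g : Plane → Plane) (j : Fin 2) (x : Plane) : ℝ :=
  1 / 2 * (grad g 0 j x ^ 2 + grad g 1 j x ^ 2) + 1 / 2 * (1 / ε ^ 2 * (1 - ‖g x‖) ^ 2)

theorem edgeDensity_nonneg (ε : ℝ) (g : Plane → Plane) (j : Fin 2) (x : Plane) :
    0 ≤ edgeDensity ε g j x := by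
  unfold edgeDensity; positivity

/-- The even splitting of the potential makes the two families of edges together see exactly the
bulk energy, which keeps the final constant sharp. -/
theorem edgeDensity_add (ε : ℝ) (g : Plane → Plane) (x : Plane) :
    edgeDensity ε g 0 x + edgeDensity ε g 1 x = glDensity ε g x := by
  unfold edgeDensity glDensity
  rw [gradSq_eq]
  ring

theorem continuous_edgeDensity {g : Plane → Plane} (hg : ContDiff ℝ 1 g) (ε : ℝ) (j : Fin 2) :
    Continuous (edgeDensity ε g j) := by
  have h0 := continuous_grad hg 0 j
  have h1 := continuous_grad hg 1 j
  have h2 := hg.continuous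
  unfold edgeDensity
  fun_prop

/-- The energy carried by the edge of length `δ` from `p` in direction `j`. -/
def edgeEnergy (ε : ℝ) (g : Plane → Plane) (δ : ℝ) (j : Fin 2) (p : Plane) : ℝ :=
  ∫ s in (0 : ℝ)..δ, edgeDensity ε g j (p + s • EuclideanSpace.single j 1)

theorem edgeEnergy_nonneg (ε : ℝ) (g : Plane → Plane) {δ : ℝ} (hδ : 0 ≤ δ) (j : Fin 2)
    (p : Plane) : 0 ≤ edgeEnergy ε g δ j p :=
  intervalIntegral.integral_nonneg hδ fun _ _ => edgeDensity_nonneg ε g j _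

theorem ofReal_edgeEnergy {g : Plane → Plane} (hg : ContDiff ℝ 1 g) (ε : ℝ) {δ : ℝ} (hδ : 0 ≤ δ)
    (j : Fin 2) (p : Plane) : ENNReal.ofReal (edgeEnergy ε g δ j p) =
      ∫⁻ s in Set.Ioc 0 δ,
        ENNReal.ofReal (edgeDensity ε g j (p + s • EuclideanSpace.single j 1)) := by
  have hc := continuous_edgeDensity hg ε j
  have hc' : Continuous fun s : ℝ => edgeDensity ε g j (p + s • EuclideanSpace.single j 1) := by
    fun_prop
  rw [edgeEnergy, intervalIntegral.integral_of_le hδ]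
  exact ofReal_integral_eq_lintegral_ofReal
    ((intervalIntegrable_iff_integrableOn_Ioc_of_le hδ).1 (hc'.intervalIntegrable 0 δ))
    (Eventually.of_forall fun s => edgeDensity_nonneg ε g j _)

theorem disjoint_box_latticePt {δ : ℝ} (hδ : 0 < δ) (a : Plane) {k l : ℤ × ℤ} (hkl : k ≠ l) :
    Disjoint (box (latticePt δ k + a) δ) (box (latticePt δ l + a) δ) := by
  refine Set.disjoint_left.2 fun x hx hy => hkl ?_
  obtain ⟨⟨h1, h2⟩, h3, h4⟩ := hx
  obtain ⟨⟨h5, h6⟩, h7, h8⟩ := hy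
  simp only [PiLp.add_apply, latticePt_zero, latticePt_one] at h1 h2 h3 h4 h5 h6 h7 h8
  have key : ∀ m n : ℤ, δ * m < δ * n + δ → m ≤ n := by
    intro m n h
    have : (m : ℝ) < n + 1 := by
      by_contra! hc
      nlinarith
    exact Int.lt_add_one_iff.1 (by exact_mod_cast this)
  refine Prod.ext ?_ ?_
  · exact le_antisymm (key _ _ (by linarith)) (key _ _ (by linarith))
  · exact le_antisymm (key _ _ (by linarith)) (key _ _ (by linarith))

theorem dist_le_of_mem_box {δ : ℝ} {p x : Plane} (hx : x ∈ box p δ) : dist x p ≤ 2 * δ := by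
  obtain ⟨⟨h1, h2⟩, h3, h4⟩ := hx
  rw [two_mul]
  exact dist_le_of_abs_sub_le (abs_le.2 ⟨by linarith, by linarith⟩)
    (abs_le.2 ⟨by linarith, by linarith⟩)

/-- Fubini: for a fixed position `s` along the edge the squares swept by the translations are
disjoint, so their sum is at most the bulk integral. Integrating over `s` gives the factor `δ`.
Points of an edge are within `2δ + δ` of its site. -/
theorem lintegral_sum_edgeEnergy_le {g : Plane → Plane} (hg : ContDiff ℝ 1 g) (ε : ℝ) {δ : ℝ}
    (hδ : 0 < δ) (j : Fin 2) (S : Finset (ℤ × ℤ)) {T : Set Plane}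
    (hT : ∀ k ∈ S, ∀ y, dist y (latticePt δ k) ≤ 3 * δ → y ∈ T) :
    ∫⁻ τ in box 0 δ, ∑ k ∈ S, ENNReal.ofReal (edgeEnergy ε g δ j (latticePt δ k + τ)) ≤
      ENNReal.ofReal δ * ∫⁻ x in T, ENNReal.ofReal (edgeDensity ε g j x) := by
  have hc := continuous_edgeDensity hg ε j
  set e : Plane := EuclideanSpace.single j 1 with he
  have hm : ∀ k : ℤ × ℤ, Measurable fun q : Plane × ℝ =>
      ENNReal.ofReal (edgeDensity ε g j (latticePt δ k + q.1 + q.2 • e)) := fun k =>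
    (by fun_prop : Continuous fun q : Plane × ℝ =>
      edgeDensity ε g j (latticePt δ k + q.1 + q.2 • e)).measurable.ennreal_ofReal
  have hm1 : ∀ (k : ℤ × ℤ) (τ : Plane), Measurable fun s : ℝ =>
      ENNReal.ofReal (edgeDensity ε g j (latticePt δ k + τ + s • e)) := fun k τ =>
    (by fun_prop : Continuous fun s : ℝ =>
      edgeDensity ε g j (latticePt δ k + τ + s • e)).measurable.ennreal_ofReal
  have hm2 : ∀ (k : ℤ × ℤ) (s : ℝ), Measurable fun τ : Plane =>
      ENNReal.ofReal (edgeDensity ε g j (latticePt δ k + τ + s • e)) := fun k s =>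
    (by fun_prop : Continuous fun τ : Plane =>
      edgeDensity ε g j (latticePt δ k + τ + s • e)).measurable.ennreal_ofReal
  calc ∫⁻ τ in box 0 δ, ∑ k ∈ S, ENNReal.ofReal (edgeEnergy ε g δ j (latticePt δ k + τ))
      = ∫⁻ τ in box 0 δ, ∫⁻ s in Set.Ioc 0 δ, ∑ k ∈ S,
          ENNReal.ofReal (edgeDensity ε g j (latticePt δ k + τ + s • e)) := by
        refine lintegral_congr fun τ => ?_
        rw [lintegral_finsetSum]
        · exact Finset.sum_congr rfl fun k _ => ofReal_edgeEnergy hg ε hδ.le j _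
        · exact fun k _ => hm1 k τ
    _ = ∫⁻ s in Set.Ioc 0 δ, ∫⁻ τ in box 0 δ, ∑ k ∈ S,
          ENNReal.ofReal (edgeDensity ε g j (latticePt δ k + τ + s • e)) :=
        lintegral_lintegral_swap (Finset.measurable_fun_sum _ fun k _ => hm k).aemeasurable
    _ ≤ ∫⁻ s in Set.Ioc 0 δ, ∫⁻ x in T, ENNReal.ofReal (edgeDensity ε g j x) := by
        refine setLIntegral_mono' measurableSet_Ioc fun s hs => ?_
        rw [lintegral_finsetSum]
        · have h1 : ∀ k ∈ S, ∫⁻ τ in box 0 δ,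
              ENNReal.ofReal (edgeDensity ε g j (latticePt δ k + τ + s • e)) =
              ∫⁻ x in box (latticePt δ k + s • e) δ, ENNReal.ofReal (edgeDensity ε g j x) := by
            intro k _
            rw [setLIntegral_box_eq (latticePt δ k + s • e)]
            exact lintegral_congr fun τ => by rw [add_right_comm]
          rw [Finset.sum_congr rfl h1, ← lintegral_biUnion_finset]
          · refine lintegral_mono_set ?_
            refine Set.iUnion₂_subset fun k hk x hx => hT k hk x ?_
            have h2 := dist_le_of_mem_box hx
            have h3 : dist (latticePt δ k + s • e) (latticePt δ k) ≤ δ := by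
              rw [dist_self_add_left, norm_smul, he, PiLp.norm_single, norm_one, mul_one,
                Real.norm_eq_abs, abs_of_pos hs.1]
              exact hs.2
            linarith [dist_triangle x (latticePt δ k + s • e) (latticePt δ k)]
          · exact fun k _ l _ hkl => disjoint_box_latticePt hδ _ hkl
          · exact fun k _ => measurableSet_box _ _
        · exact fun k _ => hm2 k s
    _ = _ := by
        rw [setLIntegral_const, Real.volume_Ioc, sub_zero, mul_comm]

theorem measurable_edgeEnergy {g : Plane → Plane} (hg : ContDiff ℝ 1 g) (ε δ : ℝ) (j : Fin 2) :
    Continuous (edgeEnergy ε g δ j) := by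
  have hc := continuous_edgeDensity hg ε j
  exact intervalIntegral.continuous_parametric_intervalIntegral_of_continuous' (by fun_prop) 0 δ

/-- Some translate of the lattice of step `δ` carries at most `1/δ` times the bulk energy. -/
theorem exists_translate_edgeEnergy_le (hbdd : Bornology.IsBounded Ω) {g : Plane → Plane}
    (hg : ContDiff ℝ 1 g) (ε : ℝ) {δ : ℝ} (hδ : 0 < δ) {T : Set Plane}
    (hT : ∀ x ∈ Ω, ∀ y, dist y x ≤ 3 * δ → y ∈ T) {E : ℝ} (hE0 : 0 ≤ E)
    (hE : ∫⁻ x in T, ENNReal.ofReal (glDensity ε g x) ≤ ENNReal.ofReal E) :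
    ∃ τ ∈ box 0 δ, bondSum Ω δ (fun k => edgeEnergy ε g δ 0 (latticePt δ k + τ))
      (fun k => edgeEnergy ε g δ 1 (latticePt δ k + τ)) ≤ E / δ := by
  set H := (finite_hBonds hbdd hδ).toFinset with hH
  set W := (finite_vBonds hbdd hδ).toFinset with hW
  set F : Plane → ℝ≥0∞ := fun τ =>
    ∑ k ∈ H, ENNReal.ofReal (edgeEnergy ε g δ 0 (latticePt δ k + τ)) +
      ∑ k ∈ W, ENNReal.ofReal (edgeEnergy ε g δ 1 (latticePt δ k + τ)) with hF
  have hm : ∀ (j : Fin 2) (S : Finset (ℤ × ℤ)), Measurable fun τ =>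
      ∑ k ∈ S, ENNReal.ofReal (edgeEnergy ε g δ j (latticePt δ k + τ)) := fun j S =>
    Finset.measurable_fun_sum _ fun k _ => ((measurable_edgeEnergy hg ε δ j).comp
      (continuous_const.add continuous_id)).measurable.ennreal_ofReal
  have hmF : Measurable F := (hm 0 H).add (hm 1 W)
  have h1 : ∫⁻ τ in box 0 δ, F τ ≤ ENNReal.ofReal (δ * E) := by
    rw [hF, lintegral_add_left (hm 0 H)]
    refine (add_le_add
      (lintegral_sum_edgeEnergy_le hg ε hδ 0 H (T := T) fun k hk => hT _ ?_)
      (lintegral_sum_edgeEnergy_le hg ε hδ 1 W (T := T) fun k hk => hT _ ?_)).trans ?_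
    · exact ((Set.Finite.mem_toFinset _).1 hk).1
    · exact ((Set.Finite.mem_toFinset _).1 hk).1
    · rw [← mul_add, ← lintegral_add_left (continuous_edgeDensity hg ε 0).measurable.ennreal_ofReal,
        ENNReal.ofReal_mul hδ.le]
      refine mul_le_mul_right (le_of_eq_of_le (lintegral_congr fun x => ?_) hE) _
      rw [← ENNReal.ofReal_add (edgeDensity_nonneg _ _ _ _) (edgeDensity_nonneg _ _ _ _),
        edgeDensity_add]
  have hvol := volume_box_zero hδ.le
  -- Some translate does not exceed the average, which is at most `δE` divided by the area `δ²`.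
  obtain ⟨τ, hτ, h2⟩ := exists_le_setLAverage (μ := volume) (s := box 0 δ) (f := F)
    (by rw [hvol]; simp [hδ.ne']) (by rw [hvol]; exact ENNReal.ofReal_ne_top)
    hmF.aemeasurable
  refine ⟨τ, hτ, ?_⟩
  rw [setLAverage_eq, hvol] at h2
  have h3 : F τ ≤ ENNReal.ofReal (E / δ) := by
    refine h2.trans ?_
    rw [show E / δ = δ * E / δ ^ 2 by field_simp, ENNReal.ofReal_div_of_pos (by positivity)]
    exact ENNReal.div_le_div_right h1 _
  rw [bondSum_eq hbdd hδ, ← ENNReal.ofReal_le_ofReal_iff (by positivity), ENNReal.ofReal_add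
    (Finset.sum_nonneg fun k _ => edgeEnergy_nonneg _ _ hδ.le _ _)
    (Finset.sum_nonneg fun k _ => edgeEnergy_nonneg _ _ hδ.le _ _),
    ENNReal.ofReal_sum_of_nonneg fun k _ => edgeEnergy_nonneg _ _ hδ.le _ _,
    ENNReal.ofReal_sum_of_nonneg fun k _ => edgeEnergy_nonneg _ _ hδ.le _ _]
  exact h3

/-! ### Phases along an edge -/

/-- The phase of a planar vector, in turns. -/
def turn (y : Plane) : ℝ := 1 / (2 * Real.pi) * (Complex.mk (y 0) (y 1)).arg

/-- The edge is read as a curve in `ℂ`. The factor two appears because the edge energy contains one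
half of the squared speed. -/
theorem exists_turn_increment {g : Plane → Plane} (hg : ContDiff ℝ 1 g) {δ η : ℝ} (hδ : 0 < δ)
    (hε : 0 < ε) (hεδ : 2 * ε ≤ δ) (hη : 0 < η) (hη2 : η ≤ 1 / 2) (j : Fin 2) (p : Plane)
    (hsmall : 8 * edgeEnergy ε g δ j p * ε < η ^ 2) :
    ∃ (b : ℝ) (n : ℤ), turn (g (p + δ • EuclideanSpace.single j 1)) - turn (g p) = b + n ∧
      4 * Real.pi ^ 2 * b ^ 2 ≤ 2 * δ / (1 - η) ^ 2 * edgeEnergy ε g δ j p ∧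
      |b - 1 / (2 * Real.pi) * edgeCirc g δ j p| ≤ ε * edgeEnergy ε g δ j p := by
  set e : Plane := EuclideanSpace.single j 1 with he
  set γ : ℝ → ℂ := fun s => ⟨g (p + s • e) 0, g (p + s • e) 1⟩ with hγ
  set γ' : ℝ → ℂ := fun s => ⟨grad g 0 j (p + s • e), grad g 1 j (p + s • e)⟩ with hγ'
  have hline : ∀ s : ℝ, HasDerivAt (fun s : ℝ => p + s • e) e s := fun s => by
    simpa using ((hasDerivAt_id s).smul_const e).const_add p
  have hgl : ∀ s : ℝ, HasDerivAt (fun s : ℝ => g (p + s • e)) (fderiv ℝ g (p + s • e) e) s :=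
    fun s => ((hg.differentiable one_ne_zero) _).hasFDerivAt.comp_hasDerivAt s (hline s)
  have hco : ∀ (a : Fin 2) (s : ℝ), HasDerivAt (fun s : ℝ => g (p + s • e) a)
      (grad g a j (p + s • e)) s := fun a s =>
    ((EuclideanSpace.proj a : Plane →L[ℝ] ℝ).hasFDerivAt.comp_hasDerivAt s (hgl s))
  have hmk : ∀ a b : ℝ, (⟨a, b⟩ : ℂ) = a + b * Complex.I := Complex.mk_eq_add_mul_I
  have hd : ∀ s, HasDerivAt γ (γ' s) s := by
    intro s
    simp only [hγ, hγ', hmk]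
    exact ((hco 0 s).ofReal_comp).add (((hco 1 s).ofReal_comp).mul_const _)
  have hc0 := continuous_grad hg 0 j
  have hc1 := continuous_grad hg 1 j
  have hc : Continuous γ' := by
    simp only [hγ', hmk]
    fun_prop
  have hn : ∀ s, ‖γ s‖ = ‖g (p + s • e)‖ := by
    intro s
    rw [EuclideanSpace.norm_eq, Fin.sum_univ_two, Complex.norm_def, Complex.normSq_apply]
    simp [hγ, sq]
  have hn' : ∀ s, ‖γ' s‖ ^ 2 = grad g 0 j (p + s • e) ^ 2 + grad g 1 j (p + s • e) ^ 2 := by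
    intro s
    rw [← Complex.normSq_eq_norm_sq, Complex.normSq_apply]
    simp [hγ', sq]
  have hen : ∫ s in (0 : ℝ)..δ, (1 / 2 * ‖γ' s‖ ^ 2 + 1 / 2 * (1 / ε ^ 2 * (1 - ‖γ s‖) ^ 2)) =
      edgeEnergy ε g δ j p := by
    simp only [hn, hn']
    rfl
  obtain ⟨b, n, h1, h2, h3⟩ := exists_phase_increment hd hc hδ.le hε hη2 fun s hs =>
    abs_one_sub_norm_le_of_energy hd hc hε hεδ hη hen.le hsmall hs
  refine ⟨b, n, ?_, h2.trans ?_, ?_⟩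
  · rw [← h1]
    simp [turn, hγ]
  · rw [← hen, mul_comm 2 δ, mul_div_right_comm, mul_assoc, ← intervalIntegral.integral_const_mul (2 : ℝ)]
    have hγc : Continuous γ := continuous_iff_continuousAt.2 fun s => (hd s).continuousAt
    refine mul_le_mul_of_nonneg_left ?_ (div_nonneg hδ.le (sq_nonneg _))
    refine intervalIntegral.integral_mono_on hδ.le
      (Continuous.intervalIntegrable (by fun_prop) _ _)
      (Continuous.intervalIntegrable (by fun_prop) _ _) fun s _ => ?_
    have : 0 ≤ 1 / ε ^ 2 * (1 - ‖γ s‖) ^ 2 := by positivity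
    linarith
  · rw [hen] at h3
    exact h3

end

section

variable {Ω : Set Plane} {ε : ℝ}

/-! ### Sums over cells and integrals -/

theorem LipC.integrableOn_mul {A : Set Plane} {J : Plane → ℝ} (hJ : IntegrableOn J A)
    (φ : LipC Ω) : IntegrableOn (fun x => J x * φ x) A :=
  hJ.mul_bdd (c := ‖φ‖) φ.continuous.aestronglyMeasurable (Eventually.of_forall φ.abs_le_norm)

theorem abs_setIntegral_mul_le {A : Set Plane} (hA : MeasurableSet A) {J ψ : Plane → ℝ}
    (hJ : IntegrableOn J A) {c : ℝ} (hψ : ∀ x ∈ A, |ψ x| ≤ c) :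
    |∫ x in A, J x * ψ x| ≤ c * ∫ x in A, |J x| := by
  rw [← integral_const_mul]
  refine norm_integral_le_of_norm_le (G := ℝ) (hJ.abs.const_mul c) ?_
  refine (ae_restrict_mem hA).mono fun x hx => ?_
  rw [norm_mul, Real.norm_eq_abs, Real.norm_eq_abs, mul_comm]
  exact mul_le_mul_of_nonneg_right (hψ x hx) (abs_nonneg _)

/-- The union of the half-open cells. -/
def cellUnion (Ω : Set Plane) (δ : ℝ) : Set Plane := ⋃ k ∈ cells Ω δ, box (latticePt δ k) δ

theorem cellUnion_eq (hbdd : Bornology.IsBounded Ω) {δ : ℝ} (hδ : 0 < δ) :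
    cellUnion Ω δ = ⋃ k ∈ (finite_cells hbdd hδ).toFinset, box (latticePt δ k) δ := by
  simp [cellUnion]

theorem measurableSet_cellUnion (hbdd : Bornology.IsBounded Ω) {δ : ℝ} (hδ : 0 < δ) :
    MeasurableSet (cellUnion Ω δ) := by
  rw [cellUnion_eq hbdd hδ]
  exact Finset.measurableSet_biUnion _ fun k _ => measurableSet_box _ _

theorem box_subset_of_mem_cells {δ : ℝ} {k : ℤ × ℤ} (hk : k ∈ cells Ω δ) :
    box (latticePt δ k) δ ⊆ Ω := fun x hx =>
  hk.2 x ⟨hx.1.1, hx.1.2.le⟩ ⟨hx.2.1, hx.2.2.le⟩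

theorem cellUnion_subset {δ : ℝ} : cellUnion Ω δ ⊆ Ω :=
  Set.iUnion₂_subset fun _ hk => box_subset_of_mem_cells hk

theorem pairwiseDisjoint_box {δ : ℝ} (hδ : 0 < δ) (S : Set (ℤ × ℤ)) :
    S.PairwiseDisjoint fun k => box (latticePt δ k) δ := fun k _ l _ hkl => by
  simpa using disjoint_box_latticePt hδ 0 hkl

theorem mem_box_floor {δ : ℝ} (hδ : 0 < δ) (x : Plane) :
    x ∈ box (latticePt δ (⌊x 0 / δ⌋, ⌊x 1 / δ⌋)) δ := by
  have key : ∀ s : ℝ, δ * ⌊s / δ⌋ ≤ s ∧ s < δ * ⌊s / δ⌋ + δ := by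
    intro s
    have h1 := Int.floor_le (s / δ)
    have h2 := Int.lt_floor_add_one (s / δ)
    rw [le_div_iff₀ hδ] at h1
    rw [div_lt_iff₀ hδ] at h2
    constructor <;> linarith
  exact ⟨key (x 0), key (x 1)⟩

/-- The square around `x` is not a cell, so it contains a point outside `Ω`. Hence the Jacobian in
the layer missed by the cells is multiplied by a small test function. -/
theorem LipC.abs_le_of_notMem_cellUnion {δ : ℝ} (hδ : 0 < δ) (φ : LipC Ω) {x : Plane}
    (hx : x ∉ cellUnion Ω δ) : |φ x| ≤ 2 * δ * ‖φ‖ := by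
  have hb := mem_box_floor hδ x
  set k : ℤ × ℤ := (⌊x 0 / δ⌋, ⌊x 1 / δ⌋)
  have hk : k ∉ cells Ω δ := fun hk => hx (Set.mem_iUnion₂.2 ⟨k, hk, hb⟩)
  obtain ⟨z, hz0, hz1, hz⟩ := exists_notMem_of_notMem_cells hδ.le hk
  obtain ⟨⟨h1, h2⟩, h3, h4⟩ := hb
  rw [latticePt_zero] at h1 h2
  rw [latticePt_one] at h3 h4
  obtain ⟨h5, h6⟩ := hz0
  obtain ⟨h7, h8⟩ := hz1
  have hd : dist x z ≤ δ + δ := dist_le_of_abs_sub_le (abs_le.2 ⟨by linarith, by linarith⟩)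
    (abs_le.2 ⟨by linarith, by linarith⟩)
  calc |φ x| ≤ ‖φ‖ * dist x z := φ.abs_le_of_notMem x hz
    _ ≤ ‖φ‖ * (δ + δ) := by gcongr
    _ = _ := by ring

theorem dist_cellCenter_le {δ : ℝ} {k : ℤ × ℤ} {x : Plane} (hx : x ∈ box (latticePt δ k) δ) :
    dist (cellCenter δ k) x ≤ δ := by
  obtain ⟨⟨h1, h2⟩, h3, h4⟩ := hx
  rw [latticePt_zero] at h1 h2
  rw [latticePt_one] at h3 h4
  refine (dist_le_of_abs_sub_le (a := δ / 2) (b := δ / 2) ?_ ?_).trans (by linarith)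
  · rw [cellCenter_zero, abs_le]; constructor <;> linarith
  · rw [cellCenter_one, abs_le]; constructor <;> linarith

theorem abs_sum_cells_sub_setIntegral_cellUnion_le (hbdd : Bornology.IsBounded Ω) {δ : ℝ}
    (hδ : 0 < δ) {J : Plane → ℝ} (hJ : IntegrableOn J (cellUnion Ω δ)) (φ : LipC Ω) :
    |∑ k ∈ (finite_cells hbdd hδ).toFinset,
        (∫ x in box (latticePt δ k) δ, J x) * φ (cellCenter δ k) -
      ∫ x in cellUnion Ω δ, J x * φ x| ≤ δ * ‖φ‖ * ∫ x in cellUnion Ω δ, |J x| := by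
  have hsub : ∀ k ∈ (finite_cells hbdd hδ).toFinset, box (latticePt δ k) δ ⊆ cellUnion Ω δ := by
    intro k hk
    exact Set.subset_biUnion_of_mem (u := fun k => box (latticePt δ k) δ)
      ((Set.Finite.mem_toFinset _).1 hk)
  have hd := pairwiseDisjoint_box hδ (↑(finite_cells hbdd hδ).toFinset : Set (ℤ × ℤ))
  have hsum : ∀ F : Plane → ℝ, IntegrableOn F (cellUnion Ω δ) → ∫ x in cellUnion Ω δ, F x =
      ∑ k ∈ (finite_cells hbdd hδ).toFinset, ∫ x in box (latticePt δ k) δ, F x := by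
    intro F hF
    rw [cellUnion_eq hbdd hδ]
    exact integral_biUnion_finset _ (fun k _ => measurableSet_box _ _) hd
      fun k hk => hF.mono_set (hsub k hk)
  rw [hsum _ (φ.integrableOn_mul hJ), hsum _ hJ.abs, ← Finset.sum_sub_distrib, Finset.mul_sum]
  refine (Finset.abs_sum_le_sum_abs _ _).trans (Finset.sum_le_sum fun k hk => ?_)
  have hJk := hJ.mono_set (hsub k hk)
  rw [← integral_mul_const, ← integral_sub (hJk.mul_const _) (φ.integrableOn_mul hJk)]
  simp only [← mul_sub]
  refine abs_setIntegral_mul_le (measurableSet_box _ _) hJk fun x hx => ?_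
  calc |φ (cellCenter δ k) - φ x| ≤ ‖φ‖ * dist (cellCenter δ k) x := φ.abs_sub_le _ _
    _ ≤ ‖φ‖ * δ := mul_le_mul_of_nonneg_left (dist_cellCenter_le hx) (norm_nonneg _)
    _ = _ := mul_comm _ _

theorem abs_sum_cells_sub_setIntegral_le (hbdd : Bornology.IsBounded Ω) (hΩ : MeasurableSet Ω)
    {δ : ℝ} (hδ : 0 < δ) {J : Plane → ℝ} (hJ : IntegrableOn J Ω) (φ : LipC Ω) :
    |∑ k ∈ (finite_cells hbdd hδ).toFinset,
        (∫ x in box (latticePt δ k) δ, J x) * φ (cellCenter δ k) -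
      ∫ x in Ω, J x * φ x| ≤ 2 * δ * ‖φ‖ * ∫ x in Ω, |J x| := by
  have hU := measurableSet_cellUnion hbdd hδ
  have hsub : cellUnion Ω δ ⊆ Ω := cellUnion_subset
  have h1 := abs_sum_cells_sub_setIntegral_cellUnion_le hbdd hδ (hJ.mono_set hsub) φ
  have h2 := abs_setIntegral_mul_le (hΩ.diff hU) (hJ.mono_set Set.sdiff_subset)
    fun x hx => φ.abs_le_of_notMem_cellUnion hδ hx.2
  have split : ∀ F : Plane → ℝ, IntegrableOn F Ω →
      ∫ x in Ω, F x = (∫ x in cellUnion Ω δ, F x) + ∫ x in Ω \ cellUnion Ω δ, F x := by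
    intro F hF
    rw [← integral_inter_add_sdiff hU hF, Set.inter_eq_self_of_subset_right hsub]
  rw [split _ (φ.integrableOn_mul hJ), split _ hJ.abs]
  have h3 : 0 ≤ δ * ‖φ‖ * ∫ x in cellUnion Ω δ, |J x| :=
    mul_nonneg (by positivity) (integral_nonneg fun x => abs_nonneg _)
  rw [abs_le] at h1 h2 ⊢
  constructor <;> nlinarith

/-! ### Deforming Jacobians -/

/-- After the change of variables only the test function has moved, by its Lipschitz constant times
the displacement. Where `U` exceeds the image of `Ω`, the preimage of `x` is a nearby point outside
`Ω`, so `φ x` is itself small. -/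
theorem IsDeformation.abs_integral_jacDet_sub_le (hopen : IsOpen Ω)
    {Ψ : Plane ≃ₜ Plane} {s t C : ℝ} (hΨ : IsDeformation Ψ s t C) {f : Plane → Plane}
    (hf : ContDiff ℝ 1 f) {U : Set Plane} (hU : MeasurableSet U) (hUΩ : Ψ '' Ω ⊆ U) {d : Plane → ℝ}
    (hd : IntegrableOn d U) (hJ : IntegrableOn (jacDet f) (Ψ '' Ω)) (φ : LipC Ω) :
    |(∫ x in Ω, jacDet (f ∘ Ψ) x * φ x) - ∫ x in U, d x * φ x| ≤
      ‖φ‖ * ((s + C * t) * (∫ x in Ψ '' Ω, |jacDet f x|) + (s + C * t) * (∫ x in U, |d x|) +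
        ∫ x in Ψ '' Ω, |jacDet f x - d x|) := by
  have hO : MeasurableSet (Ψ '' Ω) := (Ψ.isOpenMap Ω hopen).measurableSet
  have hr : ∀ x, dist (Ψ.symm x) x ≤ s + C * t := fun x => by
    have := hΨ.dist_le (Ψ.symm x)
    rwa [Ψ.apply_symm_apply, dist_comm] at this
  have hr0 : 0 ≤ s + C * t := dist_nonneg.trans (hr 0)
  have hdO := hd.mono_set hUΩ
  have hφΨ : IntegrableOn (fun x => jacDet f x * (φ (Ψ.symm x) - φ x)) (Ψ '' Ω) :=
    hJ.mul_bdd (c := ‖φ‖ * (s + C * t))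
      ((φ.continuous.comp Ψ.symm.continuous).sub φ.continuous).aestronglyMeasurable
      (Eventually.of_forall fun x => (φ.abs_sub_le _ _).trans
        (mul_le_mul_of_nonneg_left (hr x) (norm_nonneg _)))
  have h1 := abs_setIntegral_mul_le hO hJ (ψ := fun x => φ (Ψ.symm x) - φ x) fun x _ =>
    (φ.abs_sub_le _ _).trans (mul_le_mul_of_nonneg_left (hr x) (norm_nonneg _))
  have h2 := abs_setIntegral_mul_le hO (hJ.sub hdO) (ψ := φ) fun x _ => φ.abs_le_norm x
  have h3 := abs_setIntegral_mul_le (hU.diff hO) (hd.mono_set Set.sdiff_subset) (ψ := φ)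
    (c := ‖φ‖ * (s + C * t)) fun x hx => by
      have hx' : Ψ.symm x ∉ Ω := fun h => hx.2 ⟨_, h, Ψ.apply_symm_apply x⟩
      refine (φ.abs_le_of_notMem x hx').trans (mul_le_mul_of_nonneg_left ?_ (norm_nonneg _))
      rw [dist_comm]
      exact hr x
  have h4 : ∫ x in U \ Ψ '' Ω, |d x| ≤ ∫ x in U, |d x| :=
    setIntegral_mono_set hd.abs (Eventually.of_forall fun x => abs_nonneg _)
      Set.sdiff_subset.eventuallyLE
  have h5 : ∫ x in U, d x * φ x = (∫ x in Ψ '' Ω, d x * φ x) + ∫ x in U \ Ψ '' Ω, d x * φ x := by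
    rw [← integral_inter_add_sdiff hO (φ.integrableOn_mul hd),
      Set.inter_eq_self_of_subset_right hUΩ]
  have h6 : ∫ x in Ω, jacDet (f ∘ Ψ) x * φ x =
      (∫ x in Ψ '' Ω, jacDet f x * (φ (Ψ.symm x) - φ x)) +
        ((∫ x in Ψ '' Ω, (jacDet f - d) x * φ x) + ∫ x in Ψ '' Ω, d x * φ x) := by
    refine (hΨ.integral_jacDet f hf φ.1 Ω hopen.measurableSet).trans ?_
    rw [← integral_add (φ.integrableOn_mul (hJ.sub hdO)) (φ.integrableOn_mul hdO),
      ← integral_add hφΨ]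
    · exact integral_congr_ae (Eventually.of_forall fun x => by simp only [Pi.sub_apply]; ring)
    · exact (φ.integrableOn_mul (hJ.sub hdO)).add (φ.integrableOn_mul hdO)
  rw [h5, h6]
  have h7 : ‖φ‖ * (s + C * t) * ∫ x in U \ Ψ '' Ω, |d x| ≤
      ‖φ‖ * (s + C * t) * ∫ x in U, |d x| := mul_le_mul_of_nonneg_left h4 (by positivity)
  rw [abs_le] at h1 h2 h3 ⊢
  simp only [Pi.sub_apply] at h2 ⊢
  constructor <;> linarith

end

section

variable {Ω : Set Plane} {ε : ℝ}

/-! ### From a smooth map with controlled lattice edges to a displacement -/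

theorem latticePt_add_right (δ : ℝ) (k : ℤ × ℤ) :
    latticePt δ (k + (1, 0)) = latticePt δ k + δ • EuclideanSpace.single 0 1 := by
  ext j
  fin_cases j
  · simp [latticePt]; ring
  · simp [latticePt]

theorem latticePt_add_up (δ : ℝ) (k : ℤ × ℤ) :
    latticePt δ (k + (0, 1)) = latticePt δ k + δ • EuclideanSpace.single 1 1 := by
  ext j
  fin_cases j
  · simp [latticePt]
  · simp [latticePt]; ring

/-- Comparison of the elastic strain of the sampled phase with the circulation along one edge. -/
theorem elastic_turn_estimate {G : Plane → Plane} (hG : ContDiff ℝ 1 G) {δ η : ℝ} (hδ : 0 < δ)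
    (hε : 0 < ε) (hεδ : 2 * ε ≤ δ) (hη : 0 < η) (hη2 : η ≤ 1 / 2) (j : Fin 2) (p : Plane)
    (hsmall : 8 * edgeEnergy ε G δ j p * ε < η ^ 2) :
    4 * Real.pi ^ 2 *
        elastic (-turn (G (p + δ • EuclideanSpace.single j 1)) - -turn (G p)) ^ 2 ≤
      2 * δ / (1 - η) ^ 2 * edgeEnergy ε G δ j p ∧
    |elastic (-turn (G (p + δ • EuclideanSpace.single j 1)) - -turn (G p)) +
        1 / (2 * Real.pi) * edgeCirc G δ j p| ≤ 2 * δ * edgeEnergy ε G δ j p := by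
  obtain ⟨b, n, h1, h2, h3⟩ := exists_turn_increment hG hδ hε hεδ hη hη2 j p hsmall
  set e := elastic (-turn (G (p + δ • EuclideanSpace.single j 1)) - -turn (G p)) with he
  have hen := edgeEnergy_nonneg ε G hδ.le j p
  set en := edgeEnergy ε G δ j p
  obtain ⟨m, hm⟩ := elastic_eq_sub_int (-turn (G (p + δ • EuclideanSpace.single j 1)) - -turn (G p))
  have heb : e - -b = ((-n - m : ℤ) : ℝ) := by
    rw [he, hm]; push_cast; linarith
  have habs : |e| ≤ 1 / 2 := abs_elastic_le _
  have hpi := Real.pi_gt_three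
  have h4 := sq_le_sq_of_sub_int habs _ heb
  have h5 := abs_sub_le_of_sub_int habs _ heb
  rw [neg_sq] at h4 h5
  refine ⟨(mul_le_mul_of_nonneg_left h4 (by positivity)).trans h2, ?_⟩
  -- Since `1 - η ≥ 1/2`, one has `4π²b² ≤ 8δ en`, and `π > 3` gives the rest. The rounding error is
  -- thus of the same order as the current error.
  have h6 : 4 * b ^ 2 ≤ δ * en := by
    have h7 : 2 * δ / (1 - η) ^ 2 * en ≤ 8 * δ * en := by
      refine mul_le_mul_of_nonneg_right ?_ hen
      rw [div_le_iff₀ (by nlinarith)]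
      nlinarith [mul_pos hδ hδ, mul_nonneg hδ.le (by nlinarith : 0 ≤ (1 - η) ^ 2 - 1 / 4)]
    have h8 : 36 * b ^ 2 ≤ 4 * Real.pi ^ 2 * b ^ 2 :=
      mul_le_mul_of_nonneg_right (by nlinarith) (sq_nonneg b)
    nlinarith [mul_nonneg hδ.le hen]
  have h9 : ε * en ≤ δ * en := mul_le_mul_of_nonneg_right (by linarith) hen
  calc |e + 1 / (2 * Real.pi) * edgeCirc G δ j p|
      = |(e - -b) - (b - 1 / (2 * Real.pi) * edgeCirc G δ j p)| := by congr 1; ring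
    _ ≤ |e - -b| + |b - 1 / (2 * Real.pi) * edgeCirc G δ j p| := abs_sub _ _
    _ ≤ 2 * δ * en := by linarith

/-- The displacement samples the phase of `G` with a minus sign, because `dislocation` circulates
clockwise. No constant is lost: half of `2δ/(1 - η)²` times `E/δ` is `E/(1 - η)²`. -/
theorem exists_displacement (hbdd : Bornology.IsBounded Ω) (hΩ : MeasurableSet Ω)
    {G : Plane → Plane} (hG : ContDiff ℝ 2 G) {δ η E : ℝ} (hδ : 0 < δ)
    (hε : 0 < ε) (hεδ : 2 * ε ≤ δ) (hη : 0 < η) (hη2 : η ≤ 1 / 2)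
    (hE : bondSum Ω δ (fun k => edgeEnergy ε G δ 0 (latticePt δ k))
      (fun k => edgeEnergy ε G δ 1 (latticePt δ k)) ≤ E / δ)
    (hsmall : 8 * (E / δ) * ε < η ^ 2) :
    ∃ u : Site Ω δ → ℝ,
      ENNReal.ofReal (4 * Real.pi ^ 2) * energySD u ≤ ENNReal.ofReal (E / (1 - η) ^ 2) ∧
      ∀ φ : LipC Ω, |dislocationMeasure u φ - 1 / Real.pi * ∫ x in Ω, jacDet G x * φ x| ≤
        δ * ‖φ‖ * (4 * E + ∫ x in Ω, |jacDet G x|) := by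
  have hG1 : ContDiff ℝ 1 G := hG.of_le (by norm_num)
  have hpi := Real.pi_gt_three
  have hen : ∀ j k, 0 ≤ edgeEnergy ε G δ j (latticePt δ k) := fun j k =>
    edgeEnergy_nonneg ε G hδ.le j _
  have hH : ∀ k ∈ hBonds Ω δ, edgeEnergy ε G δ 0 (latticePt δ k) ≤ E / δ := by
    intro k hk
    refine le_trans ?_ hE
    rw [bondSum_eq hbdd hδ]
    exact le_add_of_le_of_nonneg (Finset.single_le_sum (f := fun k =>
      edgeEnergy ε G δ 0 (latticePt δ k)) (fun k _ => hen 0 k)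
      ((Set.Finite.mem_toFinset _).2 hk)) (Finset.sum_nonneg fun k _ => hen 1 k)
  have hV : ∀ k ∈ vBonds Ω δ, edgeEnergy ε G δ 1 (latticePt δ k) ≤ E / δ := by
    intro k hk
    refine le_trans ?_ hE
    rw [bondSum_eq hbdd hδ]
    exact le_add_of_nonneg_of_le (Finset.sum_nonneg fun k _ => hen 0 k) (Finset.single_le_sum
      (f := fun k => edgeEnergy ε G δ 1 (latticePt δ k)) (fun k _ => hen 1 k)
      ((Set.Finite.mem_toFinset _).2 hk))
  set u : Site Ω δ → ℝ := fun i => -turn (G (latticePt δ i.1)) with hu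
  set βh : ℤ × ℤ → ℝ := fun k => elasticStrain u k (k + (1, 0)) with hβh
  set βv : ℤ × ℤ → ℝ := fun k => elasticStrain u k (k + (0, 1)) with hβv
  have hstrain : ∀ k l : ℤ × ℤ, latticePt δ k ∈ Ω → latticePt δ l ∈ Ω →
      elasticStrain u k l = elastic (-turn (G (latticePt δ l)) - -turn (G (latticePt δ k))) := by
    intro k l hk hl
    rw [elasticStrain]
    rw [extend_site u ⟨k, hk⟩, extend_site u ⟨l, hl⟩]
  have hsm : ∀ en : ℝ, en ≤ E / δ → 8 * en * ε < η ^ 2 := fun en h =>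
    lt_of_le_of_lt (by gcongr) hsmall
  have hh : ∀ k ∈ hBonds Ω δ, _ := fun k hk =>
    elastic_turn_estimate hG1 hδ hε hεδ hη hη2 0 (latticePt δ k) (hsm _ (hH k hk))
  have hv : ∀ k ∈ vBonds Ω δ, _ := fun k hk =>
    elastic_turn_estimate hG1 hδ hε hεδ hη hη2 1 (latticePt δ k) (hsm _ (hV k hk))
  simp only [← latticePt_add_right] at hh
  simp only [← latticePt_add_up] at hv
  have h1η : 0 < (1 - η) ^ 2 := by nlinarith
  refine ⟨u, ?_, fun φ => ?_⟩
  · rw [energySD_eq hbdd hδ, ← ENNReal.ofReal_mul (by positivity)]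
    refine ENNReal.ofReal_le_ofReal ?_
    have h1 : bondSum Ω δ (fun k => 4 * Real.pi ^ 2 * βh k ^ 2)
        (fun k => 4 * Real.pi ^ 2 * βv k ^ 2) ≤ bondSum Ω δ
        (fun k => 2 * δ / (1 - η) ^ 2 * edgeEnergy ε G δ 0 (latticePt δ k))
        (fun k => 2 * δ / (1 - η) ^ 2 * edgeEnergy ε G δ 1 (latticePt δ k)) := by
      refine bondSum_mono hbdd hδ (fun k hk => ?_) (fun k hk => ?_)
      · simp only [hβh]
        rw [hstrain _ _ hk.1 hk.2]
        exact (hh k hk).1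
      · simp only [hβv]
        rw [hstrain _ _ hk.1 hk.2]
        exact (hv k hk).1
    rw [bondSum_const_mul hbdd hδ, bondSum_const_mul hbdd hδ] at h1
    have h2 : 2 * δ / (1 - η) ^ 2 * bondSum Ω δ (fun k => edgeEnergy ε G δ 0 (latticePt δ k))
      (fun k => edgeEnergy ε G δ 1 (latticePt δ k)) ≤ 2 * δ / (1 - η) ^ 2 * (E / δ) := by gcongr
    have h3 : 2 * δ / (1 - η) ^ 2 * (E / δ) = 2 * (E / (1 - η) ^ 2) := by field_simp
    linarith
  · set c : ℝ := 1 / (2 * Real.pi) with hc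
    set xh : ℤ × ℤ → ℝ := fun k => βh k + c * edgeCirc G δ 0 (latticePt δ k) with hxh
    set xv : ℤ × ℤ → ℝ := fun k => βv k + c * edgeCirc G δ 1 (latticePt δ k) with hxv
    have h1 : bondSum Ω δ (fun k => |xh k|) (fun k => |xv k|) ≤ 2 * E := by
      have h2 : bondSum Ω δ (fun k => |xh k|) (fun k => |xv k|) ≤ bondSum Ω δ
          (fun k => 2 * δ * edgeEnergy ε G δ 0 (latticePt δ k))
          (fun k => 2 * δ * edgeEnergy ε G δ 1 (latticePt δ k)) := by
        refine bondSum_mono hbdd hδ (fun k hk => ?_) (fun k hk => ?_)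
        · simp only [hxh, hβh]
          rw [hstrain _ _ hk.1 hk.2]
          exact (hh k hk).2
        · simp only [hxv, hβv]
          rw [hstrain _ _ hk.1 hk.2]
          exact (hv k hk).2
      rw [bondSum_const_mul hbdd hδ] at h2
      refine h2.trans ((mul_le_mul_of_nonneg_left hE (by positivity)).trans_eq ?_)
      field_simp
    have h2 := abs_sum_curl_mul_le hbdd hδ xh xv φ
    -- The remainders `xh`, `xv` compare strain and current on each bond. Their curl compares the
    -- dislocation with the Jacobian integrated over the cell.
    have h3 : ∀ k, curl xh xv k = dislocation u k -
        1 / Real.pi * ∫ x in box (latticePt δ k) δ, jacDet G x := by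
      intro k
      have h4 := two_mul_integral_jacDet_box hG (latticePt δ k) hδ.le
      rw [← latticePt_add_right, ← latticePt_add_up] at h4
      have h5 : 1 / Real.pi * ∫ x in box (latticePt δ k) δ, jacDet G x =
          c * (2 * ∫ x in box (latticePt δ k) δ, jacDet G x) := by
        rw [hc]; field_simp
      rw [h5, h4, dislocation_eq_curl]
      simp only [curl, hxh, hxv, hβh, hβv]
      ring
    have h4 := abs_sum_cells_sub_setIntegral_le hbdd hΩ hδ
      (integrableOn_of_continuous hbdd (continuous_jacDet hG1)) φ
    have h5 : ∑ k ∈ (finite_cells hbdd hδ).toFinset, curl xh xv k * φ (cellCenter δ k) =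
        dislocationMeasure u φ - 1 / Real.pi * ∑ k ∈ (finite_cells hbdd hδ).toFinset,
          (∫ x in box (latticePt δ k) δ, jacDet G x) * φ (cellCenter δ k) := by
      rw [dislocationMeasure_apply hbdd hδ, Finset.mul_sum, ← Finset.sum_sub_distrib]
      refine Finset.sum_congr rfl fun k _ => ?_
      rw [h3]; ring
    rw [h5] at h2
    set S := ∑ k ∈ (finite_cells hbdd hδ).toFinset,
      (∫ x in box (latticePt δ k) δ, jacDet G x) * φ (cellCenter δ k)
    set I := ∫ x in Ω, jacDet G x * φ x
    have hJ0 : 0 ≤ ∫ x in Ω, |jacDet G x| := integral_nonneg fun x => abs_nonneg _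
    set J := ∫ x in Ω, |jacDet G x|
    have h6 : |1 / Real.pi * (S - I)| ≤ δ * ‖φ‖ * J := by
      rw [abs_mul, abs_of_pos (by positivity : 0 < 1 / Real.pi)]
      have h7 : 1 / Real.pi ≤ 1 / 2 := by
        apply one_div_le_one_div_of_le <;> linarith
      calc 1 / Real.pi * |S - I| ≤ 1 / 2 * (2 * δ * ‖φ‖ * J) := by gcongr
        _ = _ := by ring
    have h7 : 2 * δ * ‖φ‖ * bondSum Ω δ (fun k => |xh k|) (fun k => |xv k|) ≤
        2 * δ * ‖φ‖ * (2 * E) := by gcongr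
    calc |dislocationMeasure u φ - 1 / Real.pi * I|
        = |(dislocationMeasure u φ - 1 / Real.pi * S) + 1 / Real.pi * (S - I)| := by
          congr 1; ring
      _ ≤ _ := abs_add_le _ _
      _ ≤ δ * ‖φ‖ * (4 * E + J) := by linarith

/-! ### Recovering a displacement from a Sobolev map -/

theorem grad_comp_add_right (g : Plane → Plane) (τ : Plane) (a j : Fin 2) (x : Plane) :
    grad (fun x => g (x + τ)) a j x = grad g a j (x + τ) := by
  rw [grad, grad, fderiv_comp_add_right]

theorem edgeEnergy_comp_add_right (ε : ℝ) (g : Plane → Plane) (δ : ℝ) (j : Fin 2) (τ p : Plane) :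
    edgeEnergy ε (fun x => g (x + τ)) δ j p = edgeEnergy ε g δ j (p + τ) := by
  simp only [edgeEnergy, edgeDensity, grad_comp_add_right, add_right_comm p τ]

theorem integral_abs_le_of_lintegral_le {A : Set Plane} {J e : Plane → ℝ}
    (hJ : AEStronglyMeasurable J (volume.restrict A)) (hle : ∀ x, |J x| ≤ e x) {E : ℝ} (hE : 0 ≤ E)
    (h : ∫⁻ x in A, ENNReal.ofReal (e x) ≤ ENNReal.ofReal E) :
    IntegrableOn J A ∧ ∫ x in A, |J x| ≤ E := by
  have h1 : ∫⁻ x in A, ENNReal.ofReal |J x| ≤ ENNReal.ofReal E :=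
    (lintegral_mono fun x => ENNReal.ofReal_le_ofReal (hle x)).trans h
  have h2 : IntegrableOn J A := by
    refine ⟨hJ, ?_⟩
    rw [hasFiniteIntegral_iff_norm]
    exact h1.trans_lt ENNReal.ofReal_lt_top
  refine ⟨h2, ?_⟩
  rw [← ENNReal.ofReal_le_ofReal_iff hE, ofReal_integral_eq_lintegral_ofReal h2.abs
    (Eventually.of_forall fun x => abs_nonneg _)]
  exact h1

-- Sampling on a translated grid needs a map on a neighbourhood of `Ω`, and mollification needs a
-- margin inside `Ω`. Pulling back by a map sending a neighbourhood well inside `Ω` provides both.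
set_option maxHeartbeats 1000000 in
theorem exists_displacement_of_sobolevMap (hopen : IsOpen Ω) (hbdd : Bornology.IsBounded Ω)
    (hlip : HasLipschitzBoundary Ω) : ∃ M > 0, ∃ d > 0, ∀ ε δ η E : ℝ, 0 < ε → 0 < δ → δ ≤ d →
      2 * ε ≤ δ → 0 < η → η ≤ 1 / 2 → 0 ≤ E → 16 * ((E + 1) / δ) * ε < η ^ 2 →
      ∀ w : SobolevMap Ω, w.energy ε ≤ ENNReal.ofReal E → ∃ u : Site Ω δ → ℝ,
        ENNReal.ofReal (4 * Real.pi ^ 2) * energySD u ≤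
          ENNReal.ofReal ((1 + M * δ) * (E + δ) / (1 - η) ^ 2) ∧
        dist (dislocationMeasure u) ((1 / Real.pi) • w.jac) ≤ M * δ * (E + 1) := by
  obtain ⟨V, hV, hVc, c, hc, t₀, ht₀, hin⟩ := exists_inward_field hbdd hlip
  obtain ⟨C, hC, t₁, ht₁, hdef⟩ := exists_deformation hV hVc
  have hV1 : ContDiff ℝ 1 V := hV.of_le (by exact_mod_cast le_top)
  obtain ⟨L, hL⟩ := hV1.lipschitzWith_of_hasCompactSupport hVc one_ne_zero
  have hL0 : (0 : ℝ) ≤ L := L.2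
  -- The inward push leaves a ball of radius `9δ` around images of points of `Ω`: `8δ` for the
  -- `4δ`-neighbourhood, whose distances are at most doubled, and `δ` for mollification.
  set a : ℝ := 9 / c with ha
  have ha0 : 0 < a := by positivity
  set M : ℝ := C * a + 9 * (2 + C * a) + 10 with hM
  refine ⟨M, by positivity,
    min 1 (min (t₀ / a) (min (t₁ / a) (min (1 / (L + 1) / a) (1 / C / a)))), by positivity, ?_⟩
  intro ε δ η E hε hδ hδd hεδ hη hη2 hE hsmall w hw
  simp only [le_min_iff] at hδd
  obtain ⟨hδ1, hδ2, hδ3, hδ4, hδ5⟩ := hδd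
  rw [le_div_iff₀ ha0] at hδ2 hδ3 hδ4 hδ5
  set t : ℝ := δ * a with ht
  have ht0 : 0 < t := by positivity
  have hct : c * t = 9 * δ := by rw [ht, ha]; field_simp
  have htL : t * L ≤ 1 := by
    rw [le_div_iff₀ (by positivity)] at hδ4
    nlinarith
  have htC : C * t ≤ 1 := by
    rw [le_div_iff₀ (by positivity)] at hδ5
    linarith
  obtain ⟨Φ, hΦ, hΦd⟩ := hdef t ht0 hδ3 0
  simp only [add_zero] at hΦ
  set T : Set Plane := Metric.thickening (4 * δ) Ω with hT
  have hTm : MeasurableSet T := Metric.isOpen_thickening.measurableSet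
  have hΦT : MeasurableSet (Φ '' T) := (Φ.isOpenMap T Metric.isOpen_thickening).measurableSet
  have hΦTΩ : ∀ z ∈ Φ '' T, Metric.ball z δ ⊆ Ω := by
    rintro _ ⟨y, hy, rfl⟩
    obtain ⟨x, hx, hyx⟩ := Metric.mem_thickening_iff.1 hy
    refine subset_trans ?_ (hin t ht0 hδ2 x hx)
    refine Metric.ball_subset_ball' ?_
    have h1 : dist (Φ y) (x + t • V x) ≤ dist y x + t * (L * dist y x) := by
      rw [hΦ]
      refine (dist_add_add_le _ _ _ _).trans (add_le_add_right ?_ _)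
      rw [dist_smul₀, Real.norm_eq_abs, abs_of_pos ht0]
      exact mul_le_mul_of_nonneg_left (hL.dist_le_mul y x) ht0.le
    have h2 : t * (L * dist y x) ≤ 1 * dist y x := by
      rw [← mul_assoc]; exact mul_le_mul_of_nonneg_right htL dist_nonneg
    linarith
  obtain ⟨f, hf, hfE, hfJ⟩ := exists_smooth_approx hopen w hδ hΦT hΦTΩ ε hδ hE hw
  have hf1 : ContDiff ℝ 1 f := hf.of_le (by exact_mod_cast le_top)
  set E₁ : ℝ := (1 + C * t) * (E + δ) with hE₁
  have hE₁0 : 0 ≤ E₁ := by positivity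
  have hE₁' : E₁ ≤ 2 * (E + 1) := by
    calc E₁ ≤ (1 + 1) * (E + 1) := by rw [hE₁]; gcongr
      _ = _ := by ring
  set g := f ∘ Φ with hg
  have hgs : ContDiff ℝ ∞ g := hf.comp hΦd.contDiff
  have hg1 : ContDiff ℝ 1 g := hgs.of_le (by exact_mod_cast le_top)
  have hgE : ∫⁻ x in T, ENNReal.ofReal (glDensity ε g x) ≤ ENNReal.ofReal E₁ := by
    refine (hΦd.energy_le f hf1 ε T hTm).trans ?_
    rw [hE₁, ENNReal.ofReal_mul (by positivity)]
    gcongr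
  -- The translate depends on the smoothed map `f`. It is absorbed into a second deformation `Ψ =
  -- Φ(· + τ)` with the same constants.
  obtain ⟨τ, hτ, hτE⟩ := exists_translate_edgeEnergy_le hbdd hg1 ε hδ (T := T)
    (fun x hx y hy => Metric.mem_thickening_iff.2 ⟨x, hx, hy.trans_lt (by linarith)⟩) hE₁0 hgE
  have hτn : ‖τ‖ ≤ 2 * δ := by
    rw [← dist_zero_right]; exact dist_le_of_mem_box hτ
  obtain ⟨Ψ, hΨ, hΨd⟩ := hdef t ht0 hδ3 τ
  have hΨΦ : ∀ x, Ψ x = Φ (x + τ) := fun x => by rw [hΨ, hΦ]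
  have hcomp : f ∘ Ψ = fun x => g (x + τ) := by
    funext x
    simp only [Function.comp, hΨΦ, hg]
  have hΨT : Ψ '' Ω ⊆ Φ '' T := by
    rintro _ ⟨x, hx, rfl⟩
    refine ⟨x + τ, Metric.mem_thickening_iff.2 ⟨x, hx, ?_⟩, (hΨΦ x).symm⟩
    rw [dist_self_add_left]
    linarith
  have hΦTsub : Φ '' T ⊆ Ω := fun z hz => hΦTΩ z hz (Metric.mem_ball_self hδ)
  have hGs : ContDiff ℝ ∞ (f ∘ Ψ) := hf.comp hΨd.contDiff
  have hG1 : ContDiff ℝ 1 (f ∘ Ψ) := hGs.of_le (by exact_mod_cast le_top)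
  have hedge : bondSum Ω δ (fun k => edgeEnergy ε (f ∘ Ψ) δ 0 (latticePt δ k))
      (fun k => edgeEnergy ε (f ∘ Ψ) δ 1 (latticePt δ k)) ≤ E₁ / δ := by
    simp only [hcomp, edgeEnergy_comp_add_right]
    exact hτE
  have hsmall' : 8 * (E₁ / δ) * ε < η ^ 2 := by
    refine lt_of_le_of_lt ?_ hsmall
    calc 8 * (E₁ / δ) * ε ≤ 8 * (2 * (E + 1) / δ) * ε := by gcongr
      _ = _ := by ring
  obtain ⟨u, hu1, hu2⟩ := exists_displacement hbdd hopen.measurableSet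
    (hGs.of_le (WithTop.coe_le_coe.2 le_top : ((2 : ℕ∞) : ℕ∞ω) ≤ ((⊤ : ℕ∞) : ℕ∞ω))) hδ hε hεδ hη hη2 hedge hsmall'
  refine ⟨u, hu1.trans (ENNReal.ofReal_le_ofReal ?_), ?_⟩
  · have : C * t ≤ M * δ := by
      rw [ht, hM]
      linarith [mul_pos (mul_pos hC ha0) hδ]
    rw [hE₁]
    gcongr
  · have hw' := hw
    rw [SobolevMap.energy] at hw'
    have hdet := integral_abs_le_of_lintegral_le w.integrable_det.aestronglyMeasurable
      (w.abs_det_le_density ε) hE hw'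
    have hfE' : ∫⁻ x in Ψ '' Ω, ENNReal.ofReal (glDensity ε f x) ≤ ENNReal.ofReal (E + δ) :=
      (lintegral_mono_set hΨT).trans hfE
    have hjac := integral_abs_le_of_lintegral_le
      (continuous_jacDet hf1).aestronglyMeasurable (abs_jacDet_le_glDensity ε f) (by positivity)
      hfE'
    have hdiff := integral_abs_le_of_lintegral_le (A := Ψ '' Ω)
      (J := fun x => jacDet f x - w.det x) (e := fun x => |jacDet f x - w.det x|)
      (hjac.1.sub (hdet.1.mono_set (hΨT.trans hΦTsub))).aestronglyMeasurable
      (fun _ => le_rfl) hδ.le ((lintegral_mono_set hΨT).trans hfJ)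
    have hGE := integral_abs_le_of_lintegral_le (A := Ω) (E := E₁)
      (continuous_jacDet hG1).aestronglyMeasurable (abs_jacDet_le_glDensity ε (f ∘ Ψ)) hE₁0 (by
        refine (hΨd.energy_le f hf1 ε Ω hopen.measurableSet).trans ?_
        rw [hE₁, ENNReal.ofReal_mul (by positivity)]
        gcongr)
    refine SingSpace.dist_le (by positivity) fun φ => ?_
    have h1 := hu2 φ
    have h2 := hΨd.abs_integral_jacDet_sub_le hopen hf1 hopen.measurableSet
      (hΨT.trans hΦTsub) hdet.1 hjac.1 φ
    have h3 : ((1 / Real.pi) • w.jac) φ = 1 / Real.pi * ∫ x in Ω, w.det x * φ x := rfl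
    rw [h3]
    set I := ∫ x in Ω, jacDet (f ∘ Ψ) x * φ x
    set I' := ∫ x in Ω, w.det x * φ x
    set r : ℝ := ‖τ‖ + C * t with hr
    have hr0 : 0 ≤ r := by positivity
    have hr' : r ≤ (2 + C * a) * δ := by
      rw [hr, ht]; linarith
    have h4 : |I - I'| ≤ ‖φ‖ * (r * (E + δ) + r * E + δ) := by
      refine h2.trans (mul_le_mul_of_nonneg_left ?_ (norm_nonneg _))
      gcongr
      · exact hjac.2
      · exact hdet.2
      · exact hdiff.2
    have h5 : r * (E + δ) + r * E + δ ≤ (2 * (2 + C * a) + 1) * δ * (E + 1) := by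
      have h6 : r * (E + δ) + r * E ≤ r * (2 * (E + 1)) := by
        rw [← mul_add]; exact mul_le_mul_of_nonneg_left (by linarith) hr0
      have h7 : r * (2 * (E + 1)) ≤ (2 + C * a) * δ * (2 * (E + 1)) := by gcongr
      linarith [mul_nonneg hδ.le hE]
    have hpi := Real.pi_gt_three
    have h6 : |1 / Real.pi * (I - I')| ≤ ‖φ‖ * ((2 * (2 + C * a) + 1) * δ * (E + 1)) := by
      rw [abs_mul, abs_of_pos (by positivity : 0 < 1 / Real.pi)]
      have h7 : 1 / Real.pi ≤ 1 := by
        rw [div_le_one (by linarith)]; linarith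
      calc 1 / Real.pi * |I - I'| ≤ 1 * |I - I'| := by gcongr
        _ ≤ _ := by rw [one_mul]; exact h4.trans (by gcongr)
    have h7 : δ * ‖φ‖ * (4 * E₁ + ∫ x in Ω, |jacDet (f ∘ Ψ) x|) ≤ δ * ‖φ‖ * (10 * (E + 1)) := by
      refine mul_le_mul_of_nonneg_left ?_ (by positivity)
      linarith [hGE.2]
    calc |dislocationMeasure u φ - 1 / Real.pi * I'|
        = |(dislocationMeasure u φ - 1 / Real.pi * I) + 1 / Real.pi * (I - I')| := by
          congr 1; ring
      _ ≤ _ := abs_add_le _ _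
      _ ≤ ‖φ‖ * ((2 * (2 + C * a) + 1 + 10) * δ * (E + 1)) := by linarith
      _ ≤ ‖φ‖ * (M * δ * (E + 1)) := by
          refine mul_le_mul_of_nonneg_left ?_ (norm_nonneg _)
          gcongr
          rw [hM]
          linarith [mul_pos hC ha0]
      _ = _ := mul_comm _ _

end

/-! ### From spins to Ginzburg–Landau maps: smoothed bilinear interpolation -/

section

/-! ### Smooth steps with almost minimal slope -/

/-- `B` is a smooth step from `0` to `1` over the unit interval, with derivative `b ≤ 1 + θ`. -/
structure IsStep (B b : ℝ → ℝ) (θ : ℝ) : Prop where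
  contDiff : ContDiff ℝ 1 b
  hasDerivAt : ∀ s, HasDerivAt B (b s) s
  eq_zero : ∀ s ≤ 0, B s = 0
  eq_one : ∀ s, 1 ≤ s → B s = 1
  deriv_eq_zero : ∀ s ≤ 0, b s = 0
  deriv_eq_zero' : ∀ s, 1 ≤ s → b s = 0
  deriv_nonneg : ∀ s, 0 ≤ b s
  deriv_le : ∀ s, b s ≤ 1 + θ

theorem exists_isStep {θ : ℝ} (hθ : 0 < θ) : ∃ B b : ℝ → ℝ, IsStep B b θ := by
  -- The inner ball has length `1/(1 + θ)`, so the normalized bump is at most `1 + θ`.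
  let f : ContDiffBump (1 / 2 : ℝ) := ⟨1 / (2 * (1 + θ)), 1 / 2, by positivity, by
    rw [div_lt_div_iff₀ (by positivity) (by norm_num)]; linarith⟩
  set b : ℝ → ℝ := f.normed volume with hb
  have hbc : Continuous b := f.continuous_normed
  have hout : ∀ s : ℝ, s ≤ 0 ∨ 1 ≤ s → b s = 0 := by
    intro s hs
    have h1 : s ∉ Function.support b := by
      rw [hb, f.support_normed_eq, Metric.mem_ball, Real.dist_eq, not_lt]
      change 1 / 2 ≤ |s - 1 / 2|
      rcases hs with hs | hs
      · rw [abs_of_nonpos (by linarith)]; linarith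
      · rw [abs_of_nonneg (by linarith)]; linarith
    simpa using h1
  have hI : ∀ a c : ℝ, IntervalIntegrable b volume a c := fun a c => hbc.intervalIntegrable a c
  have hone : ∫ t in (0 : ℝ)..1, b t = 1 := by
    rw [intervalIntegral.integral_of_le zero_le_one, setIntegral_eq_integral_of_forall_compl_eq_zero,
      hb, f.integral_normed]
    intro s hs
    apply hout
    by_contra! hcon
    exact hs ⟨hcon.1, hcon.2.le⟩
  refine ⟨fun s => ∫ t in (0 : ℝ)..s, b t, b, ?_, ?_, ?_, ?_, ?_, ?_, ?_, ?_⟩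
  · exact f.contDiff_normed
  · exact fun s => intervalIntegral.integral_hasDerivAt_right (hI 0 s)
      (hbc.stronglyMeasurableAtFilter _ _) hbc.continuousAt
  · intro s hs
    rw [intervalIntegral.integral_congr (g := fun _ => 0), intervalIntegral.integral_zero]
    intro t ht
    rw [Set.uIcc_of_ge hs] at ht
    exact hout t (Or.inl ht.2)
  · intro s hs
    rw [← intervalIntegral.integral_add_adjacent_intervals (hI 0 1) (hI 1 s), hone,
      intervalIntegral.integral_congr (a := 1) (g := fun _ => 0), intervalIntegral.integral_zero,
      add_zero]
    intro t ht
    rw [Set.uIcc_of_le hs] at ht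
    exact hout t (Or.inr ht.1)
  · exact fun s hs => hout s (Or.inl hs)
  · exact fun s hs => hout s (Or.inr hs)
  · exact fun s => f.nonneg_normed s
  · intro s
    refine (f.normed_le_div_measure_closedBall_rIn (μ := volume) s).trans_eq ?_
    rw [Measure.real, Real.volume_closedBall, ENNReal.toReal_ofReal (by positivity)]
    change 1 / (2 * (1 / (2 * (1 + θ)))) = 1 + θ
    field_simp

namespace IsStep

variable {B b : ℝ → ℝ} {θ : ℝ}

theorem monotone (hB : IsStep B b θ) : Monotone B :=
  monotone_of_deriv_nonneg (fun s => (hB.hasDerivAt s).differentiableAt) fun s => by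
    rw [(hB.hasDerivAt s).deriv]; exact hB.deriv_nonneg s

theorem nonneg (hB : IsStep B b θ) (s : ℝ) : 0 ≤ B s := by
  rcases le_total s 0 with h | h
  · rw [hB.eq_zero s h]
  · rw [← hB.eq_zero 0 le_rfl]; exact hB.monotone h

theorem le_one (hB : IsStep B b θ) (s : ℝ) : B s ≤ 1 := by
  rcases le_total 1 s with h | h
  · rw [hB.eq_one s h]
  · rw [← hB.eq_one 1 le_rfl]; exact hB.monotone h

theorem continuous (hB : IsStep B b θ) : Continuous B :=
  continuous_iff_continuousAt.2 fun s => (hB.hasDerivAt s).continuousAt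

theorem contDiff_two (hB : IsStep B b θ) : ContDiff ℝ 2 B := by
  rw [show (2 : ℕ∞ω) = 1 + 1 by norm_num, contDiff_succ_iff_deriv]
  refine ⟨fun s => (hB.hasDerivAt s).differentiableAt, by simp, ?_⟩
  rw [show deriv B = b from funext fun s => (hB.hasDerivAt s).deriv]
  exact hB.contDiff

end IsStep

/-- The hat function generated by a step. -/
def hat (B : ℝ → ℝ) (s : ℝ) : ℝ := B (s + 1) - B s

section Hat

variable {B b : ℝ → ℝ} {θ : ℝ}

theorem IsStep.hasDerivAt_hat (hB : IsStep B b θ) (s : ℝ) :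
    HasDerivAt (hat B) (hat b s) s :=
  ((hB.hasDerivAt (s + 1)).comp_add_const s 1).sub (hB.hasDerivAt s)

/-- Outside its two relevant nodes the hat is a difference of two equal constants. The value `c` is
one for the step and zero for its derivative. -/
theorem hat_sub_int {F : ℝ → ℝ} {c : ℝ} (h0 : ∀ s ≤ 0, F s = 0) (h1 : ∀ s, 1 ≤ s → F s = c)
    {σ : ℝ} (hσ : σ ∈ Set.Icc (0 : ℝ) 1) (n : ℤ) (hn0 : n ≠ 0) (hn1 : n ≠ 1) :
    hat F (σ - n) = 0 := by
  obtain ⟨hσ0, hσ1⟩ := hσ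
  rcases lt_or_ge n 0 with hn | hn
  · have : (n : ℝ) ≤ -1 := by exact_mod_cast Int.le_sub_one_of_lt hn
    rw [hat, h1 _ (by linarith), h1 _ (by linarith), sub_self]
  · have : (2 : ℝ) ≤ n := by exact_mod_cast (by omega : (2 : ℤ) ≤ n)
    rw [hat, h0 _ (by linarith), h0 _ (by linarith), sub_self]

theorem hat_of_mem {F : ℝ → ℝ} {c : ℝ} (h1 : ∀ s, 1 ≤ s → F s = c)
    {σ : ℝ} (hσ : σ ∈ Set.Icc (0 : ℝ) 1) : hat F σ = c - F σ := by
  rw [hat, h1 _ (by linarith [hσ.1])]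

theorem hat_sub_one {F : ℝ → ℝ} (h0 : ∀ s ≤ 0, F s = 0)
    {σ : ℝ} (hσ : σ ∈ Set.Icc (0 : ℝ) 1) : hat F (σ - 1) = F σ := by
  rw [hat, h0 (σ - 1) (by linarith [hσ.2]), sub_add_cancel, sub_zero]

end Hat

/-! ### Interpolation of lattice fields -/

theorem sum_corners {S : Finset (ℤ × ℤ)} {k : ℤ × ℤ} {P Q : ℤ → ℝ} {a : ℤ × ℤ → ℝ}
    (hP : ∀ n, n ≠ k.1 → n ≠ k.1 + 1 → P n = 0) (hQ : ∀ n, n ≠ k.2 → n ≠ k.2 + 1 → Q n = 0)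
    (ha : ∀ m ∉ S, a m = 0) :
    ∑ m ∈ S, P m.1 * Q m.2 * a m =
      P k.1 * Q k.2 * a k + P (k.1 + 1) * Q k.2 * a (k + (1, 0)) +
        P k.1 * Q (k.2 + 1) * a (k + (0, 1)) +
        P (k.1 + 1) * Q (k.2 + 1) * a (k + (1, 1)) := by
  have h1 : ∑ m ∈ S, P m.1 * Q m.2 * a m =
      ∑ m ∈ S ∪ ({k.1, k.1 + 1} ×ˢ {k.2, k.2 + 1}), P m.1 * Q m.2 * a m :=
    Finset.sum_subset Finset.subset_union_left fun m _ hm => by rw [ha m hm, mul_zero]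
  have h2 : ∑ m ∈ ({k.1, k.1 + 1} ×ˢ {k.2, k.2 + 1} : Finset (ℤ × ℤ)), P m.1 * Q m.2 * a m =
      ∑ m ∈ S ∪ ({k.1, k.1 + 1} ×ˢ {k.2, k.2 + 1}), P m.1 * Q m.2 * a m := by
    refine Finset.sum_subset Finset.subset_union_right fun m _ hm => ?_
    simp only [Finset.mem_product, Finset.mem_insert, Finset.mem_singleton, not_and_or,
      not_or] at hm
    rcases hm with hm | hm
    · rw [hP _ hm.1 hm.2, zero_mul, zero_mul]
    · rw [hQ _ hm.1 hm.2, mul_zero, zero_mul]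
  rw [h1, ← h2, Finset.sum_product, Finset.sum_pair (by omega), Finset.sum_pair (by omega),
    Finset.sum_pair (by omega)]
  obtain ⟨k1, k2⟩ := k
  simp only [Prod.mk_add_mk, add_zero]
  ring

/-- The interpolation of the field `a` on the lattice of step `ε`, with profile `B`. -/
def interp (B : ℝ → ℝ) (ε : ℝ) (S : Finset (ℤ × ℤ)) (a : ℤ × ℤ → Plane) (x : Plane) : Plane :=
  WithLp.toLp 2 fun i => ∑ m ∈ S, hat B (x 0 / ε - m.1) * hat B (x 1 / ε - m.2) * a m i

section Interp

variable {B b : ℝ → ℝ} {θ ε : ℝ} {S : Finset (ℤ × ℤ)} {a : ℤ × ℤ → Plane}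

theorem contDiff_interp (hB : IsStep B b θ) : ContDiff ℝ 2 (interp B ε S a) := by
  have hB2 := hB.contDiff_two
  have hc : ∀ j : Fin 2, ContDiff ℝ 2 fun x : Plane => x j := fun j =>
    (EuclideanSpace.proj j : Plane →L[ℝ] ℝ).contDiff
  refine contDiff_euclidean.2 fun i => ?_
  have h0 := hc 0
  have h1 := hc 1
  simp only [interp, hat]
  refine ContDiff.sum fun m _ => ?_
  refine ContDiff.mul (ContDiff.mul ?_ ?_) contDiff_const
  · exact (hB2.comp (((h0.div_const ε).sub contDiff_const).add contDiff_const)).sub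
      (hB2.comp ((h0.div_const ε).sub contDiff_const))
  · exact (hB2.comp (((h1.div_const ε).sub contDiff_const).add contDiff_const)).sub
      (hB2.comp ((h1.div_const ε).sub contDiff_const))

theorem grad_eq_of_hasDerivAt {f : Plane → Plane} (hf : ContDiff ℝ 1 f) {i j : Fin 2} {x : Plane}
    {c : ℝ} (h : HasDerivAt (fun s : ℝ => f (x + s • EuclideanSpace.single j 1) i) c 0) :
    grad f i j x = c := by
  have h1 : HasDerivAt (fun s : ℝ => x + s • (EuclideanSpace.single j 1 : Plane))
      (EuclideanSpace.single j 1) 0 := by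
    simpa using ((hasDerivAt_id (0 : ℝ)).smul_const (EuclideanSpace.single j 1 : Plane)).const_add x
  have h2 : HasFDerivAt f (fderiv ℝ f x) (x + (0 : ℝ) • (EuclideanSpace.single j 1 : Plane)) := by
    rw [zero_smul, add_zero]
    exact ((hf.differentiable one_ne_zero) x).hasFDerivAt
  exact ((EuclideanSpace.proj i : Plane →L[ℝ] ℝ).hasFDerivAt.comp_hasDerivAt 0
    (h2.comp_hasDerivAt 0 h1)).unique h

theorem grad_interp_zero (hB : IsStep B b θ) (i : Fin 2) (x : Plane) :
    grad (interp B ε S a) i 0 x =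
      ∑ m ∈ S, (1 / ε * hat b (x 0 / ε - m.1)) * hat B (x 1 / ε - m.2) * a m i := by
  refine grad_eq_of_hasDerivAt ((contDiff_interp hB).of_le (by norm_num)) ?_
  simp only [interp]
  refine HasDerivAt.fun_sum fun m _ => HasDerivAt.mul_const ?_ _
  have h1 : HasDerivAt (fun s : ℝ => (x + s • (EuclideanSpace.single 0 1 : Plane)) 0 / ε - m.1)
      (1 / ε) 0 := by
    simpa using (((hasDerivAt_id (0 : ℝ)).const_add (x 0)).div_const ε).sub_const (m.1 : ℝ)
  have h2 := (hB.hasDerivAt_hat _).comp (0 : ℝ) h1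
  simpa [mul_comm] using h2.mul_const (hat B (x 1 / ε - m.2))

theorem grad_interp_one (hB : IsStep B b θ) (i : Fin 2) (x : Plane) :
    grad (interp B ε S a) i 1 x =
      ∑ m ∈ S, hat B (x 0 / ε - m.1) * (1 / ε * hat b (x 1 / ε - m.2)) * a m i := by
  refine grad_eq_of_hasDerivAt ((contDiff_interp hB).of_le (by norm_num)) ?_
  simp only [interp]
  refine HasDerivAt.fun_sum fun m _ => HasDerivAt.mul_const ?_ _
  have h1 : HasDerivAt (fun s : ℝ => (x + s • (EuclideanSpace.single 1 1 : Plane)) 1 / ε - m.2)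
      (1 / ε) 0 := by
    simpa using (((hasDerivAt_id (0 : ℝ)).const_add (x 1)).div_const ε).sub_const (m.2 : ℝ)
  have h2 := (hB.hasDerivAt_hat _).comp (0 : ℝ) h1
  simpa [mul_comm] using h2.const_mul (hat B (x 0 / ε - m.1))

theorem hat_corner_eq_zero {F : ℝ → ℝ} {c : ℝ} (h0 : ∀ s ≤ 0, F s = 0) (h1 : ∀ s, 1 ≤ s → F s = c)
    {s : ℝ} {l : ℤ} (hs : s - l ∈ Set.Icc (0 : ℝ) 1) (n : ℤ) (hn : n ≠ l) (hn' : n ≠ l + 1) :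
    hat F (s - n) = 0 := by
  have := hat_sub_int h0 h1 hs (n - l) (by omega) (by omega)
  rwa [Int.cast_sub, sub_sub_sub_cancel_right] at this

theorem hat_corner_zero {F : ℝ → ℝ} {c : ℝ} (h1 : ∀ s, 1 ≤ s → F s = c)
    {s : ℝ} {l : ℤ} (hs : s - l ∈ Set.Icc (0 : ℝ) 1) : hat F (s - l) = c - F (s - l) :=
  hat_of_mem h1 hs

theorem hat_corner_one {F : ℝ → ℝ} (h0 : ∀ s ≤ 0, F s = 0)
    {s : ℝ} {l : ℤ} (hs : s - l ∈ Set.Icc (0 : ℝ) 1) : hat F (s - (l + 1 : ℤ)) = F (s - l) := by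
  rw [← hat_sub_one h0 hs]; push_cast; ring_nf

theorem interp_apply (hB : IsStep B b θ) (ha : ∀ m ∉ S, a m = 0) {k : ℤ × ℤ} {x : Plane}
    (h0 : x 0 / ε - k.1 ∈ Set.Icc (0 : ℝ) 1) (h1 : x 1 / ε - k.2 ∈ Set.Icc (0 : ℝ) 1) (i : Fin 2) :
    interp B ε S a x i =
      (1 - B (x 0 / ε - k.1)) * (1 - B (x 1 / ε - k.2)) * a k i +
      B (x 0 / ε - k.1) * (1 - B (x 1 / ε - k.2)) * a (k + (1, 0)) i +
      (1 - B (x 0 / ε - k.1)) * B (x 1 / ε - k.2) * a (k + (0, 1)) i +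
      B (x 0 / ε - k.1) * B (x 1 / ε - k.2) * a (k + (1, 1)) i := by
  have := sum_corners (S := S) (k := k) (P := fun n => hat B (x 0 / ε - n))
    (Q := fun n => hat B (x 1 / ε - n)) (a := fun m => a m i)
    (hat_corner_eq_zero hB.eq_zero hB.eq_one h0) (hat_corner_eq_zero hB.eq_zero hB.eq_one h1)
    (fun m hm => by simp [ha m hm])
  simp only [hat_corner_zero hB.eq_one h0, hat_corner_zero hB.eq_one h1,
    hat_corner_one hB.eq_zero h0, hat_corner_one hB.eq_zero h1] at this
  exact this

theorem grad_interp_zero_apply (hB : IsStep B b θ) (ha : ∀ m ∉ S, a m = 0) {k : ℤ × ℤ} {x : Plane}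
    (h0 : x 0 / ε - k.1 ∈ Set.Icc (0 : ℝ) 1) (h1 : x 1 / ε - k.2 ∈ Set.Icc (0 : ℝ) 1) (i : Fin 2) :
    grad (interp B ε S a) i 0 x = 1 / ε * b (x 0 / ε - k.1) *
      ((1 - B (x 1 / ε - k.2)) * (a (k + (1, 0)) i - a k i) +
        B (x 1 / ε - k.2) * (a (k + (1, 1)) i - a (k + (0, 1)) i)) := by
  have := sum_corners (S := S) (k := k) (P := fun n => 1 / ε * hat b (x 0 / ε - n))
    (Q := fun n => hat B (x 1 / ε - n)) (a := fun m => a m i)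
    (fun n hn hn' => by
      rw [hat_corner_eq_zero hB.deriv_eq_zero hB.deriv_eq_zero' h0 n hn hn', mul_zero])
    (hat_corner_eq_zero hB.eq_zero hB.eq_one h1)
    (fun m hm => by simp [ha m hm])
  simp only [hat_corner_zero hB.deriv_eq_zero' h0, hat_corner_zero hB.eq_one h1,
    hat_corner_one hB.deriv_eq_zero h0, hat_corner_one hB.eq_zero h1] at this
  rw [grad_interp_zero hB, this]
  ring

theorem grad_interp_one_apply (hB : IsStep B b θ) (ha : ∀ m ∉ S, a m = 0) {k : ℤ × ℤ} {x : Plane}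
    (h0 : x 0 / ε - k.1 ∈ Set.Icc (0 : ℝ) 1) (h1 : x 1 / ε - k.2 ∈ Set.Icc (0 : ℝ) 1) (i : Fin 2) :
    grad (interp B ε S a) i 1 x = 1 / ε * b (x 1 / ε - k.2) *
      ((1 - B (x 0 / ε - k.1)) * (a (k + (0, 1)) i - a k i) +
        B (x 0 / ε - k.1) * (a (k + (1, 1)) i - a (k + (1, 0)) i)) := by
  have := sum_corners (S := S) (k := k) (P := fun n => hat B (x 0 / ε - n))
    (Q := fun n => 1 / ε * hat b (x 1 / ε - n)) (a := fun m => a m i)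
    (hat_corner_eq_zero hB.eq_zero hB.eq_one h0)
    (fun n hn hn' => by
      rw [hat_corner_eq_zero hB.deriv_eq_zero hB.deriv_eq_zero' h1 n hn hn', mul_zero])
    (fun m hm => by simp [ha m hm])
  simp only [hat_corner_zero hB.deriv_eq_zero' h1, hat_corner_zero hB.eq_one h0,
    hat_corner_one hB.deriv_eq_zero h1, hat_corner_one hB.eq_zero h0] at this
  rw [grad_interp_one hB, this]
  ring

/-- The cross product of two planar vectors. -/
def wedge (p q : Plane) : ℝ := p 0 * q 1 - p 1 * q 0

theorem integral_step_slope (hB : IsStep B b θ) (hε : 0 < ε) :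
    ∫ s in (0 : ℝ)..ε, 1 / ε * b (s / ε) = 1 := by
  have h : ∀ s ∈ Set.uIcc 0 ε, HasDerivAt (fun s => B (s / ε)) (1 / ε * b (s / ε)) s := by
    intro s _
    rw [mul_comm]
    exact (hB.hasDerivAt (s / ε)).comp s ((hasDerivAt_id s).div_const ε)
  rw [intervalIntegral.integral_eq_sub_of_hasDerivAt h, div_self hε.ne', hB.eq_one 1 le_rfl,
    zero_div, hB.eq_zero 0 le_rfl, sub_zero]
  have := hB.contDiff.continuous
  exact Continuous.intervalIntegrable (by fun_prop) _ _

/-- Along a bond the interpolant is `(1 - B)a + Ba'`, whose current is `B'` times the wedge of the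
end values. The circulation is therefore exact, whatever the profile. -/
theorem edgeCirc_interp_zero (hB : IsStep B b θ) (hε : 0 < ε) (ha : ∀ m ∉ S, a m = 0)
    (k : ℤ × ℤ) : edgeCirc (interp B ε S a) ε 0 (latticePt ε k) = wedge (a k) (a (k + (1, 0))) := by
  have h : ∀ s ∈ Set.uIcc 0 ε, cross (interp B ε S a) 0
      (latticePt ε k + s • EuclideanSpace.single 0 1) =
      wedge (a k) (a (k + (1, 0))) * (1 / ε * b (s / ε)) := by
    intro s hs
    rw [Set.uIcc_of_le hε.le] at hs
    set x : Plane := latticePt ε k + s • EuclideanSpace.single 0 1 with hx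
    have e0 : x 0 / ε - k.1 = s / ε := by
      simp [hx, latticePt]; field_simp; ring
    have e1 : x 1 / ε - k.2 = 0 := by
      simp [hx, latticePt]; field_simp; ring
    have h0 : x 0 / ε - k.1 ∈ Set.Icc (0 : ℝ) 1 := by
      rw [e0]; exact ⟨div_nonneg hs.1 hε.le, (div_le_one hε).2 hs.2⟩
    have h1 : x 1 / ε - k.2 ∈ Set.Icc (0 : ℝ) 1 := by rw [e1]; simp
    rw [cross, interp_apply hB ha h0 h1, interp_apply hB ha h0 h1,
      grad_interp_zero_apply hB ha h0 h1, grad_interp_zero_apply hB ha h0 h1, e0, e1,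
      hB.eq_zero 0 le_rfl, wedge]
    ring
  rw [edgeCirc, intervalIntegral.integral_congr h, intervalIntegral.integral_const_mul,
    integral_step_slope hB hε, mul_one]

theorem edgeCirc_interp_one (hB : IsStep B b θ) (hε : 0 < ε) (ha : ∀ m ∉ S, a m = 0)
    (k : ℤ × ℤ) : edgeCirc (interp B ε S a) ε 1 (latticePt ε k) = wedge (a k) (a (k + (0, 1))) := by
  have h : ∀ s ∈ Set.uIcc 0 ε, cross (interp B ε S a) 1
      (latticePt ε k + s • EuclideanSpace.single 1 1) =
      wedge (a k) (a (k + (0, 1))) * (1 / ε * b (s / ε)) := by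
    intro s hs
    rw [Set.uIcc_of_le hε.le] at hs
    set x : Plane := latticePt ε k + s • EuclideanSpace.single 1 1 with hx
    have e1 : x 1 / ε - k.2 = s / ε := by
      simp [hx, latticePt]; field_simp; ring
    have e0 : x 0 / ε - k.1 = 0 := by
      simp [hx, latticePt]; field_simp; ring
    have h1 : x 1 / ε - k.2 ∈ Set.Icc (0 : ℝ) 1 := by
      rw [e1]; exact ⟨div_nonneg hs.1 hε.le, (div_le_one hε).2 hs.2⟩
    have h0 : x 0 / ε - k.1 ∈ Set.Icc (0 : ℝ) 1 := by rw [e0]; simp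
    rw [cross, interp_apply hB ha h0 h1, interp_apply hB ha h0 h1,
      grad_interp_one_apply hB ha h0 h1, grad_interp_one_apply hB ha h0 h1, e0, e1,
      hB.eq_zero 0 le_rfl, wedge]
    ring
  rw [edgeCirc, intervalIntegral.integral_congr h, intervalIntegral.integral_const_mul,
    integral_step_slope hB hε, mul_one]

end Interp

end

section

variable {Ω : Set Plane}

/-! ### Energy of an interpolated lattice field -/

/-- Squared differences of a lattice field along horizontal bonds. -/
def hDiffSq (a : ℤ × ℤ → Plane) (k : ℤ × ℤ) : ℝ := ‖a (k + (1, 0)) - a k‖ ^ 2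

/-- Squared differences of a lattice field along vertical bonds. -/
def vDiffSq (a : ℤ × ℤ → Plane) (k : ℤ × ℤ) : ℝ := ‖a (k + (0, 1)) - a k‖ ^ 2

theorem norm_sq_plane (p : Plane) : ‖p‖ ^ 2 = p 0 ^ 2 + p 1 ^ 2 := by
  rw [EuclideanSpace.norm_sq_eq, Fin.sum_univ_two, Real.norm_eq_abs, Real.norm_eq_abs, sq_abs,
    sq_abs]

theorem convex_sq_le {X α β : ℝ} (h0 : 0 ≤ X) (h1 : X ≤ 1) :
    ((1 - X) * α + X * β) ^ 2 ≤ (1 - X) * α ^ 2 + X * β ^ 2 := by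
  nlinarith [mul_nonneg (mul_nonneg h0 (sub_nonneg.2 h1)) (sq_nonneg (α - β))]

section Interp

variable {B b : ℝ → ℝ} {θ ε : ℝ} {S : Finset (ℤ × ℤ)} {a : ℤ × ℤ → Plane}

/-- Each partial derivative is a slope, at most `(1 + θ)/ε`, times a convex combination of the
differences on two opposite bonds; the square is convex. -/
theorem gradSq_interp_le (hB : IsStep B b θ) (hε : 0 < ε) (ha : ∀ m ∉ S, a m = 0)
    {k : ℤ × ℤ} {x : Plane}
    (h0 : x 0 / ε - k.1 ∈ Set.Icc (0 : ℝ) 1) (h1 : x 1 / ε - k.2 ∈ Set.Icc (0 : ℝ) 1) :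
    gradSq (interp B ε S a) x ≤ ((1 + θ) / ε) ^ 2 *
      ((1 - B (x 1 / ε - k.2)) * hDiffSq a k + B (x 1 / ε - k.2) * hDiffSq a (k + (0, 1)) +
        ((1 - B (x 0 / ε - k.1)) * vDiffSq a k + B (x 0 / ε - k.1) * vDiffSq a (k + (1, 0)))) := by
  have e1 : k + (0, 1) + (1, 0) = k + (1, 1) := by rw [add_assoc]; rfl
  have e2 : k + (1, 0) + (0, 1) = k + (1, 1) := by rw [add_assoc]; rfl
  have hb : ∀ s, (1 / ε * b s) ^ 2 ≤ ((1 + θ) / ε) ^ 2 := fun s => by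
    rw [one_div_mul_eq_div]
    have := hB.deriv_nonneg s
    have := hB.deriv_le s
    gcongr
  rw [gradSq_eq, grad_interp_zero_apply hB ha h0 h1, grad_interp_zero_apply hB ha h0 h1,
    grad_interp_one_apply hB ha h0 h1, grad_interp_one_apply hB ha h0 h1]
  set X := B (x 0 / ε - k.1)
  set Y := B (x 1 / ε - k.2)
  have hX0 : 0 ≤ X := hB.nonneg _
  have hX1 : X ≤ 1 := hB.le_one _
  have hY0 : 0 ≤ Y := hB.nonneg _
  have hY1 : Y ≤ 1 := hB.le_one _
  have key : ∀ (c s : ℝ), c ^ 2 ≤ ((1 + θ) / ε) ^ 2 → 0 ≤ s → s ≤ 1 → ∀ α β : ℝ,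
      (c * ((1 - s) * α + s * β)) ^ 2 ≤
        ((1 + θ) / ε) ^ 2 * ((1 - s) * α ^ 2 + s * β ^ 2) := by
    intro c s hc hs0 hs1 α β
    rw [mul_pow]
    exact mul_le_mul hc (convex_sq_le hs0 hs1) (sq_nonneg _) (sq_nonneg _)
  simp only [hDiffSq, vDiffSq, norm_sq_plane, e1, e2, PiLp.sub_apply]
  linarith [key _ Y (hb (x 0 / ε - k.1)) hY0 hY1 (a (k + (1, 0)) 0 - a k 0)
      (a (k + (1, 1)) 0 - a (k + (0, 1)) 0),
    key _ Y (hb (x 0 / ε - k.1)) hY0 hY1 (a (k + (1, 0)) 1 - a k 1)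
      (a (k + (1, 1)) 1 - a (k + (0, 1)) 1),
    key _ X (hb (x 1 / ε - k.2)) hX0 hX1 (a (k + (0, 1)) 0 - a k 0)
      (a (k + (1, 1)) 0 - a (k + (1, 0)) 0),
    key _ X (hb (x 1 / ε - k.2)) hX0 hX1 (a (k + (0, 1)) 1 - a k 1)
      (a (k + (1, 1)) 1 - a (k + (1, 0)) 1)]

/-- The deviation from the unit vector `a k` is a combination, with coefficients in `[0, 1]`, of the
differences along the lower, right and left bonds. -/
theorem one_sub_norm_interp_sq_le (hB : IsStep B b θ) (ha : ∀ m ∉ S, a m = 0)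
    {k : ℤ × ℤ} (hk : ‖a k‖ = 1) {x : Plane}
    (h0 : x 0 / ε - k.1 ∈ Set.Icc (0 : ℝ) 1) (h1 : x 1 / ε - k.2 ∈ Set.Icc (0 : ℝ) 1) :
    (1 - ‖interp B ε S a x‖) ^ 2 ≤
      3 * (hDiffSq a k + vDiffSq a k + vDiffSq a (k + (1, 0))) := by
  have e2 : k + (1, 0) + (0, 1) = k + (1, 1) := by rw [add_assoc]; rfl
  set X := B (x 0 / ε - k.1) with hX
  set Y := B (x 1 / ε - k.2) with hY
  have hX0 : 0 ≤ X := hB.nonneg _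
  have hX1 : X ≤ 1 := hB.le_one _
  have hY0 : 0 ≤ Y := hB.nonneg _
  have hY1 : Y ≤ 1 := hB.le_one _
  have h2 : interp B ε S a x - a k = X • (a (k + (1, 0)) - a k) +
      (X * Y) • (a (k + (1, 0) + (0, 1)) - a (k + (1, 0))) +
      ((1 - X) * Y) • (a (k + (0, 1)) - a k) := by
    ext i
    simp only [PiLp.sub_apply, PiLp.add_apply, PiLp.smul_apply, smul_eq_mul]
    rw [interp_apply hB ha h0 h1, e2]
    ring
  have h3 : ‖interp B ε S a x - a k‖ ≤ ‖a (k + (1, 0)) - a k‖ +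
      ‖a (k + (1, 0) + (0, 1)) - a (k + (1, 0))‖ + ‖a (k + (0, 1)) - a k‖ := by
    have hs : ∀ (c : ℝ) (p : Plane), 0 ≤ c → c ≤ 1 → ‖c • p‖ ≤ ‖p‖ := fun c p hc hc1 => by
      rw [norm_smul, Real.norm_eq_abs, abs_of_nonneg hc]
      exact mul_le_of_le_one_left (norm_nonneg _) hc1
    rw [h2]
    exact norm_add₃_le.trans (add_le_add (add_le_add (hs _ _ hX0 hX1)
      (hs _ _ (mul_nonneg hX0 hY0) (mul_le_one₀ hX1 hY0 hY1)))
      (hs _ _ (mul_nonneg (sub_nonneg.2 hX1) hY0) (mul_le_one₀ (by linarith) hY0 hY1)))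
  have h4 : |1 - ‖interp B ε S a x‖| ≤ ‖interp B ε S a x - a k‖ := by
    rw [← hk, norm_sub_rev]; exact abs_norm_sub_norm_le _ _
  have h5 := h4.trans h3
  rw [← sq_abs, hDiffSq, vDiffSq, vDiffSq]
  set p := ‖a (k + (1, 0)) - a k‖
  set q := ‖a (k + (1, 0) + (0, 1)) - a (k + (1, 0))‖
  set r := ‖a (k + (0, 1)) - a k‖
  calc |1 - ‖interp B ε S a x‖| ^ 2 ≤ (p + q + r) ^ 2 := by gcongr
    _ ≤ _ := by nlinarith [sq_nonneg (p - q), sq_nonneg (q - r), sq_nonneg (p - r)]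

theorem coord_div_sub_mem {k : ℤ × ℤ} (hε : 0 < ε) {x : Plane} (hx : x ∈ box (latticePt ε k) ε) :
    x 0 / ε - k.1 ∈ Set.Icc (0 : ℝ) 1 ∧ x 1 / ε - k.2 ∈ Set.Icc (0 : ℝ) 1 := by
  obtain ⟨⟨h1, h2⟩, h3, h4⟩ := hx
  rw [latticePt_zero] at h1 h2
  rw [latticePt_one] at h3 h4
  have key : ∀ (s : ℝ) (n : ℤ), ε * n ≤ s → s < ε * n + ε → s / ε - n ∈ Set.Icc (0 : ℝ) 1 := by
    intro s n h h'
    constructor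
    · rw [sub_nonneg, le_div_iff₀ hε]; linarith
    · rw [sub_le_iff_le_add, div_le_iff₀ hε]; linarith
  exact ⟨key _ _ h1 h2, key _ _ h3 h4⟩

/-- The mean of the step in the coordinate `j` over a cell. -/
def stepMean (B : ℝ → ℝ) (ε : ℝ) (j : Fin 2) : ℝ := 1 / ε ^ 2 * ∫ x in box 0 ε, B (x j / ε)

theorem integrableOn_box {F : Plane → ℝ} (hF : Continuous F) (p : Plane) (δ : ℝ) :
    IntegrableOn F (box p δ) := by
  refine integrableOn_of_continuous (Metric.isBounded_closedBall (x := p) (r := 2 * δ) |>.subset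
    fun x hx => Metric.mem_closedBall.2 (dist_le_of_mem_box hx)) hF

theorem stepMean_mem (hB : IsStep B b θ) (hε : 0 < ε) (j : Fin 2) :
    0 ≤ stepMean B ε j ∧ stepMean B ε j ≤ 1 := by
  have hc := hB.continuous
  constructor
  · exact mul_nonneg (by positivity) (integral_nonneg fun x => hB.nonneg _)
  · rw [stepMean, one_div, inv_mul_le_iff₀ (by positivity), mul_one]
    have h1 : ∫ x in box 0 ε, B (x j / ε) ≤ ∫ _ in box 0 ε, (1 : ℝ) :=
      setIntegral_mono (integrableOn_box (by fun_prop) 0 ε)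
        (integrableOn_box continuous_const 0 ε) fun x => hB.le_one _
    refine h1.trans_eq ?_
    rw [setIntegral_const, smul_eq_mul, mul_one, Measure.real, volume_box_zero hε.le,
      ENNReal.toReal_ofReal (by positivity)]

theorem setIntegral_box_step (hε : 0 < ε) (j : Fin 2) (k : ℤ × ℤ) (n : ℤ)
    (hn : latticePt ε k j = ε * n) :
    ∫ x in box (latticePt ε k) ε, B (x j / ε - n) = ε ^ 2 * stepMean B ε j := by
  rw [setIntegral_box_eq, stepMean, ← mul_assoc, mul_one_div_cancel (by positivity), one_mul]
  refine integral_congr_ae (Eventually.of_forall fun x => ?_)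
  simp only [PiLp.add_apply]
  rw [hn]
  congr 1
  field_simp
  ring

theorem lintegral_box_glDensity_interp_le (hB : IsStep B b θ) (hε : 0 < ε) (ha : ∀ m ∉ S, a m = 0)
    {k : ℤ × ℤ} (hk : ‖a k‖ = 1) (δ : ℝ) :
    ∫⁻ x in box (latticePt ε k) ε, ENNReal.ofReal (glDensity δ (interp B ε S a) x) ≤
      ENNReal.ofReal ((1 + θ) ^ 2 / 2 * (((1 - stepMean B ε 1) * hDiffSq a k +
          stepMean B ε 1 * hDiffSq a (k + (0, 1))) + ((1 - stepMean B ε 0) * vDiffSq a k +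
          stepMean B ε 0 * vDiffSq a (k + (1, 0)))) +
        3 * (ε / δ) ^ 2 * (hDiffSq a k + vDiffSq a k + vDiffSq a (k + (1, 0)))) := by
  have hc := hB.continuous
  set c₀ : ℝ := (1 + θ) ^ 2 / (2 * ε ^ 2) * (hDiffSq a k + vDiffSq a k) +
    3 / δ ^ 2 * (hDiffSq a k + vDiffSq a k + vDiffSq a (k + (1, 0))) with hc₀
  set c₁ : ℝ := (1 + θ) ^ 2 / (2 * ε ^ 2) * (hDiffSq a (k + (0, 1)) - hDiffSq a k) with hc₁
  set c₂ : ℝ := (1 + θ) ^ 2 / (2 * ε ^ 2) * (vDiffSq a (k + (1, 0)) - vDiffSq a k) with hc₂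
  set R : Plane → ℝ := fun x => c₀ + c₁ * B (x 1 / ε - k.2) + c₂ * B (x 0 / ε - k.1) with hR
  have hRc : Continuous R := by fun_prop
  have hle : ∀ x ∈ box (latticePt ε k) ε, glDensity δ (interp B ε S a) x ≤ R x := by
    intro x hx
    obtain ⟨h0, h1⟩ := coord_div_sub_mem hε hx
    have h2 := gradSq_interp_le hB hε ha h0 h1
    have h3 := one_sub_norm_interp_sq_le hB ha hk h0 h1
    rw [glDensity]
    have h4 : 1 / δ ^ 2 * (1 - ‖interp B ε S a x‖) ^ 2 ≤ 1 / δ ^ 2 * (3 * (hDiffSq a k +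
        vDiffSq a k + vDiffSq a (k + (1, 0)))) := mul_le_mul_of_nonneg_left h3 (by positivity)
    refine (add_le_add (mul_le_mul_of_nonneg_left h2 (by norm_num)) h4).trans_eq ?_
    simp only [hR, hc₀, hc₁, hc₂]
    field_simp
    ring
  have hR0 : ∀ x ∈ box (latticePt ε k) ε, 0 ≤ R x := fun x hx =>
    (glDensity_nonneg δ _ x).trans (hle x hx)
  have hi := integrableOn_box hRc (latticePt ε k) ε
  calc ∫⁻ x in box (latticePt ε k) ε, ENNReal.ofReal (glDensity δ (interp B ε S a) x)
      ≤ ∫⁻ x in box (latticePt ε k) ε, ENNReal.ofReal (R x) :=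
        setLIntegral_mono' (measurableSet_box _ _) fun x hx => ENNReal.ofReal_le_ofReal (hle x hx)
    _ = ENNReal.ofReal (∫ x in box (latticePt ε k) ε, R x) :=
        (ofReal_integral_eq_lintegral_ofReal hi ((ae_restrict_mem (measurableSet_box _ _)).mono
          hR0)).symm
    _ = _ := by
        congr 1
        have i0 : IntegrableOn (fun _ : Plane => c₀) (box (latticePt ε k) ε) :=
          integrableOn_box continuous_const _ _
        have i1 : IntegrableOn (fun x : Plane => c₁ * B (x 1 / ε - k.2)) (box (latticePt ε k) ε) :=
          integrableOn_box (by fun_prop) _ _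
        have i2 : IntegrableOn (fun x : Plane => c₂ * B (x 0 / ε - k.1)) (box (latticePt ε k) ε) :=
          integrableOn_box (by fun_prop) _ _
        have i01 : IntegrableOn (fun x : Plane => c₀ + c₁ * B (x 1 / ε - k.2))
          (box (latticePt ε k) ε) := i0.add i1
        simp only [hR]
        rw [integral_add i01 i2, integral_add i0 i1, integral_const_mul,
          integral_const_mul, setIntegral_box_step hε 1 k k.2 rfl,
          setIntegral_box_step hε 0 k k.1 rfl, setIntegral_const, smul_eq_mul, Measure.real,
          volume_box hε.le, ENNReal.toReal_ofReal (by positivity), hc₀, hc₁, hc₂]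
        field_simp
        ring

theorem sum_cells_le_sum (C H : Finset (ℤ × ℤ)) (e : ℤ × ℤ) {x : ℤ × ℤ → ℝ} (hx : ∀ k, 0 ≤ x k)
    (h : ∀ k ∈ C, k + e ∈ H) : ∑ k ∈ C, x (k + e) ≤ ∑ k ∈ H, x k := by
  rw [← Finset.sum_image (f := x) (g := fun k => k + e) fun k _ l _ hkl => add_right_cancel hkl]
  exact Finset.sum_le_sum_of_subset_of_nonneg (Finset.image_subset_iff.2 h) fun k _ _ => hx k

/-- A horizontal bond receives weight `1 - m` from the cell above it and `m` from the cell below,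
hence at most one in total; likewise for vertical bonds. Only the slope factor `(1 + θ)²` is lost.
The potential costs `(ε/δ)²` because a cell has area `ε²`. -/
theorem lintegral_cellUnion_glDensity_interp_le (hbdd : Bornology.IsBounded Ω) (hB : IsStep B b θ)
    (hε : 0 < ε) (ha : ∀ m ∉ S, a m = 0) (hk : ∀ k ∈ cells Ω ε, ‖a k‖ = 1) (δ : ℝ) :
    ∫⁻ x in cellUnion Ω ε, ENNReal.ofReal (glDensity δ (interp B ε S a) x) ≤
      ENNReal.ofReal (((1 + θ) ^ 2 + 12 * (ε / δ) ^ 2) *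
        (1 / 2 * bondSum Ω ε (hDiffSq a) (vDiffSq a))) := by
  have hh0 : ∀ k, 0 ≤ hDiffSq a k := fun k => sq_nonneg _
  have hv0 : ∀ k, 0 ≤ vDiffSq a k := fun k => sq_nonneg _
  obtain ⟨hm0, hm0'⟩ := stepMean_mem hB hε 0
  obtain ⟨hm1, hm1'⟩ := stepMean_mem hB hε 1
  rw [cellUnion_eq hbdd hε, lintegral_biUnion_finset (pairwiseDisjoint_box hε _)
    fun k _ => measurableSet_box _ _]
  set C := (finite_cells hbdd hε).toFinset with hC
  refine (Finset.sum_le_sum fun k hkC => lintegral_box_glDensity_interp_le hB hε ha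
    (hk k ((Set.Finite.mem_toFinset _).1 hkC)) δ).trans ?_
  rw [← ENNReal.ofReal_sum_of_nonneg]
  swap
  · intro k _
    have := hh0 k
    have := hv0 k
    have := hh0 (k + (0, 1))
    have := hv0 (k + (1, 0))
    have := sub_nonneg.2 hm0'
    have := sub_nonneg.2 hm1'
    positivity
  refine ENNReal.ofReal_le_ofReal ?_
  rw [bondSum_eq hbdd hε]
  simp only [Finset.sum_add_distrib, ← Finset.mul_sum]
  set H := (finite_hBonds hbdd hε).toFinset
  set W := (finite_vBonds hbdd hε).toFinset
  have corner : ∀ k ∈ C, ∀ i j : ℤ, (i = 0 ∨ i = 1) → (j = 0 ∨ j = 1) →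
      latticePt ε (k + (i, j)) ∈ Ω := fun k hk i j hi hj =>
    latticePt_mem_of_mem_cells hε.le ((Set.Finite.mem_toFinset _).1 hk) hi hj
  have hz : ∀ k : ℤ × ℤ, k + ((0 : ℤ), (0 : ℤ)) = k := fun k => add_zero k
  have s1 : ∑ k ∈ C, hDiffSq a k ≤ ∑ k ∈ H, hDiffSq a k := by
    have := sum_cells_le_sum C H (0, 0) hh0 fun k hk => (Set.Finite.mem_toFinset _).2
      ⟨corner k hk 0 0 (by simp) (by simp), by
        rw [add_assoc]; exact corner k hk 1 0 (by simp) (by simp)⟩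
    simpa only [hz] using this
  have s2 : ∑ k ∈ C, vDiffSq a k ≤ ∑ k ∈ W, vDiffSq a k := by
    have := sum_cells_le_sum C W (0, 0) hv0 fun k hk => (Set.Finite.mem_toFinset _).2
      ⟨corner k hk 0 0 (by simp) (by simp), by
        rw [add_assoc]; exact corner k hk 0 1 (by simp) (by simp)⟩
    simpa only [hz] using this
  have s3 : ∑ k ∈ C, hDiffSq a (k + (0, 1)) ≤ ∑ k ∈ H, hDiffSq a k :=
    sum_cells_le_sum C H (0, 1) hh0 fun k hk => (Set.Finite.mem_toFinset _).2
      ⟨corner k hk 0 1 (by simp) (by simp), by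
        rw [add_assoc]; exact corner k hk 1 1 (by simp) (by simp)⟩
  have s4 : ∑ k ∈ C, vDiffSq a (k + (1, 0)) ≤ ∑ k ∈ W, vDiffSq a k :=
    sum_cells_le_sum C W (1, 0) hv0 fun k hk => (Set.Finite.mem_toFinset _).2
      ⟨corner k hk 1 0 (by simp) (by simp), by
        rw [add_assoc]; exact corner k hk 1 1 (by simp) (by simp)⟩
  set m0 := stepMean B ε 0
  set m1 := stepMean B ε 1
  have hH0 : 0 ≤ ∑ k ∈ H, hDiffSq a k := Finset.sum_nonneg fun k _ => hh0 k
  have t1 : (1 - m1) * ∑ k ∈ C, hDiffSq a k + m1 * ∑ k ∈ C, hDiffSq a (k + (0, 1)) ≤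
      ∑ k ∈ H, hDiffSq a k := by
    linarith [mul_le_mul_of_nonneg_left s1 (sub_nonneg.2 hm1'), mul_le_mul_of_nonneg_left s3 hm1]
  have t2 : (1 - m0) * ∑ k ∈ C, vDiffSq a k + m0 * ∑ k ∈ C, vDiffSq a (k + (1, 0)) ≤
      ∑ k ∈ W, vDiffSq a k := by
    linarith [mul_le_mul_of_nonneg_left s2 (sub_nonneg.2 hm0'), mul_le_mul_of_nonneg_left s4 hm0]
  have t3 : ∑ k ∈ C, hDiffSq a k + ∑ k ∈ C, vDiffSq a k + ∑ k ∈ C, vDiffSq a (k + (1, 0)) ≤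
      2 * (∑ k ∈ H, hDiffSq a k + ∑ k ∈ W, vDiffSq a k) := by linarith
  have u1 := mul_le_mul_of_nonneg_left (add_le_add t1 t2)
    (by positivity : 0 ≤ (1 + θ) ^ 2 / 2)
  have u2 := mul_le_mul_of_nonneg_left t3 (by positivity : 0 ≤ 3 * (ε / δ) ^ 2)
  linarith

end Interp

end

section

variable {Ω : Set Plane} {ε : ℝ}

/-! ### Recovering a Sobolev map from a spin field -/

/-- The complex conjugate of a spin field, as a planar lattice field extended by zero. -/
def conjField (v : Site Ω ε → Circle) (k : ℤ × ℤ) : Plane :=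
  open Classical in
  if hk : latticePt ε k ∈ Ω then !₂[(v ⟨k, hk⟩ : ℂ).re, -(v ⟨k, hk⟩ : ℂ).im] else 0

theorem conjField_of_mem (v : Site Ω ε → Circle) {k : ℤ × ℤ} (hk : latticePt ε k ∈ Ω) :
    conjField v k = !₂[(v ⟨k, hk⟩ : ℂ).re, -(v ⟨k, hk⟩ : ℂ).im] := dif_pos hk

theorem norm_conjField_sub_sq (v : Site Ω ε → Circle) (i j : Site Ω ε) :
    ‖conjField v j.1 - conjField v i.1‖ ^ 2 = ‖(v i : ℂ) - (v j : ℂ)‖ ^ 2 := by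
  rw [conjField_of_mem v i.2, conjField_of_mem v j.2, norm_sq_plane, ← Complex.normSq_eq_norm_sq,
    Complex.normSq_apply]
  change ((v j : ℂ).re - (v i : ℂ).re) ^ 2 + (-(v j : ℂ).im - -(v i : ℂ).im) ^ 2 = _
  rw [Complex.sub_re, Complex.sub_im]
  ring

theorem norm_conjField (v : Site Ω ε → Circle) {k : ℤ × ℤ} (hk : latticePt ε k ∈ Ω) :
    ‖conjField v k‖ = 1 := by
  have h1 : ‖conjField v k‖ ^ 2 = 1 := by
    rw [conjField_of_mem v hk, norm_sq_plane]
    have h2 := Circle.norm_coe (v ⟨k, hk⟩)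
    have h3 : Complex.normSq (v ⟨k, hk⟩ : ℂ) = 1 := by rw [Complex.normSq_eq_norm_sq, h2, one_pow]
    rw [Complex.normSq_apply] at h3
    simp
    linarith
  nlinarith [norm_nonneg (conjField v k)]

theorem energyXY_eq (hbdd : Bornology.IsBounded Ω) (hε : 0 < ε) (v : Site Ω ε → Circle) :
    energyXY v = ENNReal.ofReal
      (1 / 2 * bondSum Ω ε (hDiffSq (conjField v)) (vDiffSq (conjField v))) := by
  refine Eq.trans ?_ (tsum_bond_ofReal hbdd hε
    (fun k l => ‖conjField v l - conjField v k‖ ^ 2) fun _ _ => sq_nonneg _)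
  exact congrArg _ (tsum_congr fun b => by rw [norm_conjField_sub_sq])

/-- For `y ≥ 0`: the cubic Taylor bound when `y ≤ 1`, and `0 ≤ sin y` with `y ≤ y²` beyond. A
quadratic bound suffices, since it is absorbed by the energy. -/
theorem abs_sub_sin_le {y : ℝ} (hy : |y| ≤ Real.pi) : |y - Real.sin y| ≤ y ^ 2 := by
  have key : ∀ z : ℝ, 0 ≤ z → z ≤ Real.pi → |z - Real.sin z| ≤ z ^ 2 := by
    intro z hz hz'
    rw [abs_of_nonneg (sub_nonneg.2 (Real.sin_le hz))]
    rcases le_total 1 z with h | h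
    · nlinarith [Real.sin_nonneg_of_nonneg_of_le_pi hz hz']
    · rcases hz.eq_or_lt with rfl | hz0
      · simp
      · have h1 := Real.sin_gt_sub_cube hz0
        have h2 : z ^ 3 ≤ z ^ 2 := by nlinarith [mul_nonneg (sq_nonneg z) (sub_nonneg.2 h)]
        nlinarith [pow_pos hz0 3]
  rcases le_total 0 y with h | h
  · rw [abs_of_nonneg h] at hy
    exact key y h hy
  · rw [abs_of_nonpos h] at hy
    have := key (-y) (by linarith) hy
    rw [Real.sin_neg, neg_sq] at this
    rw [abs_sub_comm]
    convert this using 2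
    ring

theorem sq_le_sin_sq {β : ℝ} (hβ : |β| ≤ 1 / 2) : 4 * β ^ 2 ≤ Real.sin (Real.pi * β) ^ 2 := by
  have hpi := Real.pi_pos
  have h1 : 2 * |β| ≤ Real.sin (Real.pi * |β|) := by
    have := Real.mul_le_sin (x := Real.pi * |β|) (by positivity) (by nlinarith)
    calc 2 * |β| = 2 / Real.pi * (Real.pi * |β|) := by field_simp
      _ ≤ _ := this
  have h2 : Real.sin (Real.pi * β) ^ 2 = Real.sin (Real.pi * |β|) ^ 2 := by
    rcases abs_cases β with h | h
    · rw [h.1]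
    · rw [h.1, mul_neg, Real.sin_neg, neg_sq]
  rw [h2, ← sq_abs β]
  nlinarith [abs_nonneg β]

/-- Comparison of the elastic strain of the phase with the circulation along one bond. -/
theorem elasticStrain_phase_estimate (v : Site Ω ε → Circle) (i j : Site Ω ε) :
    elasticStrain (fun i => 1 / (2 * Real.pi) * phase (v i)) i.1 j.1 ^ 2 ≤
      ‖conjField v j.1 - conjField v i.1‖ ^ 2 ∧
    |elasticStrain (fun i => 1 / (2 * Real.pi) * phase (v i)) i.1 j.1 +
        1 / (2 * Real.pi) * wedge (conjField v i.1) (conjField v j.1)| ≤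
      1 / 2 * ‖conjField v j.1 - conjField v i.1‖ ^ 2 := by
  set u : Site Ω ε → ℝ := fun i => 1 / (2 * Real.pi) * phase (v i) with hu
  have hpi := Real.pi_pos
  have hpi3 := Real.pi_gt_three
  have hpi4 := Real.pi_lt_d2
  obtain ⟨n, hn⟩ := elastic_eq_sub_int (u j - u i)
  have habs := abs_elastic_le (u j - u i)
  rw [elasticStrain, extend_site, extend_site]
  set β := elastic (u j - u i) with hβ
  have hph : phase (v j) - phase (v i) = 2 * Real.pi * β + n * (2 * Real.pi) := by
    rw [hn, hu]; field_simp; ring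
  have hre : ∀ i, (v i : ℂ).re = Real.cos (phase (v i)) := fun i => by
    rw [← Complex.exp_ofReal_mul_I_re, ← Circle.coe_exp, circle_exp_phase]
  have him : ∀ i, (v i : ℂ).im = Real.sin (phase (v i)) := fun i => by
    rw [← Complex.exp_ofReal_mul_I_im, ← Circle.coe_exp, circle_exp_phase]
  -- Conjugation reverses the phase, which compensates for the clockwise orientation of
  -- `dislocation`: the strain is close to minus the normalized current.
  have hw : wedge (conjField v i.1) (conjField v j.1) = -Real.sin (2 * Real.pi * β) := by
    rw [← Real.sin_add_int_mul_two_pi _ n, ← hph, Real.sin_sub, wedge, conjField_of_mem v i.2,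
      conjField_of_mem v j.2]
    change (v i : ℂ).re * -(v j : ℂ).im - -(v i : ℂ).im * (v j : ℂ).re = _
    rw [hre, him, hre, him]
    ring
  have hd : ‖conjField v j.1 - conjField v i.1‖ ^ 2 = 4 * Real.sin (Real.pi * β) ^ 2 := by
    have h1 : ‖conjField v j.1 - conjField v i.1‖ ^ 2 =
        2 - 2 * Real.cos (phase (v j) - phase (v i)) := by
      rw [norm_sq_plane, conjField_of_mem v i.2, conjField_of_mem v j.2, Real.cos_sub]
      change ((v j : ℂ).re - (v i : ℂ).re) ^ 2 + (-(v j : ℂ).im - -(v i : ℂ).im) ^ 2 = _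
      rw [hre, him, hre, him]
      nlinarith [Real.sin_sq_add_cos_sq (phase (v i)), Real.sin_sq_add_cos_sq (phase (v j))]
    rw [h1, hph, Real.cos_add_int_mul_two_pi, mul_assoc, Real.cos_two_mul]
    nlinarith [Real.sin_sq_add_cos_sq (Real.pi * β)]
  have h2 := sq_le_sin_sq habs
  have h3 := abs_sub_sin_le (y := 2 * Real.pi * β) (by
    rw [abs_mul, abs_of_pos (by positivity)]; nlinarith)
  rw [hw, hd]
  refine ⟨by nlinarith [sq_nonneg β], ?_⟩
  calc |β + 1 / (2 * Real.pi) * -Real.sin (2 * Real.pi * β)|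
      = |1 / (2 * Real.pi) * (2 * Real.pi * β - Real.sin (2 * Real.pi * β))| := by
        congr 1; field_simp; ring
    _ = 1 / (2 * Real.pi) * |2 * Real.pi * β - Real.sin (2 * Real.pi * β)| := by
        rw [abs_mul, abs_of_pos (by positivity)]
    _ ≤ 1 / (2 * Real.pi) * (2 * Real.pi * β) ^ 2 := by gcongr
    _ = 2 * Real.pi * β ^ 2 := by field_simp
    -- By `4β² ≤ sin²(πβ)` the right-hand side is at least `8β²`, and `2π ≤ 8`.
    _ ≤ 1 / 2 * (4 * Real.sin (Real.pi * β) ^ 2) := by nlinarith [sq_nonneg β]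

theorem exists_norm_vorticityMeasure_le (hbdd : Bornology.IsBounded Ω) :
    ∃ M : ℝ, 0 < M ∧ ∀ ε : ℝ, 0 < ε → ε ≤ 1 → ∀ (v : Site Ω ε → Circle) (E : ℝ), 0 ≤ E →
      energyXY v ≤ ENNReal.ofReal E → ‖vorticityMeasure v‖ ≤ M * √E := by
  obtain ⟨M, hM, H⟩ := exists_norm_dislocationMeasure_le hbdd
  refine ⟨M, hM, fun ε hε hε1 v E hE hv => H ε hε hε1 _ E hE (le_trans ?_ hv)⟩
  rw [energyXY_eq hbdd hε, energySD_eq hbdd hε]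
  refine ENNReal.ofReal_le_ofReal (mul_le_mul_of_nonneg_left ?_ (by norm_num))
  exact bondSum_mono hbdd hε
    (fun k hk => (elasticStrain_phase_estimate v ⟨k, hk.1⟩ ⟨k + (1, 0), hk.2⟩).1)
    (fun k hk => (elasticStrain_phase_estimate v ⟨k, hk.1⟩ ⟨k + (0, 1), hk.2⟩).1)

theorem abs_vorticityMeasure_sub_le (hbdd : Bornology.IsBounded Ω) (hε : 0 < ε) {B b : ℝ → ℝ}
    {θ E E₁ δ : ℝ} (hB : IsStep B b θ) (v : Site Ω ε → Circle)
    (hE : 1 / 2 * bondSum Ω ε (hDiffSq (conjField v)) (vDiffSq (conjField v)) ≤ E)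
    (hE₁0 : 0 ≤ E₁) (hE₁ : ∫⁻ x in cellUnion Ω ε, ENNReal.ofReal (glDensity δ
      (interp B ε (finite_sites hbdd hε).toFinset (conjField v)) x) ≤ ENNReal.ofReal E₁)
    (φ : LipC Ω) :
    |vorticityMeasure v φ - 1 / Real.pi * ∫ x in cellUnion Ω ε,
        jacDet (interp B ε (finite_sites hbdd hε).toFinset (conjField v)) x * φ x| ≤
      ε * ‖φ‖ * (2 * E + E₁) := by
  have hpi := Real.pi_gt_three
  have ha : ∀ m ∉ (finite_sites hbdd hε).toFinset, conjField v m = 0 := fun m hm => by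
    rw [Set.Finite.mem_toFinset] at hm
    exact dif_neg hm
  set f := interp B ε (finite_sites hbdd hε).toFinset (conjField v) with hf
  have hf2 : ContDiff ℝ 2 f := contDiff_interp hB
  have hf1 : ContDiff ℝ 1 f := hf2.of_le (by norm_num)
  have hJ := integral_abs_le_of_lintegral_le (A := cellUnion Ω ε)
    (continuous_jacDet hf1).aestronglyMeasurable (abs_jacDet_le_glDensity δ f) hE₁0 hE₁
  set u : Site Ω ε → ℝ := fun i => 1 / (2 * Real.pi) * phase (v i) with hu
  change |dislocationMeasure u φ - _| ≤ _
  set c : ℝ := 1 / (2 * Real.pi) with hc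
  set xh : ℤ × ℤ → ℝ := fun k => elasticStrain u k (k + (1, 0)) +
    c * wedge (conjField v k) (conjField v (k + (1, 0))) with hxh
  set xv : ℤ × ℤ → ℝ := fun k => elasticStrain u k (k + (0, 1)) +
    c * wedge (conjField v k) (conjField v (k + (0, 1))) with hxv
  have h1 : bondSum Ω ε (fun k => |xh k|) (fun k => |xv k|) ≤ E := by
    have h2 : bondSum Ω ε (fun k => |xh k|) (fun k => |xv k|) ≤ bondSum Ω ε
        (fun k => 1 / 2 * hDiffSq (conjField v) k) (fun k => 1 / 2 * vDiffSq (conjField v) k) :=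
      bondSum_mono hbdd hε
        (fun k hk => (elasticStrain_phase_estimate v ⟨k, hk.1⟩ ⟨k + (1, 0), hk.2⟩).2)
        (fun k hk => (elasticStrain_phase_estimate v ⟨k, hk.1⟩ ⟨k + (0, 1), hk.2⟩).2)
    rw [bondSum_const_mul hbdd hε] at h2
    exact h2.trans hE
  have h2 := abs_sum_curl_mul_le hbdd hε xh xv φ
  have h3 : ∀ k, curl xh xv k = dislocation u k -
      1 / Real.pi * ∫ x in box (latticePt ε k) ε, jacDet f x := by
    intro k
    have h4 := two_mul_integral_jacDet_box hf2 (latticePt ε k) hε.le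
    rw [← latticePt_add_right, ← latticePt_add_up, hf, edgeCirc_interp_zero hB hε ha,
      edgeCirc_interp_one hB hε ha, edgeCirc_interp_zero hB hε ha,
      edgeCirc_interp_one hB hε ha] at h4
    have h5 : 1 / Real.pi * ∫ x in box (latticePt ε k) ε, jacDet f x =
        c * (2 * ∫ x in box (latticePt ε k) ε, jacDet f x) := by
      rw [hc]; field_simp
    rw [h5, h4, dislocation_eq_curl]
    simp only [curl, hxh, hxv]
    ring
  have h4 := abs_sum_cells_sub_setIntegral_cellUnion_le hbdd hε hJ.1 φ
  have h5 : ∑ k ∈ (finite_cells hbdd hε).toFinset, curl xh xv k * φ (cellCenter ε k) =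
      dislocationMeasure u φ - 1 / Real.pi * ∑ k ∈ (finite_cells hbdd hε).toFinset,
        (∫ x in box (latticePt ε k) ε, jacDet f x) * φ (cellCenter ε k) := by
    rw [dislocationMeasure_apply hbdd hε, Finset.mul_sum, ← Finset.sum_sub_distrib]
    refine Finset.sum_congr rfl fun k _ => ?_
    rw [h3]; ring
  rw [h5] at h2
  set T := ∑ k ∈ (finite_cells hbdd hε).toFinset,
    (∫ x in box (latticePt ε k) ε, jacDet f x) * φ (cellCenter ε k)
  set I := ∫ x in cellUnion Ω ε, jacDet f x * φ x
  have h6 : |1 / Real.pi * (T - I)| ≤ ε * ‖φ‖ * E₁ := by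
    rw [abs_mul, abs_of_pos (by positivity : 0 < 1 / Real.pi)]
    have h7 : 1 / Real.pi ≤ 1 := by rw [div_le_one (by linarith)]; linarith
    calc 1 / Real.pi * |T - I| ≤ 1 * (ε * ‖φ‖ * E₁) := by
          gcongr
          exact h4.trans (mul_le_mul_of_nonneg_left hJ.2 (by positivity))
      _ = _ := one_mul _
  have h7 : 2 * ε * ‖φ‖ * bondSum Ω ε (fun k => |xh k|) (fun k => |xv k|) ≤
      2 * ε * ‖φ‖ * E := by gcongr
  calc |dislocationMeasure u φ - 1 / Real.pi * I|
      = |(dislocationMeasure u φ - 1 / Real.pi * T) + 1 / Real.pi * (T - I)| := by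
        congr 1; ring
    _ ≤ _ := abs_add_le _ _
    _ ≤ ε * ‖φ‖ * (2 * E + E₁) := by linarith

/-- The interpolant has controlled energy only on the full cells, so it is composed with a
deformation sending `Ω` into them. The length `δ` enters only through the potential. -/
theorem exists_sobolevMap_of_spin (hopen : IsOpen Ω) (hbdd : Bornology.IsBounded Ω)
    (hlip : HasLipschitzBoundary Ω) : ∃ M > 0, ∃ d > 0, ∀ ε δ θ E : ℝ, 0 < ε → ε ≤ d → 0 < δ →
      ε ≤ δ → 0 < θ → θ ≤ 1 → 0 ≤ E → ∀ v : Site Ω ε → Circle, energyXY v ≤ ENNReal.ofReal E →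
      ∃ w : SobolevMap Ω,
        w.energy δ ≤ ENNReal.ofReal ((1 + M * ε) * (((1 + θ) ^ 2 + 12 * (ε / δ) ^ 2) * E)) ∧
        dist (vorticityMeasure v) ((1 / Real.pi) • w.jac) ≤ M * ε * E := by
  obtain ⟨V, hV, hVc, c, hc, t₀, ht₀, hin⟩ := exists_inward_field hbdd hlip
  obtain ⟨C, hC, t₁, ht₁, hdef⟩ := exists_deformation hV hVc
  -- The push leaves a ball of radius `3ε` around the image point, which contains the lattice square
  -- of that point, since it lies within `2ε`.
  set a : ℝ := 3 / c with ha
  have ha0 : 0 < a := by positivity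
  refine ⟨32 * (C * a) + 18, by positivity, min (t₀ / a) (t₁ / a), by positivity, ?_⟩
  intro ε δ θ E hε hεd hδ hεδ hθ hθ1 hE v hv
  simp only [le_min_iff] at hεd
  obtain ⟨hε2, hε3⟩ := hεd
  rw [le_div_iff₀ ha0] at hε2 hε3
  set t : ℝ := ε * a with ht
  have ht0 : 0 < t := by positivity
  have hct : c * t = 3 * ε := by rw [ht, ha]; field_simp
  obtain ⟨Φ, hΦ, hΦd⟩ := hdef t ht0 hε3 0
  simp only [add_zero, norm_zero] at hΦ hΦd
  have hsub : Φ '' Ω ⊆ cellUnion Ω ε := by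
    rintro _ ⟨y, hy, rfl⟩
    have hball := hin t ht0 hε2 y hy
    rw [← hΦ, hct] at hball
    have hb := mem_box_floor hε (Φ y)
    set k : ℤ × ℤ := (⌊Φ y 0 / ε⌋, ⌊Φ y 1 / ε⌋)
    refine Set.mem_iUnion₂.2 ⟨k, ?_, hb⟩
    by_contra hk
    obtain ⟨z, hz0, hz1, hz⟩ := exists_notMem_of_notMem_cells hε.le hk
    refine hz (hball ?_)
    obtain ⟨⟨h1, h2⟩, h3, h4⟩ := hb
    rw [latticePt_zero] at h1 h2
    rw [latticePt_one] at h3 h4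
    obtain ⟨h5, h6⟩ := hz0
    obtain ⟨h7, h8⟩ := hz1
    rw [Metric.mem_ball]
    have := dist_le_of_abs_sub_le (x := z) (y := Φ y) (a := ε) (b := ε)
      (abs_le.2 ⟨by linarith, by linarith⟩) (abs_le.2 ⟨by linarith, by linarith⟩)
    linarith
  obtain ⟨B, b, hB⟩ := exists_isStep hθ
  have ha' : ∀ m ∉ (finite_sites hbdd hε).toFinset, conjField v m = 0 := fun m hm => by
    rw [Set.Finite.mem_toFinset] at hm
    exact dif_neg hm
  rw [energyXY_eq hbdd hε, ENNReal.ofReal_le_ofReal_iff hE] at hv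
  set E₁ : ℝ := ((1 + θ) ^ 2 + 12 * (ε / δ) ^ 2) * E with hE₁
  have hE₁0 : 0 ≤ E₁ := by positivity
  have hE₁' : E₁ ≤ 16 * E := by
    have h1 : (ε / δ) ^ 2 ≤ 1 := pow_le_one₀ (by positivity) ((div_le_one hδ).2 hεδ)
    have h2 : (1 + θ) ^ 2 ≤ 4 := by nlinarith
    rw [hE₁]
    gcongr
    linarith
  have hUE : ∫⁻ x in cellUnion Ω ε, ENNReal.ofReal (glDensity δ
      (interp B ε (finite_sites hbdd hε).toFinset (conjField v)) x) ≤ ENNReal.ofReal E₁ := by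
    refine (lintegral_cellUnion_glDensity_interp_le hbdd hB hε ha'
      (fun k hk => norm_conjField v hk.1) δ).trans (ENNReal.ofReal_le_ofReal ?_)
    rw [hE₁]
    gcongr
  have hvort := abs_vorticityMeasure_sub_le hbdd hε hB v hv hE₁0 hUE
  set f := interp B ε (finite_sites hbdd hε).toFinset (conjField v) with hf
  have hf1 : ContDiff ℝ 1 f := (contDiff_interp hB).of_le (by norm_num)
  have hJ := integral_abs_le_of_lintegral_le (A := cellUnion Ω ε)
    (continuous_jacDet hf1).aestronglyMeasurable (abs_jacDet_le_glDensity δ f) hE₁0 hUE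
  have hΦ1 : ContDiff ℝ 1 (f ∘ Φ) :=
    hf1.comp (hΦd.contDiff.of_le (by exact_mod_cast le_top))
  refine ⟨SobolevMap.ofContDiff hbdd (f ∘ Φ) hΦ1, ?_, ?_⟩
  · rw [SobolevMap.energy_ofContDiff]
    refine (hΦd.energy_le f hf1 δ Ω hopen.measurableSet).trans ?_
    rw [ENNReal.ofReal_mul (by positivity)]
    have h1 : C * t ≤ (32 * (C * a) + 18) * ε := by
      rw [ht]; linarith [mul_pos (mul_pos hC ha0) hε]
    gcongr
    exact (lintegral_mono_set hsub).trans hUE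
  · refine SingSpace.dist_le (by positivity) fun φ => ?_
    have h1 := hvort φ
    have h2 := hΦd.abs_integral_jacDet_sub_le hopen hf1 (measurableSet_cellUnion hbdd hε) hsub
      hJ.1 (hJ.1.mono_set hsub) φ
    have h3 : ((1 / Real.pi) • (SobolevMap.ofContDiff hbdd (f ∘ Φ) hΦ1).jac) φ =
      1 / Real.pi * ∫ x in Ω, jacDet (f ∘ Φ) x * φ x := rfl
    rw [h3]
    have h4 : ∫ x in Φ '' Ω, |jacDet f x| ≤ ∫ x in cellUnion Ω ε, |jacDet f x| :=
      setIntegral_mono_set hJ.1.abs (Eventually.of_forall fun x => abs_nonneg _) hsub.eventuallyLE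
    simp only [sub_self, abs_zero, integral_zero, add_zero, zero_add] at h2
    set I := ∫ x in Ω, jacDet (f ∘ Φ) x * φ x
    set I' := ∫ x in cellUnion Ω ε, jacDet f x * φ x
    have h5 : |I - I'| ≤ ‖φ‖ * (C * t * E₁ + C * t * E₁) := by
      refine h2.trans (mul_le_mul_of_nonneg_left ?_ (norm_nonneg _))
      gcongr
      · exact h4.trans hJ.2
      · exact hJ.2
    have hpi := Real.pi_gt_three
    have h6 : |1 / Real.pi * (I' - I)| ≤ ‖φ‖ * (2 * (C * t) * E₁) := by
      rw [abs_mul, abs_of_pos (by positivity : 0 < 1 / Real.pi), abs_sub_comm]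
      have h7 : 1 / Real.pi ≤ 1 := by rw [div_le_one (by linarith)]; linarith
      calc 1 / Real.pi * |I - I'| ≤ 1 * (‖φ‖ * (C * t * E₁ + C * t * E₁)) := by gcongr
        _ = _ := by ring
    calc |vorticityMeasure v φ - 1 / Real.pi * I|
        = |(vorticityMeasure v φ - 1 / Real.pi * I') + 1 / Real.pi * (I' - I)| := by
          congr 1; ring
      _ ≤ _ := abs_add_le _ _
      _ ≤ ε * ‖φ‖ * (2 * E + E₁) + ‖φ‖ * (2 * (C * t) * E₁) := add_le_add h1 h6
      _ ≤ ε * ‖φ‖ * (2 * E + 16 * E) + ‖φ‖ * (2 * (C * t) * (16 * E)) := by gcongr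
      _ = _ := by rw [ht]; ring

end

/-! ### Choice of the new scale and asymptotics of its logarithm -/

section

/-! ### A change of scale with logarithmic loss -/

/-- The change of scale `ε ↦ ε (K + log⁺ (1/ε)) ^ K`. -/
def logScale (K : ℕ) (ε : ℝ) : ℝ := ε * (K + max 0 (-Real.log ε)) ^ K

theorem logScale_pos {K : ℕ} (hK : 1 ≤ K) {ε : ℝ} (hε : 0 < ε) : 0 < logScale K ε := by
  have : (1 : ℝ) ≤ K := by exact_mod_cast hK
  have := le_max_left 0 (-Real.log ε)
  unfold logScale
  positivity

/-- If `y = x e^r`, passing from `y` to `x` raises the logarithm by at most `r`, and `K + m + r ≤ (K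
+ m)(1 + r/K) < (K + m)e^(r/K)`. Its `K`-th power is beaten by `y/x`; the additive constant `K` is
what makes this work. -/
theorem logScale_strictMonoOn {K : ℕ} (hK : 1 ≤ K) : StrictMonoOn (logScale K) (Set.Ici 0) := by
  intro x hx y _ hxy
  have hK' : (1 : ℝ) ≤ K := by exact_mod_cast hK
  rcases (Set.mem_Ici.1 hx).eq_or_lt with rfl | hx0
  · simpa [logScale] using logScale_pos hK hxy
  have hy0 := hx0.trans hxy
  have hr : 0 < Real.log (y / x) := Real.log_pos ((one_lt_div hx0).2 hxy)
  have hlog : Real.log (y / x) = Real.log y - Real.log x := Real.log_div hy0.ne' hx0.ne'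
  set r := Real.log (y / x) with hr_def
  set m := max 0 (-Real.log y) with hm
  have hm0 : 0 ≤ m := le_max_left _ _
  have h1 : max 0 (-Real.log x) ≤ m + r :=
    max_le (by linarith) (by linarith [le_max_right 0 (-Real.log y)])
  have h2 : (K : ℝ) + max 0 (-Real.log x) < (K + m) * Real.exp (r / K) := by
    have h3 : r / K + 1 < Real.exp (r / K) := Real.add_one_lt_exp (by positivity)
    have h4 : r ≤ (K + m) * (r / K) := by
      calc r = K * (r / K) := by field_simp
        _ ≤ _ := by gcongr; linarith
    nlinarith
  have h3 : ((K : ℝ) + max 0 (-Real.log x)) ^ K < ((K + m) * Real.exp (r / K)) ^ K :=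
    pow_lt_pow_left₀ h2 (by have := le_max_left 0 (-Real.log x); positivity) (by omega)
  have h4 : Real.exp (r / K) ^ K = y / x := by
    rw [← Real.exp_nat_mul, mul_div_cancel₀ _ (by positivity), hr_def,
      Real.exp_log (by positivity)]
  rw [mul_pow, h4] at h3
  calc logScale K x = x * ((K : ℝ) + max 0 (-Real.log x)) ^ K := rfl
    _ < x * ((K + m) ^ K * (y / x)) := by gcongr
    _ = logScale K y := by rw [logScale, ← hm]; field_simp

theorem tendsto_abs_log : Tendsto (fun ε : ℝ => |Real.log ε|) (𝓝[>] 0) atTop :=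
  tendsto_abs_atBot_atTop.comp Real.tendsto_log_nhdsGT_zero

theorem logScale_eq {K : ℕ} {ε : ℝ} (hε : 0 < ε) (hε1 : ε < 1) :
    logScale K ε = ε * (K + |Real.log ε|) ^ K := by
  have h := Real.log_neg hε hε1
  rw [logScale, abs_of_neg h, max_eq_right (by linarith)]

theorem tendsto_add_div (K : ℝ) :
    Tendsto (fun ε : ℝ => (K + |Real.log ε|) / |Real.log ε|) (𝓝[>] 0) (𝓝 1) := by
  have h1 : Tendsto (fun ε : ℝ => K / |Real.log ε| + 1) (𝓝[>] 0) (𝓝 (0 + 1)) :=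
    (tendsto_const_nhds.div_atTop tendsto_abs_log).add tendsto_const_nhds
  rw [zero_add] at h1
  refine h1.congr' ?_
  filter_upwards [tendsto_abs_log.eventually_gt_atTop 0] with ε hε
  field_simp

theorem tendsto_logScale_mul (K : ℕ) (r : ℝ) :
    Tendsto (fun ε : ℝ => logScale K ε * |Real.log ε| ^ r) (𝓝[>] 0) (𝓝 0) := by
  have h1 := (tendsto_mul_abs_log_rpow (K + r)).mul ((tendsto_add_div K).pow K)
  rw [zero_mul] at h1
  refine h1.congr' ?_
  filter_upwards [tendsto_abs_log.eventually_gt_atTop 0, eventually_pos_lt one_pos] with ε hl hε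
  rw [logScale_eq hε.1 hε.2, Real.rpow_add hl, Real.rpow_natCast, div_pow]
  field_simp

theorem tendsto_logScale (K : ℕ) : Tendsto (logScale K) (𝓝[>] 0) (𝓝 0) := by
  simpa using tendsto_logScale_mul K 0

theorem logScale_continuousOn (K : ℕ) : ContinuousOn (logScale K) (Set.Ici 0) := by
  intro x hx
  rcases (Set.mem_Ici.1 hx).eq_or_lt with rfl | hx0
  · rw [← continuousWithinAt_Ioi_iff_Ici, ContinuousWithinAt]
    simpa [logScale] using tendsto_logScale K
  · refine ContinuousAt.continuousWithinAt ?_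
    have := Real.continuousAt_log hx0.ne'
    unfold logScale
    exact continuousAt_id.mul ((continuousAt_const.add (continuousAt_const.max this.neg)).pow K)

/-- The power `K ≥ r + 1` beats `|log ε|^r` with one logarithm to spare. -/
theorem tendsto_div_logScale_mul {K : ℕ} {r : ℝ} (hK : r + 1 ≤ K) (hK1 : 1 ≤ K) :
    Tendsto (fun ε : ℝ => ε / logScale K ε * |Real.log ε| ^ r) (𝓝[>] 0) (𝓝 0) := by
  refine squeeze_zero' ?_ ?_ (tendsto_inv_atTop_zero.comp tendsto_abs_log)
  · filter_upwards [eventually_pos_lt one_pos] with ε hε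
    have := logScale_pos hK1 hε.1
    have := hε.1
    positivity
  · filter_upwards [tendsto_abs_log.eventually_ge_atTop 1, eventually_pos_lt one_pos] with ε hl hε
    have hl0 : 0 < |Real.log ε| := by linarith
    have hK0 : (0 : ℝ) ≤ K := Nat.cast_nonneg K
    rw [logScale_eq hε.1 hε.2]
    simp only [Function.comp]
    have h1 : |Real.log ε| ^ (r + 1) ≤ (K + |Real.log ε|) ^ K := by
      calc |Real.log ε| ^ (r + 1) ≤ |Real.log ε| ^ (K : ℝ) :=
            Real.rpow_le_rpow_of_exponent_le hl hK
        _ = |Real.log ε| ^ K := Real.rpow_natCast _ _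
        _ ≤ _ := by gcongr; linarith
    rw [Real.rpow_add hl0, Real.rpow_one] at h1
    have hε0 := hε.1
    rw [show ε / (ε * (K + |Real.log ε|) ^ K) * |Real.log ε| ^ r =
      |Real.log ε| ^ r / (K + |Real.log ε|) ^ K by field_simp, div_le_iff₀ (by positivity),
      inv_mul_eq_div, le_div_iff₀ hl0]
    exact h1

theorem tendsto_log_add_div_rpow (K : ℝ) {r : ℝ} (hr : 0 < r) :
    Tendsto (fun ε : ℝ => Real.log (K + |Real.log ε|) / |Real.log ε| ^ r) (𝓝[>] 0) (𝓝 0) := by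
  have h1 : Tendsto (fun ε : ℝ => K + |Real.log ε|) (𝓝[>] 0) atTop :=
    tendsto_atTop_add_const_left _ K tendsto_abs_log
  have h2 := ((isLittleO_log_rpow_atTop hr).tendsto_div_nhds_zero).comp h1
  have h3 := ((tendsto_add_div K).rpow_const (Or.inl one_ne_zero) (p := r))
  have h4 := h2.mul h3
  rw [zero_mul] at h4
  refine h4.congr' ?_
  filter_upwards [tendsto_abs_log.eventually_gt_atTop 0, h1.eventually_gt_atTop 0] with ε hl hK
  simp only [Function.comp]
  rw [Real.div_rpow hK.le hl.le]
  have : 0 < (K + |Real.log ε|) ^ r := Real.rpow_pos_of_pos hK r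
  field_simp

/-- The ratio of the logarithms of the two scales. -/
def logRatio (K : ℕ) (ε : ℝ) : ℝ := 1 - K * (Real.log (K + |Real.log ε|) / |Real.log ε|)

theorem tendsto_logRatio (K : ℕ) : Tendsto (logRatio K) (𝓝[>] 0) (𝓝 1) := by
  have h1 := (tendsto_log_add_div_rpow K one_pos).const_mul (K : ℝ)
  simp only [Real.rpow_one, mul_zero] at h1
  have h2 := h1.const_sub 1
  rwa [sub_zero] at h2

theorem abs_log_logScale {K : ℕ} (hK : 1 ≤ K) : ∀ᶠ ε in 𝓝[>] (0 : ℝ),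
    |Real.log (logScale K ε)| = |Real.log ε| * logRatio K ε := by
  filter_upwards [tendsto_abs_log.eventually_gt_atTop 0, eventually_pos_lt one_pos,
    (tendsto_logScale K).eventually_lt_const one_pos] with ε hl hε hδ
  have hδ0 := logScale_pos hK hε.1
  have hK' : (1 : ℝ) ≤ K := by exact_mod_cast hK
  rw [abs_of_neg (Real.log_neg hδ0 hδ), logScale_eq hε.1 hε.2,
    Real.log_mul hε.1.ne' (by positivity), Real.log_pow, logRatio]
  have : Real.log ε = -|Real.log ε| := by rw [abs_of_neg (Real.log_neg hε.1 hε.2), neg_neg]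
  rw [this]
  simp only [abs_neg, abs_abs]
  field_simp
  ring

theorem tendsto_abs_log_logScale {K : ℕ} (hK : 1 ≤ K) :
    Tendsto (fun ε => |Real.log (logScale K ε)|) (𝓝[>] 0) atTop :=
  (tendsto_abs_log.atTop_mul_pos one_pos (tendsto_logRatio K)).congr'
    ((abs_log_logScale hK).mono fun _ h => h.symm)

theorem tendsto_abs_log_rpow_div {K : ℕ} (hK : 1 ≤ K) (h : ℝ) :
    Tendsto (fun ε => |Real.log ε| ^ h / |Real.log (logScale K ε)| ^ h) (𝓝[>] 0) (𝓝 1) := by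
  have h1 := ((tendsto_logRatio K).rpow_const (Or.inl one_ne_zero) (p := h)).inv₀ (by simp)
  rw [Real.one_rpow, inv_one] at h1
  refine h1.congr' ?_
  filter_upwards [tendsto_abs_log.eventually_gt_atTop 0, abs_log_logScale hK,
    (tendsto_logRatio K).eventually_const_lt one_pos] with ε hl he hr
  rw [he, Real.mul_rpow hl.le hr.le]
  have : 0 < |Real.log ε| ^ h := Real.rpow_pos_of_pos hl h
  have : 0 < logRatio K ε ^ h := Real.rpow_pos_of_pos hr h
  field_simp

/-- The measures are divided by different powers of logarithms at the two scales, while their norm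
before division is of order `√(|log ε|^h)`. With `l = |log ε|`, the normalizations differ relatively
by `O(log l / l)`, and `h ≥ 1` gives `l^(1-h) l^(h/2) ≤ l^(1/2)`, so the product tends to zero. -/
theorem tendsto_renormalization {K : ℕ} (hK : 1 ≤ K) {h : ℝ} (hh : 1 ≤ h) :
    Tendsto (fun ε => |1 / |Real.log ε| ^ (h - 1) - 1 / |Real.log (logScale K ε)| ^ (h - 1)| *
      √(|Real.log ε| ^ h)) (𝓝[>] 0) (𝓝 0) := by
  -- Differentiability of the power at one makes the relative error linear in `logRatio K ε - 1`.
  have h1 : (fun x : ℝ => x ^ (1 - h) - 1 ^ (1 - h)) =O[𝓝 1] fun x => x - 1 :=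
    (Real.hasDerivAt_rpow_const (Or.inl one_ne_zero)).isBigO_sub
  have h2 := h1.comp_tendsto (tendsto_logRatio K)
  obtain ⟨c, hc⟩ := h2.bound
  have h3 := (tendsto_log_add_div_rpow K (r := 1 / 2) (by norm_num)).norm.const_mul (c * K)
  rw [norm_zero, mul_zero] at h3
  refine squeeze_zero' (Eventually.of_forall fun ε => by positivity) ?_ h3
  filter_upwards [tendsto_abs_log.eventually_ge_atTop 1, abs_log_logScale hK,
    (tendsto_logRatio K).eventually_const_lt one_pos, hc] with ε hl he hr hcε
  have hl0 : 0 < |Real.log ε| := by linarith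
  set l := |Real.log ε|
  simp only [Function.comp, Real.one_rpow, Real.norm_eq_abs] at hcε
  rw [he, Real.mul_rpow hl0.le hr.le]
  have e1 : 1 / l ^ (h - 1) - 1 / (l ^ (h - 1) * logRatio K ε ^ (h - 1)) =
      -(l ^ (1 - h) * (logRatio K ε ^ (1 - h) - 1)) := by
    rw [show 1 - h = -(h - 1) by ring, Real.rpow_neg hl0.le, Real.rpow_neg hr.le]
    have : 0 < l ^ (h - 1) := Real.rpow_pos_of_pos hl0 _
    have : 0 < logRatio K ε ^ (h - 1) := Real.rpow_pos_of_pos hr _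
    field_simp
    ring
  have e2 : |logRatio K ε - 1| = K * (|Real.log (K + l)| / l) := by
    rw [logRatio, show ∀ z : ℝ, 1 - z - 1 = -z from fun z => by ring, abs_neg, abs_mul, abs_div,
      abs_of_pos hl0, abs_of_nonneg (Nat.cast_nonneg K)]
  rw [e2] at hcε
  have e3 : l ^ (1 - h) * √(l ^ h) ≤ l ^ (1 / 2 : ℝ) := by
    rw [Real.sqrt_eq_rpow, ← Real.rpow_mul hl0.le, ← Real.rpow_add hl0]
    exact Real.rpow_le_rpow_of_exponent_le hl (by linarith)
  have e4 : l ^ (1 / 2 : ℝ) * l ^ (1 / 2 : ℝ) = l := by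
    rw [← Real.rpow_add hl0]; norm_num
  have e5 : 0 < l ^ (1 / 2 : ℝ) := Real.rpow_pos_of_pos hl0 _
  rw [e1, abs_neg, abs_mul, abs_of_pos (Real.rpow_pos_of_pos hl0 _), Real.norm_eq_abs, abs_div,
    abs_of_pos e5]
  calc l ^ (1 - h) * |logRatio K ε ^ (1 - h) - 1| * √(l ^ h)
      = (l ^ (1 - h) * √(l ^ h)) * |logRatio K ε ^ (1 - h) - 1| := by ring
    _ ≤ l ^ (1 / 2 : ℝ) * (c * (K * (|Real.log (K + l)| / l))) := by gcongr
    _ = l ^ (1 / 2 : ℝ) * (c * (K * (|Real.log (K + l)| /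
          (l ^ (1 / 2 : ℝ) * l ^ (1 / 2 : ℝ))))) := by rw [e4]
    _ = _ := by field_simp

end

/-! ### Passing to the limit in the two recovery constructions -/

section

variable {Ω : Set Plane} {ε : ℝ}

/-! ### Recovery at a logarithmically larger scale -/

theorem SingSpace.smul_smul (c d : ℝ) (S : SingSpace Ω) : c • d • S = (c * d) • S := by
  ext φ
  exact (mul_assoc c d (S φ)).symm

theorem SingSpace.dist_smul_right (c d : ℝ) (S : SingSpace Ω) :
    dist (c • S) (d • S) = |c - d| * ‖S‖ := by
  rw [dist_eq_norm, ← SingSpace.norm_smul]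
  congr 1
  ext φ
  exact (sub_mul c d (S φ)).symm

theorem one_div_pi_mul_smul (l : ℝ) (S : SingSpace Ω) :
    (1 / (Real.pi * l)) • S = (1 / l) • (1 / Real.pi) • S := by
  rw [SingSpace.smul_smul]
  congr 1
  rw [one_div_mul_one_div, mul_comm]

/-- Since `ε/δ → 0` the potential of the interpolant disappears, and since `|log δ|/|log ε| → 1` the
change of scale does not affect the renormalized energy. -/
theorem asympLE_singGL_singXY (hopen : IsOpen Ω) (hbdd : Bornology.IsBounded Ω)
    (hlip : HasLipschitzBoundary Ω) {h : ℝ} (hh : 1 ≤ h) :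
    AsympLE (singGL Ω h) (singXY Ω h) := by
  obtain ⟨K, hK⟩ := exists_nat_ge (h + 1)
  have hK1 : 1 ≤ K := by
    have : (1 : ℝ) ≤ K := by linarith
    exact_mod_cast this
  obtain ⟨M, hM, d, hd, hrec⟩ := exists_sobolevMap_of_spin hopen hbdd hlip
  obtain ⟨N, hN, hnorm⟩ := exists_norm_vorticityMeasure_le hbdd
  refine asympLE_of_eventually (logScale K) (logScale_continuousOn K)
    (logScale_strictMonoOn hK1) (by simp [logScale]) ?_
  intro C η hη
  have hC0 : (0 : ℝ) ≤ C := C.2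
  have hid : Tendsto (fun ε : ℝ => ε) (𝓝[>] 0) (𝓝 0) := tendsto_nhdsWithin_of_tendsto_nhds tendsto_id
  have hratio : Tendsto (fun ε : ℝ => ε / logScale K ε) (𝓝[>] 0) (𝓝 0) := by
    simpa using tendsto_div_logScale_mul (K := K) (r := 0) (by linarith) hK1
  have hA : Tendsto (fun ε : ℝ => (1 + M * ε) * ((1 + ε) ^ 2 + 12 * (ε / logScale K ε) ^ 2) *
      (|Real.log ε| ^ h / |Real.log (logScale K ε)| ^ h)) (𝓝[>] 0) (𝓝 1) := by
    have := (((hid.const_mul M).const_add 1).mul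
      (((hid.const_add 1).pow 2).add ((hratio.pow 2).const_mul 12))).mul
      (tendsto_abs_log_rpow_div hK1 h)
    simpa using this
  have hD : Tendsto (fun ε : ℝ => |1 / |Real.log ε| ^ (h - 1) -
      1 / |Real.log (logScale K ε)| ^ (h - 1)| * √(|Real.log ε| ^ h) * (N * √(C + 1)) +
      ε * |Real.log ε| ^ h * (M * (C + 1))) (𝓝[>] 0) (𝓝 0) := by
    have := ((tendsto_renormalization hK1 hh).mul_const (N * √((C : ℝ) + 1))).add
      ((tendsto_mul_abs_log_rpow h).mul_const (M * ((C : ℝ) + 1)))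
    simpa using this
  filter_upwards [eventually_pos_lt one_pos, eventually_pos_lt hd,
    tendsto_abs_log.eventually_ge_atTop 1, (tendsto_abs_log_logScale hK1).eventually_ge_atTop 1,
    hratio.eventually_lt_const one_pos,
    hA.eventually_lt_const (show (1 : ℝ) < 1 + η / (2 * (C + 1)) by
      linarith [show 0 < η / (2 * ((C : ℝ) + 1)) by positivity]),
    hD.eventually_lt_const hη] with ε ⟨hε, hε1⟩ ⟨_, hεd⟩ hl hl' hr hAε hDε p hp
  set δ := logScale K ε with hδdef
  have hδ : 0 < δ := logScale_pos hK1 hε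
  set l := |Real.log ε| with hldef
  set l' := |Real.log δ| with hl'def
  have hl0 : 0 < l := by linarith
  have hl'0 : 0 < l' := by linarith
  have hlh : 0 < l ^ h := Real.rpow_pos_of_pos hl0 h
  have hl'h : 0 < l' ^ h := Real.rpow_pos_of_pos hl'0 h
  have hl'h1 : 1 ≤ l' ^ (h - 1) := Real.one_le_rpow hl' (by linarith)
  -- The slack of the almost minimizer uses half of `η`; the other half pays for the multiplicative
  -- error, applied to `e + κ ≤ C + 1`.
  set κ : ℝ := min 1 (η / 2) with hκ
  have hκ0 : 0 < κ := by positivity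
  have hFtop : singXY Ω h ε p ≠ ⊤ := ne_top_of_le_ne_top ENNReal.coe_ne_top hp
  obtain ⟨v, hv, hEv⟩ := exists_le_of_iInf_div (η := ENNReal.ofReal κ)
    (ENNReal.ofReal_pos.2 hlh).ne' ENNReal.ofReal_ne_top (ENNReal.ofReal_pos.2 hκ0).ne' hFtop
  change energyXY v ≤ (singXY Ω h ε p + ENNReal.ofReal κ) * ENNReal.ofReal (l ^ h) at hEv
  set e := (singXY Ω h ε p).toReal with he
  have hFe : singXY Ω h ε p = ENNReal.ofReal e := (ENNReal.ofReal_toReal hFtop).symm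
  have he0 : 0 ≤ e := ENNReal.toReal_nonneg
  have heC : e ≤ C := by
    rw [he]; exact ENNReal.toReal_le_coe_of_le_coe hp
  have heκ : e + κ ≤ C + 1 := add_le_add heC (min_le_left _ _)
  rw [hFe, ← ENNReal.ofReal_add he0 hκ0.le, ← ENNReal.ofReal_mul (by positivity)] at hEv
  set E := (e + κ) * l ^ h with hE
  have hE0 : 0 ≤ E := by positivity
  have hEC : E ≤ (C + 1) * l ^ h := by rw [hE]; gcongr
  -- The slope tolerance `θ` is taken equal to `ε`.
  obtain ⟨w, hw1, hw2⟩ := hrec ε δ ε E hε hεd.le hδ ((div_lt_one hδ).1 hr).le hε hε1.le hE0 v hEv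
  refine ⟨(1 / (Real.pi * l' ^ (h - 1))) • w.jac, ?_, ?_⟩
  · refine (singGL_le h w).trans (ENNReal.div_le_of_le_mul (hw1.trans ?_))
    rw [hFe, ← ENNReal.ofReal_add he0 hη.le, ← ENNReal.ofReal_mul (by positivity)]
    refine ENNReal.ofReal_le_ofReal ?_
    change _ ≤ (e + η) * l' ^ h
    calc (1 + M * ε) * (((1 + ε) ^ 2 + 12 * (ε / δ) ^ 2) * E)
        = (1 + M * ε) * ((1 + ε) ^ 2 + 12 * (ε / δ) ^ 2) * (l ^ h / l' ^ h) * (e + κ) * l' ^ h := by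
          rw [hE]; field_simp
      _ ≤ (1 + η / (2 * (C + 1))) * (e + κ) * l' ^ h := by gcongr
      _ ≤ (e + η) * l' ^ h := by
          refine mul_le_mul_of_nonneg_right ?_ hl'h.le
          have h1 : η / (2 * (C + 1)) * (e + κ) ≤ η / (2 * (C + 1)) * (C + 1) := by gcongr
          have h2 : η / (2 * ((C : ℝ) + 1)) * (C + 1) = η / 2 := by field_simp
          linarith [min_le_right 1 (η / 2)]
  · rw [one_div_pi_mul_smul, ← hv]
    -- The normalization is changed with the measure fixed, then the measure is changed with the
    -- normalization fixed.
    refine (dist_triangle _ ((1 / l' ^ (h - 1)) • vorticityMeasure v) _).trans ?_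
    rw [SingSpace.dist_smul_right, SingSpace.dist_smul, abs_of_pos (by positivity : 0 < 1 / l' ^ (h - 1))]
    refine le_trans ?_ hDε.le
    refine add_le_add ?_ ?_
    · rw [mul_assoc]
      refine mul_le_mul_of_nonneg_left ?_ (abs_nonneg _)
      calc ‖vorticityMeasure v‖ ≤ N * √E := hnorm ε hε hε1.le v E hE0 hEv
        _ ≤ N * √((C + 1) * l ^ h) := by gcongr
        _ = √(l ^ h) * (N * √(C + 1)) := by rw [Real.sqrt_mul (by positivity)]; ring
    · calc 1 / l' ^ (h - 1) * dist (vorticityMeasure v) ((1 / Real.pi) • w.jac)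
          ≤ 1 * (M * ε * E) := by
            gcongr
            rw [div_le_one (by positivity)]
            exact hl'h1
        _ ≤ 1 * (M * ε * ((C + 1) * l ^ h)) := by gcongr
        _ = _ := by ring

-- The modulus on the grid of step `δ` is close to one as soon as `(ε/δ)|log ε|^h → 0`, which is why
-- `K ≥ h + 1`. The distance error is of order `δ|log ε|^h` and still vanishes.
set_option maxHeartbeats 600000 in
theorem asympLE_singSD_singGL (hopen : IsOpen Ω) (hbdd : Bornology.IsBounded Ω)
    (hlip : HasLipschitzBoundary Ω) {h : ℝ} (hh : 1 ≤ h) :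
    AsympLE (singSD Ω h) (singGL Ω h) := by
  obtain ⟨K, hK⟩ := exists_nat_ge (h + 1)
  have hK1 : 1 ≤ K := by
    have : (1 : ℝ) ≤ K := by linarith
    exact_mod_cast this
  obtain ⟨M, hM, d, hd, hrec⟩ := exists_displacement_of_sobolevMap hopen hbdd hlip
  obtain ⟨N, hN, hnorm⟩ := exists_norm_dislocationMeasure_le hbdd
  have hpi : 1 ≤ 4 * Real.pi ^ 2 := by nlinarith [Real.pi_gt_three]
  refine asympLE_of_eventually (logScale K) (logScale_continuousOn K)
    (logScale_strictMonoOn hK1) (by simp [logScale]) ?_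
  intro C η hη
  have hC0 : (0 : ℝ) ≤ C := C.2
  have hδ0 := tendsto_logScale K
  have hratio : Tendsto (fun ε : ℝ => ε / logScale K ε) (𝓝[>] 0) (𝓝 0) := by
    simpa using tendsto_div_logScale_mul (K := K) (r := 0) (by linarith) hK1
  -- The modulus threshold is `ζ = τ^(1/4)`: it tends to zero, while the smallness condition,
  -- implied by `16(C + 2)τ < ζ² = √τ`, eventually holds.
  set τ : ℝ → ℝ := fun ε => ε / logScale K ε * |Real.log ε| ^ h with hτ
  have hτ0 : Tendsto (fun ε => √(τ ε)) (𝓝[>] 0) (𝓝 0) := by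
    simpa using (tendsto_div_logScale_mul (K := K) (r := h) hK hK1).sqrt
  have hζ0 : Tendsto (fun ε => √√(τ ε)) (𝓝[>] 0) (𝓝 0) := by simpa using hτ0.sqrt
  have hA : Tendsto (fun ε : ℝ => (1 + M * logScale K ε) / (1 - √√(τ ε)) ^ 2 *
      (|Real.log ε| ^ h / |Real.log (logScale K ε)| ^ h)) (𝓝[>] 0) (𝓝 1) := by
    have := (((hδ0.const_mul M).const_add 1).div ((hζ0.const_sub 1).pow 2) (by simp)).mul
      (tendsto_abs_log_rpow_div hK1 h)
    simpa using this
  have hD : Tendsto (fun ε : ℝ => logScale K ε * |Real.log ε| ^ h * (M * (C + 2)) +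
      |1 / |Real.log ε| ^ (h - 1) - 1 / |Real.log (logScale K ε)| ^ (h - 1)| *
        √(|Real.log ε| ^ h) * (N * √(8 * (C + 1)))) (𝓝[>] 0) (𝓝 0) := by
    have := ((tendsto_logScale_mul K h).mul_const (M * ((C : ℝ) + 2))).add
      ((tendsto_renormalization hK1 hh).mul_const (N * √(8 * ((C : ℝ) + 1))))
    simpa using this
  have hMδ : Tendsto (fun ε : ℝ => M * logScale K ε) (𝓝[>] 0) (𝓝 0) := by
    simpa using hδ0.const_mul M
  have hsm : Tendsto (fun ε : ℝ => 16 * (C + 2) * √(τ ε)) (𝓝[>] 0) (𝓝 0) := by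
    simpa using hτ0.const_mul (16 * ((C : ℝ) + 2))
  filter_upwards [eventually_pos_lt one_pos,
    hδ0.eventually_lt_const (show 0 < min (min d 1) (min (1 / 2) (η / 4)) by positivity),
    tendsto_abs_log.eventually_ge_atTop 1, (tendsto_abs_log_logScale hK1).eventually_ge_atTop 1,
    hratio.eventually_lt_const (show (0 : ℝ) < 1 / 2 by norm_num),
    hA.eventually_lt_const (show (1 : ℝ) < 1 + η / (2 * (C + 1)) by
      linarith [show 0 < η / (2 * ((C : ℝ) + 1)) by positivity]),
    hD.eventually_lt_const hη, hζ0.eventually_lt_const (show (0 : ℝ) < 1 / 2 by norm_num),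
    hMδ.eventually_lt_const one_pos, hsm.eventually_lt_const one_pos]
    with ε ⟨hε, hε1⟩ hδlt hl hl' hr hAε hDε hζ hMδε hsmε p hp
  simp only [lt_min_iff] at hδlt
  obtain ⟨⟨hδd, hδ1⟩, hδ2, hδη⟩ := hδlt
  set δ := logScale K ε with hδdef
  have hδ : 0 < δ := logScale_pos hK1 hε
  set l := |Real.log ε| with hldef
  set l' := |Real.log δ| with hl'def
  have hl0 : 0 < l := by linarith
  have hl'0 : 0 < l' := by linarith
  have hlh : 0 < l ^ h := Real.rpow_pos_of_pos hl0 h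
  have hlh1 : 1 ≤ l ^ h := Real.one_le_rpow hl (by linarith)
  have hl'h : 0 < l' ^ h := Real.rpow_pos_of_pos hl'0 h
  have hlhm1 : 1 ≤ l ^ (h - 1) := Real.one_le_rpow hl (by linarith)
  have hτpos : 0 < τ ε := by simp only [hτ]; positivity
  set ζ := √√(τ ε) with hζdef
  have hζpos : 0 < ζ := Real.sqrt_pos.2 (Real.sqrt_pos.2 hτpos)
  have hζsq : ζ ^ 2 = √(τ ε) := Real.sq_sqrt (Real.sqrt_nonneg _)
  have h1ζ : 0 < (1 - ζ) ^ 2 := pow_pos (by linarith) 2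
  set κ : ℝ := min (1 / 2) (η / 4) with hκ
  have hκ0 : 0 < κ := by positivity
  have hFtop : singGL Ω h ε p ≠ ⊤ := ne_top_of_le_ne_top ENNReal.coe_ne_top hp
  obtain ⟨w, hw, hEw⟩ := exists_le_of_iInf_div (η := ENNReal.ofReal κ)
    (ENNReal.ofReal_pos.2 hlh).ne' ENNReal.ofReal_ne_top (ENNReal.ofReal_pos.2 hκ0).ne' hFtop
  change w.energy ε ≤ (singGL Ω h ε p + ENNReal.ofReal κ) * ENNReal.ofReal (l ^ h) at hEw
  set e := (singGL Ω h ε p).toReal with he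
  have hFe : singGL Ω h ε p = ENNReal.ofReal e := (ENNReal.ofReal_toReal hFtop).symm
  have he0 : 0 ≤ e := ENNReal.toReal_nonneg
  have heC : e ≤ C := by
    rw [he]; exact ENNReal.toReal_le_coe_of_le_coe hp
  have hκ2 : κ ≤ 1 / 2 := min_le_left _ _
  have hκη : κ ≤ η / 4 := min_le_right _ _
  rw [hFe, ← ENNReal.ofReal_add he0 hκ0.le, ← ENNReal.ofReal_mul (by positivity)] at hEw
  set E := (e + κ) * l ^ h with hE
  have hE0 : 0 ≤ E := by positivity
  have hEδ : E + δ ≤ (e + κ + δ) * l ^ h := by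
    rw [hE, add_mul (e + κ)]
    linarith [le_mul_of_one_le_right hδ.le hlh1]
  have hEC : E + 1 ≤ (C + 2) * l ^ h := by
    calc E + 1 ≤ (C + 1) * l ^ h + 1 * l ^ h := by
          rw [hE]; gcongr
          · linarith
          · linarith
      _ = _ := by ring
  have hsmall : 16 * ((E + 1) / δ) * ε < ζ ^ 2 := by
    have h1 : 16 * ((E + 1) / δ) * ε ≤ 16 * ((C + 2) * l ^ h / δ) * ε := by gcongr
    have h2 : 16 * ((C + 2) * l ^ h / δ) * ε = 16 * (C + 2) * √(τ ε) * √(τ ε) := by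
      rw [mul_assoc _ (√(τ ε)), Real.mul_self_sqrt hτpos.le]
      simp only [hτ]
      ring
    rw [hζsq]
    refine h1.trans_lt (h2.trans_lt ?_)
    exact mul_lt_of_lt_one_left (Real.sqrt_pos.2 hτpos) hsmε
  obtain ⟨u, hu1, hu2⟩ := hrec ε δ ζ E hε hδ hδd.le
    (by rw [div_lt_iff₀ hδ] at hr; linarith) hζpos hζ.le hE0 hsmall w hEw
  refine ⟨(1 / l' ^ (h - 1)) • dislocationMeasure u, ?_, ?_⟩
  · refine (singSD_le h u).trans (ENNReal.div_le_of_le_mul (hu1.trans ?_))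
    rw [hFe, ← ENNReal.ofReal_add he0 hη.le, ← ENNReal.ofReal_mul (by positivity)]
    refine ENNReal.ofReal_le_ofReal ?_
    change _ ≤ (e + η) * l' ^ h
    calc (1 + M * δ) * (E + δ) / (1 - ζ) ^ 2
        ≤ (1 + M * δ) * ((e + κ + δ) * l ^ h) / (1 - ζ) ^ 2 := by gcongr
      _ = (1 + M * δ) / (1 - ζ) ^ 2 * (l ^ h / l' ^ h) * (e + κ + δ) * l' ^ h := by field_simp
      _ ≤ (1 + η / (2 * (C + 1))) * (e + κ + δ) * l' ^ h := by gcongr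
      _ ≤ (e + η) * l' ^ h := by
          refine mul_le_mul_of_nonneg_right ?_ hl'h.le
          have h1 : η / (2 * (C + 1)) * (e + κ + δ) ≤ η / (2 * (C + 1)) * (C + 1) := by
            exact mul_le_mul_of_nonneg_left (by linarith) (by positivity)
          have h2 : η / (2 * ((C : ℝ) + 1)) * (C + 1) = η / 2 := by field_simp
          linarith
  -- A crude bound suffices for the norm: the factor `4π² ≥ 1` is dropped, `1 + Mδ ≤ 2` and `(1 -
  -- ζ)² ≥ 1/4`.
  · have hu3 : energySD u ≤ ENNReal.ofReal (8 * (C + 1) * l ^ h) := by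
      refine le_trans (le_mul_of_one_le_left (zero_le) ?_) (hu1.trans (ENNReal.ofReal_le_ofReal ?_))
      · rwa [ENNReal.one_le_ofReal]
      · rw [div_le_iff₀ h1ζ]
        have h1 : 1 / 4 ≤ (1 - ζ) ^ 2 := by
          rw [show (1 / 4 : ℝ) = (1 / 2) ^ 2 by norm_num]
          exact pow_le_pow_left₀ (by norm_num) (by linarith) 2
        have h2 : E + δ ≤ (C + 1) * l ^ h := hEδ.trans (mul_le_mul_of_nonneg_right (by linarith) hlh.le)
        calc (1 + M * δ) * (E + δ) ≤ 2 * ((C + 1) * l ^ h) := by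
              gcongr
              linarith
          _ = 8 * (C + 1) * l ^ h * (1 / 4) := by ring
          _ ≤ _ := by gcongr
    rw [← hw, one_div_pi_mul_smul]
    refine (dist_triangle _ ((1 / l ^ (h - 1)) • dislocationMeasure u) _).trans ?_
    rw [SingSpace.dist_smul_right, SingSpace.dist_smul, dist_comm,
      abs_of_pos (by positivity : 0 < 1 / l ^ (h - 1))]
    refine le_trans ?_ hDε.le
    refine add_le_add ?_ ?_
    · calc 1 / l ^ (h - 1) * dist (dislocationMeasure u) ((1 / Real.pi) • w.jac)
          ≤ 1 * (M * δ * (E + 1)) := by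
            gcongr
            rw [div_le_one (by positivity)]
            exact hlhm1
        _ ≤ 1 * (M * δ * ((C + 2) * l ^ h)) := by gcongr
        _ = _ := by ring
    · rw [mul_assoc]
      refine mul_le_mul_of_nonneg_left ?_ (abs_nonneg _)
      calc ‖dislocationMeasure u‖ ≤ N * √(8 * (C + 1) * l ^ h) :=
            hnorm δ hδ hδ1.le u _ (by positivity) hu3
        _ = √(l ^ h) * (N * √(8 * (C + 1))) := by rw [Real.sqrt_mul (by positivity)]; ring

end

end TopSing

end

theorem theorem5p1 (Ω : Set TopSing.Plane) (hopen : IsOpen Ω) (hbdd : Bornology.IsBounded Ω)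
    (hlip : TopSing.HasLipschitzBoundary Ω) (hstar : StarConvex ℝ 0 Ω)
    (h : ℝ) (hh : 1 ≤ h) :
    TopSing.VarEquiv (TopSing.singGL Ω h) (TopSing.singXY Ω h) ∧
    TopSing.VarEquiv (TopSing.singXY Ω h) (TopSing.singSD Ω h) ∧
    TopSing.VarEquiv (TopSing.singGL Ω h) (TopSing.singSD Ω h) := by
  have hXYSD := TopSing.asympLE_singXY_singSD hbdd h
  have hGLXY := TopSing.asympLE_singGL_singXY hopen hbdd hlip hh
  have hSDGL := TopSing.asympLE_singSD_singGL hopen hbdd hlip hh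
  -- Each comparison against the direction of the cycle is the composition of the other two arrows.
  exact ⟨⟨hGLXY.varLE, (hXYSD.trans hSDGL).varLE⟩, ⟨hXYSD.varLE, (hSDGL.trans hGLXY).varLE⟩,
    ⟨(hGLXY.trans hXYSD).varLE, hSDGL.varLE⟩⟩
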